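/- Let $G$ be a finite group. A semi-Mackey functor on $G$ is a pair $M=(M^*,M_*)$ of a contravariant and a covariant functor from finite $G$-sets to sets, agreeing on objects, such that $M^*$ sends finite coproducts to products and the Mackey (base change) condition holds for pullback squares; each $M(X)$ is then a commutative monoid. A Tambara functor $T=(T^*,T_+,T_\bullet)$ is a triple such that $T^\alpha=(T^*,T_+)$ and $T^\mu=(T^*,T_\bullet)$ are semi-Mackey functors, the distributive law holds for exponential diagrams, and each $T(X)$ is a ring. Let $\mathrm{SMack}_G$ and $\mathrm{Tam}_G$ be the resulting categories, and for a Tambara functor $T$ let $T\text{-}\mathrm{Tam}_G=T/\mathrm{Tam}_G$ be the category of $T$-Tambara functors. Let $\otimes_\Omega$ denote the tensor product of Tambara functors, that is, the tensor product of the additive Mackey functors over the Burnside functor $\Omega$, equipped with the multiplicative transfers $$f_\bullet[t\otimes s]_{(A,p)}=[f'_\bullet e^*(t)\otimes f'_\bullet e^*(s)]_{(\Pi_f(A),\pi)},$$ where $X\xleftarrow{p}A\xleftarrow{e}X\times_Y\Pi_f(A)\xrightarrow{f'}\Pi_f(A)\xrightarrow{\pi}Y$ is the canonical exponential diagram of $f\colon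 X\to Y$ and $p\colon A\to X$; and let $\iota_T\colon T\to T\otimes_\Omega S$ be $t\mapsto[t\otimes1]_{(X,\mathrm{id})}$. **Theorem.** The following functors exist: the tensor product $\otimes_\Omega\colon\mathrm{Tam}_G\times\mathrm{Tam}_G\to\mathrm{Tam}_G$; a left adjoint $\mathcal T$ of $(-)^\mu\colon\mathrm{Tam}_G\to\mathrm{SMack}_G$; for $K=G$ and for $K=N_G(H)/H$ with $H\le G$ any subgroup, a left adjoint $\mathcal L^K$, $Q\mapsto\mathcal L^K_Q$, of $\mathrm{SMack}_K\to\mathrm{Mon}$, $M\mapsto M(K/e)^K$, where $\mathrm{Mon}$ is the category of commutative monoids; and, for each $H\le G$ and $K=N_G(H)/H$, a left adjoint $L_U$ of $\mathrm{SMack}_G\to\mathrm{SMack}_K$, $M\mapsto M(U\circ_K-)$, where $U=G/H$ with its left $G$-action and right $K$-action. For any choice of these functors put $$\mathcal F(T,M)=T[M]=T\otimes_\Omega\mathcal T(M),\qquad \mathfrak X_H=L_U(\mathcal L^K_{\mathbb N})\in\mathrm{SMack}_G\quad(K=N_G(H)/H),$$ and regard $T[M]$ as a $T$-Tambara functor through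 $\iota_T$. Then: 1. For every $H\le G$, every Tambara functor $T$ and every $T$-Tambara functor $S$ there is a bijection $$T\text{-}\mathrm{Tam}_G(T[\mathfrak X_H],S)\;\cong\;S(G/H)^{N_G(H)/H},$$ natural in $S$ and compatible with change of $T$. Here $T[\mathfrak X_H]$ is the value at $T$ of the functor $\mathit{pol}_{\mathfrak X_H}=\mathcal F(-,\mathfrak X_H)\colon\mathrm{Tam}_G\to\mathrm{Tam}_G$. 2. For $H=G$: $\mathfrak X_G\cong\mathfrak A^\alpha$, the additive part of the Burnside semi-ring functor $\mathfrak A(X)=\{\text{isomorphism classes of finite }G\text{-sets over }X\}$; and there are isomorphisms of $T$-Tambara functors $T[\mathfrak X_G]\cong T[\mathbf X]:=T[\mathfrak A^\alpha]$, natural in $T$. 3. For $H=e$: $\mathfrak X_e\cong\mathcal L^G_{\mathbb N}$; and there are isomorphisms of $T$-Tambara functors $T[\mathfrak X_e]\cong T[\mathbf x]:=T[\mathcal L^G_{\mathbb N}]$, natural in $T$. -/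

import Mathlib

open CategoryTheory

universe u v w

/-! ## Finite `G`-sets -/

/-- A finite set with a left action of `G`. -/
structure FinGSet (G : Type u) [Group G] where
  carrier : Type u
  [finite_carrier : Finite carrier]
  [mulAction : MulAction G carrier]

namespace FinGSet

variable {G : Type u} [Group G]

instance : CoeSort (FinGSet.{u} G) (Type u) := ⟨FinGSet.carrier⟩

attribute [instance] FinGSet.finite_carrier FinGSet.mulAction

/-- The category of finite `G`-sets and `G`-equivariant maps. -/
instance : Category.{u} (FinGSet.{u} G) where
  Hom X Y := X →[G] Y
  id X := MulActionHom.id G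
  comp f g := MulActionHom.comp g f

instance (X Y : FinGSet.{u} G) : FunLike (X ⟶ Y) X Y :=
  inferInstanceAs (FunLike (X →[G] Y) X Y)

/-- The morphism given by an equivariant map. -/
def homMk {X Y : FinGSet.{u} G} (f : X → Y) (h : ∀ (g : G) (x : X), f (g • x) = g • f x) :
    X ⟶ Y :=
  (⟨f, h⟩ : X →[G] Y)

@[simp] theorem homMk_apply {X Y : FinGSet.{u} G} (f : X → Y)
    (h : ∀ (g : G) (x : X), f (g • x) = g • f x) (x : X) : homMk f h x = f x := rfl

@[simp] theorem id_apply {X : FinGSet.{u} G} (x : X) : (𝟙 X : X ⟶ X) x = x := rfl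

@[simp] theorem comp_apply {X Y Z : FinGSet.{u} G} (f : X ⟶ Y) (g : Y ⟶ Z) (x : X) :
    (f ≫ g) x = g (f x) := rfl

theorem map_smul {X Y : FinGSet.{u} G} (f : X ⟶ Y) (g : G) (x : X) : f (g • x) = g • f x :=
  MulActionHom.map_smul (f : X →[G] Y) g x

theorem hom_ext {X Y : FinGSet.{u} G} {f g : X ⟶ Y} (h : ∀ x, f x = g x) : f = g :=
  DFunLike.ext f g h

theorem congr_hom {X Y : FinGSet.{u} G} {f g : X ⟶ Y} (h : f = g) (x : X) : f x = g x := by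
  rw [h]

theorem comm_apply {X Y Z W : FinGSet.{u} G} {f : X ⟶ Y} {g : Y ⟶ Z} {h : X ⟶ W} {k : W ⟶ Z}
    (e : f ≫ g = h ≫ k) (x : X) : g (f x) = k (h x) :=
  congr_hom e x

/-- A bijective equivariant map is an isomorphism. -/
noncomputable def isoOfBijective {X Y : FinGSet.{u} G} (f : X ⟶ Y) (hf : Function.Bijective f) :
    X ≅ Y where
  hom := f
  inv := homMk (Equiv.ofBijective f hf).symm (fun g y => by
    apply hf.1
    simp only [map_smul, Equiv.ofBijective_apply_symm_apply])
  hom_inv_id := hom_ext fun x => hf.1 (by simp)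
  inv_hom_id := hom_ext fun y => by simp [Equiv.ofBijective_apply_symm_apply]

/-- The empty `G`-set. -/
def empty (G : Type u) [Group G] : FinGSet.{u} G :=
  letI : MulAction G PEmpty.{u + 1} :=
    { smul := fun _ x => x, one_smul := fun _ => rfl, mul_smul := fun _ _ _ => rfl }
  ⟨PEmpty.{u + 1}⟩

/-- The unique map from the empty `G`-set. -/
def fromEmpty (X : FinGSet.{u} G) : empty G ⟶ X :=
  homMk (fun x : PEmpty => x.elim) (fun _ (x : PEmpty) => x.elim)

/-- The coproduct (disjoint union) of two `G`-sets. -/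
def sum (X Y : FinGSet.{u} G) : FinGSet.{u} G := ⟨X ⊕ Y⟩

def inl (X Y : FinGSet.{u} G) : X ⟶ sum X Y := homMk (fun x => (Sum.inl x : X ⊕ Y)) fun _ _ => rfl

def inr (X Y : FinGSet.{u} G) : Y ⟶ sum X Y := homMk (fun y => (Sum.inr y : X ⊕ Y)) fun _ _ => rfl

/-- The map out of a coproduct given by a pair of maps. -/
def copair {X Y Z : FinGSet.{u} G} (f : X ⟶ Z) (g : Y ⟶ Z) : sum X Y ⟶ Z :=
  homMk (fun s : X ⊕ Y => Sum.elim f g s) (fun a (s : X ⊕ Y) => by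
    cases s with
    | inl x => exact map_smul f a x
    | inr y => exact map_smul g a y)

/-- The codiagonal `X ⊔ X ⟶ X`. -/
def fold (X : FinGSet.{u} G) : sum X X ⟶ X := copair (𝟙 X) (𝟙 X)

@[simp] theorem copair_inl {X Y Z : FinGSet.{u} G} (f : X ⟶ Z) (g : Y ⟶ Z) (x : X) :
    copair f g (Sum.inl x : X ⊕ Y) = f x := rfl

@[simp] theorem copair_inr {X Y Z : FinGSet.{u} G} (f : X ⟶ Z) (g : Y ⟶ Z) (y : Y) :
    copair f g (Sum.inr y : X ⊕ Y) = g y := rfl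

@[simp] theorem inl_apply {X Y : FinGSet.{u} G} (x : X) : inl X Y x = (Sum.inl x : X ⊕ Y) := rfl

@[simp] theorem inr_apply {X Y : FinGSet.{u} G} (y : Y) : inr X Y y = (Sum.inr y : X ⊕ Y) := rfl

/-- The canonical pullback `X ×_Y B`. -/
def pb {X Y B : FinGSet.{u} G} (f : X ⟶ Y) (q : B ⟶ Y) : FinGSet.{u} G :=
  letI : MulAction G {z : X × B // f z.1 = q z.2} :=
    { smul := fun g z => ⟨(g • z.1.1, g • z.1.2), by
        show f (g • z.1.1) = q (g • z.1.2)
        rw [map_smul, map_smul, z.2]⟩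
      one_smul := fun z => Subtype.ext (Prod.ext (one_smul G z.1.1) (one_smul G z.1.2))
      mul_smul := fun a b z =>
        Subtype.ext (Prod.ext (mul_smul a b z.1.1) (mul_smul a b z.1.2)) }
  ⟨{z : X × B // f z.1 = q z.2}⟩

def pbFst {X Y B : FinGSet.{u} G} (f : X ⟶ Y) (q : B ⟶ Y) : pb f q ⟶ X :=
  homMk (fun z : {z : X × B // f z.1 = q z.2} => z.1.1) fun _ _ => rfl

def pbSnd {X Y B : FinGSet.{u} G} (f : X ⟶ Y) (q : B ⟶ Y) : pb f q ⟶ B :=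
  homMk (fun z : {z : X × B // f z.1 = q z.2} => z.1.2) fun _ _ => rfl

theorem pb_comm {X Y B : FinGSet.{u} G} (f : X ⟶ Y) (q : B ⟶ Y) :
    pbFst f q ≫ f = pbSnd f q ≫ q :=
  hom_ext fun z => z.2

/-- Elementwise criterion for a square to be a pullback. -/
theorem isPullback_of {P X Y Z : FinGSet.{u} G} {a : P ⟶ X} {b : P ⟶ Y} {f : X ⟶ Z} {g : Y ⟶ Z}
    (comm : ∀ p, f (a p) = g (b p))
    (ex : ∀ x y, f x = g y → ∃ p, a p = x ∧ b p = y)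
    (inj : ∀ p q, a p = a q → b p = b q → p = q) : IsPullback a b f g := by
  have hc : a ≫ f = b ≫ g := hom_ext comm
  refine ⟨⟨hc⟩, ⟨Limits.PullbackCone.IsLimit.mk hc
    (fun s => homMk (fun z => (ex (s.fst z) (s.snd z) (comm_apply s.condition z)).choose) ?_)
    ?_ ?_ ?_⟩⟩
  · intro c z
    have h1 := (ex _ _ (comm_apply s.condition (c • z))).choose_spec
    have h2 := (ex _ _ (comm_apply s.condition z)).choose_spec
    apply inj
    · rw [h1.1, map_smul, map_smul, h2.1]
    · rw [h1.2, map_smul, map_smul, h2.2]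
  · intro s
    exact hom_ext fun z => (ex _ _ (comm_apply s.condition z)).choose_spec.1
  · intro s
    exact hom_ext fun z => (ex _ _ (comm_apply s.condition z)).choose_spec.2
  · intro s m h1 h2
    refine hom_ext fun z => ?_
    have h3 := (ex _ _ (comm_apply s.condition z)).choose_spec
    apply inj
    · exact (congr_hom h1 z).trans h3.1.symm
    · exact (congr_hom h2 z).trans h3.2.symm

theorem pb_isPullback {X Y B : FinGSet.{u} G} (f : X ⟶ Y) (q : B ⟶ Y) :
    IsPullback (pbFst f q) (pbSnd f q) f q :=
  isPullback_of (fun z => z.2) (fun x y h => ⟨⟨(x, y), h⟩, rfl, rfl⟩)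
    (fun _ _ h1 h2 => Subtype.ext (Prod.ext h1 h2))

theorem exists_of_isPullback {P X Y Z : FinGSet.{u} G} {a : P ⟶ X} {b : P ⟶ Y} {f : X ⟶ Z}
    {g : Y ⟶ Z} (h : IsPullback a b f g) (x : X) (y : Y) (e : f x = g y) :
    ∃ p, a p = x ∧ b p = y := by
  let z : pb f g := (⟨(x, y), e⟩ : {z : X × Y // f z.1 = g z.2})
  exact ⟨h.lift _ _ (pb_comm f g) z, congr_hom (h.lift_fst _ _ (pb_comm f g)) z,
    congr_hom (h.lift_snd _ _ (pb_comm f g)) z⟩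

theorem inj_of_isPullback {P X Y Z : FinGSet.{u} G} {a : P ⟶ X} {b : P ⟶ Y} {f : X ⟶ Z}
    {g : Y ⟶ Z} (h : IsPullback a b f g) (p q : P) (h1 : a p = a q) (h2 : b p = b q) :
    p = q := by
  let t : P ⟶ pb f g := homMk
    (fun p => (⟨(a p, b p), comm_apply h.w p⟩ : {z : X × Y // f z.1 = g z.2}))
    (fun c p => Subtype.ext (Prod.ext (map_smul a c p) (map_smul b c p)))
  have ht : t ≫ h.lift _ _ (pb_comm f g) = 𝟙 P := by
    apply h.hom_ext
    · rw [Category.assoc, h.lift_fst]; rfl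
    · rw [Category.assoc, h.lift_snd]; rfl
  have hpq : t p = t q := Subtype.ext (Prod.ext h1 h2)
  calc p = (t ≫ h.lift _ _ (pb_comm f g)) p := (congr_hom ht p).symm
    _ = (t ≫ h.lift _ _ (pb_comm f g)) q := by rw [comp_apply, comp_apply, hpq]
    _ = q := congr_hom ht q

/-- The set of pairs `(y, σ)` with `y ∈ Y` and `σ : f⁻¹(y) → A` a section of `p` over `f⁻¹(y)`. -/
structure PiSet {X Y A : FinGSet.{u} G} (f : X ⟶ Y) (p : A ⟶ X) : Type u where
  base : Y
  sec : {x : X // f x = base} → A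
  p_sec : ∀ x, p (sec x) = x.1

namespace PiSet

variable {X Y A : FinGSet.{u} G} {f : X ⟶ Y} {p : A ⟶ X}

theorem ext' {s t : PiSet f p} (h : s.base = t.base)
    (h' : ∀ (x : X) (hs : f x = s.base) (ht : f x = t.base), s.sec ⟨x, hs⟩ = t.sec ⟨x, ht⟩) :
    s = t := by
  obtain ⟨y, σ, hσ⟩ := s
  obtain ⟨y', τ, hτ⟩ := t
  obtain rfl : y = y' := h
  obtain rfl : σ = τ := funext fun x => h' x.1 x.2 x.2
  rfl

theorem sec_congr (s : PiSet f p) {x x' : X} (h : x = x') (hx : f x = s.base)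
    (hx' : f x' = s.base) : s.sec ⟨x, hx⟩ = s.sec ⟨x', hx'⟩ := by
  subst h; rfl

instance : Finite (PiSet f p) := by
  refine Finite.of_injective
    (β := Σ y : Y, ({x : X // f x = y} → A)) (fun s => ⟨s.base, s.sec⟩) ?_
  rintro ⟨y, σ, hσ⟩ ⟨y', τ, hτ⟩ h
  obtain ⟨rfl, h⟩ := Sigma.mk.inj h
  obtain rfl := eq_of_heq h
  rfl

/-- `g • (y, σ) = (g • y, x ↦ g • σ (g⁻¹ • x))`. -/
instance : MulAction G (PiSet f p) where
  smul g s :=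
    { base := g • s.base
      sec := fun x => g • s.sec ⟨g⁻¹ • x.1, by rw [map_smul, x.2, inv_smul_smul]⟩
      p_sec := fun x => by rw [map_smul, s.p_sec, smul_inv_smul] }
  one_smul s := by
    refine ext' (one_smul G s.base) fun x hs ht => ?_
    exact (one_smul G _).trans (sec_congr s (by rw [inv_one, one_smul]) _ _)
  mul_smul g h s := by
    refine ext' (mul_smul g h s.base) fun x hs ht => ?_
    refine (mul_smul g h _).trans ?_
    exact congrArg (fun a => g • h • a) (sec_congr s (by rw [mul_inv_rev, mul_smul]) _ _)

end PiSet

/-- The `G`-set `Π_f(A)`. -/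
def pi {X Y A : FinGSet.{u} G} (f : X ⟶ Y) (p : A ⟶ X) : FinGSet.{u} G := ⟨PiSet f p⟩

/-- The projection `π : Π_f(A) ⟶ Y`, `π(y, σ) = y`. -/
def piBase {X Y A : FinGSet.{u} G} (f : X ⟶ Y) (p : A ⟶ X) : pi f p ⟶ Y :=
  homMk (fun s : PiSet f p => s.base) fun _ _ => rfl

/-- The evaluation `e : X ×_Y Π_f(A) ⟶ A`, `e(x, (y, σ)) = σ(x)`. -/
def piEval {X Y A : FinGSet.{u} G} (f : X ⟶ Y) (p : A ⟶ X) : pb f (piBase f p) ⟶ A :=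
  homMk (fun z : {z : X × PiSet f p // f z.1 = z.2.base} => z.1.2.sec ⟨z.1.1, z.2⟩)
    (fun g z => congrArg (fun a => g • a)
      (PiSet.sec_congr z.1.2 (inv_smul_smul g z.1.1) _ _))

/-- The pullback `f' : X ×_Y Π_f(A) ⟶ Π_f(A)` of `f` along `π`. -/
def piSnd {X Y A : FinGSet.{u} G} (f : X ⟶ Y) (p : A ⟶ X) : pb f (piBase f p) ⟶ pi f p :=
  pbSnd f (piBase f p)

/-- The diagram `X ←p A ←l Z →r B →q Y`, together with `f : X ⟶ Y`, is an exponential diagram: it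
is isomorphic to the canonical one generated by `f` and `p`. -/
def IsExponential {X Y A Z B : FinGSet.{u} G} (f : X ⟶ Y) (p : A ⟶ X) (l : Z ⟶ A) (r : Z ⟶ B)
    (q : B ⟶ Y) : Prop :=
  ∃ (z : Z ≅ pb f (piBase f p)) (b : B ≅ pi f p),
    z.hom ≫ piEval f p = l ∧ z.hom ≫ piSnd f p = r ≫ b.hom ∧ b.hom ≫ piBase f p = q

/-- The orbit `G/H`. -/
def orbit [Finite G] (H : Subgroup G) : FinGSet.{u} G := ⟨G ⧸ H⟩

/-- The free orbit `G/e`, realized as `G` with left multiplication. -/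
def regular (G : Type u) [Group G] [Finite G] : FinGSet.{u} G := ⟨G⟩

end FinGSet

section Functors

open FinGSet

/-! ## Semi-Mackey functors -/

/-- A semi-Mackey functor on `G`: the contravariant part is `res`, the covariant part is `tr`. -/
structure SemiMackey (G : Type u) [Group G] where
  obj : FinGSet.{u} G → Type v
  res : ∀ {X Y : FinGSet.{u} G}, (X ⟶ Y) → obj Y → obj X
  tr : ∀ {X Y : FinGSet.{u} G}, (X ⟶ Y) → obj X → obj Y
  res_id : ∀ {X : FinGSet.{u} G} (m : obj X), res (𝟙 X) m = m
  res_comp : ∀ {X Y Z : FinGSet.{u} G} (f : X ⟶ Y) (g : Y ⟶ Z) (m : obj Z),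
    res (f ≫ g) m = res f (res g m)
  tr_id : ∀ {X : FinGSet.{u} G} (m : obj X), tr (𝟙 X) m = m
  tr_comp : ∀ {X Y Z : FinGSet.{u} G} (f : X ⟶ Y) (g : Y ⟶ Z) (m : obj X),
    tr (f ≫ g) m = tr g (tr f m)
  /-- binary coproducts are sent to products -/
  additive : ∀ X Y : FinGSet.{u} G, Function.Bijective
    (fun m : obj (sum X Y) => ((res (inl X Y) m, res (inr X Y) m) : obj X × obj Y))
  /-- the empty coproduct is sent to the one-point set -/
  additive_empty : ∃ m : obj (empty G), ∀ m', m' = m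
  mackey : ∀ {X' Y' X Y : FinGSet.{u} G} (x : X' ⟶ X) (f' : X' ⟶ Y') (f : X ⟶ Y) (y : Y' ⟶ Y),
    IsPullback x f' f y → ∀ m : obj Y', tr x (res f' m) = res f (tr y m)

namespace SemiMackey

variable {G : Type u} [Group G] (M : SemiMackey.{u, v} G)

theorem tr_iso {X Y : FinGSet.{u} G} (e : X ≅ Y) (m : M.obj X) : M.tr e.hom m = M.res e.inv m := by
  have h : IsPullback (𝟙 Y) e.inv (𝟙 Y) e.hom := by
    refine isPullback_of (fun p => (congr_hom e.inv_hom_id p).symm) (fun x y h => ⟨x, rfl, ?_⟩)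
      (fun _ _ h _ => h)
    rw [show x = e.hom y from h]
    exact congr_hom e.hom_inv_id y
  have := M.mackey _ _ _ _ h m
  rw [M.tr_id, M.res_id] at this
  exact this.symm

/-- The element of `M(X ⊔ Y)` with given components. -/
noncomputable def pair {X Y : FinGSet.{u} G} (a : M.obj X) (b : M.obj Y) : M.obj (sum X Y) :=
  ((M.additive X Y).2 (a, b)).choose

@[simp] theorem res_inl_pair {X Y : FinGSet.{u} G} (a : M.obj X) (b : M.obj Y) :
    M.res (inl X Y) (M.pair a b) = a :=
  congrArg Prod.fst ((M.additive X Y).2 (a, b)).choose_spec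

@[simp] theorem res_inr_pair {X Y : FinGSet.{u} G} (a : M.obj X) (b : M.obj Y) :
    M.res (inr X Y) (M.pair a b) = b :=
  congrArg Prod.snd ((M.additive X Y).2 (a, b)).choose_spec

theorem sum_ext {X Y : FinGSet.{u} G} {m n : M.obj (sum X Y)}
    (h1 : M.res (inl X Y) m = M.res (inl X Y) n) (h2 : M.res (inr X Y) m = M.res (inr X Y) n) :
    m = n :=
  (M.additive X Y).1 (Prod.ext h1 h2)

/-- The sum of two elements of `M(X)`: the transfer along the codiagonal. -/
noncomputable def mul {X : FinGSet.{u} G} (a b : M.obj X) : M.obj X := M.tr (fold X) (M.pair a b)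

/-- The unit of `M(X)`: the transfer along `∅ ⟶ X`. -/
noncomputable def one (X : FinGSet.{u} G) : M.obj X := M.tr (fromEmpty X) M.additive_empty.choose

theorem res_mul {X Y : FinGSet.{u} G} (f : X ⟶ Y) (a b : M.obj Y) :
    M.res f (M.mul a b) = M.mul (M.res f a) (M.res f b) := by
  let ff : sum X X ⟶ sum Y Y := copair (f ≫ inl Y Y) (f ≫ inr Y Y)
  have h : IsPullback (fold X) ff f (fold Y) := by
    refine isPullback_of ?_ ?_ ?_
    · rintro (p | p) <;> rfl
    · rintro x (y | y) h
      · exact ⟨(Sum.inl x : X ⊕ X), rfl, congrArg (Sum.inl : Y → Y ⊕ Y) h⟩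
      · exact ⟨(Sum.inr x : X ⊕ X), rfl, congrArg (Sum.inr : Y → Y ⊕ Y) h⟩
    · rintro (p | p) (q | q) h1 h2
      · exact congrArg (Sum.inl : X → X ⊕ X) h1
      · exact (Sum.inl_ne_inr (h2 : (Sum.inl (f p) : Y ⊕ Y) = Sum.inr (f q))).elim
      · exact (Sum.inr_ne_inl (h2 : (Sum.inr (f p) : Y ⊕ Y) = Sum.inl (f q))).elim
      · exact congrArg (Sum.inr : X → X ⊕ X) h1
  have h' := M.mackey _ _ _ _ h (M.pair a b)
  have h'' : M.res ff (M.pair a b) = M.pair (M.res f a) (M.res f b) := by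
    apply M.sum_ext
    · rw [← M.res_comp, show inl X X ≫ ff = f ≫ inl Y Y from rfl, M.res_comp]; simp
    · rw [← M.res_comp, show inr X X ≫ ff = f ≫ inr Y Y from rfl, M.res_comp]; simp
  rw [h''] at h'
  exact h'.symm

theorem res_one {X Y : FinGSet.{u} G} (f : X ⟶ Y) : M.res f (M.one Y) = M.one X := by
  have h : IsPullback (fromEmpty X) (𝟙 (empty G)) f (fromEmpty Y) :=
    isPullback_of (fun p : PEmpty => p.elim) (fun _ (y : PEmpty) => y.elim)
      (fun p : PEmpty => p.elim)
  have h' := M.mackey _ _ _ _ h M.additive_empty.choose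
  rw [M.res_id] at h'
  exact h'.symm

/-- Transfer along `f ⊔ g ⟶ Z`. -/
theorem tr_copair {X Y Z : FinGSet.{u} G} (f : X ⟶ Z) (g : Y ⟶ Z) (a : M.obj X) (b : M.obj Y) :
    M.tr (copair f g) (M.pair a b) = M.mul (M.tr f a) (M.tr g b) := by
  let ff : sum X Y ⟶ sum Z Z := copair (f ≫ inl Z Z) (g ≫ inr Z Z)
  have hff : copair f g = ff ≫ fold Z := hom_ext (by rintro (x | x) <;> rfl)
  have h1 : IsPullback f (inl X Y) (inl Z Z) ff := by
    refine isPullback_of (fun _ => rfl) ?_ (fun p q _ h => Sum.inl_injective h)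
    rintro z (x | y) h
    · exact ⟨x, (Sum.inl_injective (h : (Sum.inl z : Z ⊕ Z) = Sum.inl (f x))).symm, rfl⟩
    · exact (Sum.inl_ne_inr (h : (Sum.inl z : Z ⊕ Z) = Sum.inr (g y))).elim
  have h2 : IsPullback g (inr X Y) (inr Z Z) ff := by
    refine isPullback_of (fun _ => rfl) ?_ (fun p q _ h => Sum.inr_injective h)
    rintro z (x | y) h
    · exact (Sum.inr_ne_inl (h : (Sum.inr z : Z ⊕ Z) = Sum.inl (f x))).elim
    · exact ⟨y, (Sum.inr_injective (h : (Sum.inr z : Z ⊕ Z) = Sum.inr (g y))).symm, rfl⟩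
  have h3 : M.tr ff (M.pair a b) = M.pair (M.tr f a) (M.tr g b) := by
    apply M.sum_ext
    · rw [← M.mackey _ _ _ _ h1]; simp
    · rw [← M.mackey _ _ _ _ h2]; simp
  rw [hff, M.tr_comp, h3]
  rfl

theorem mul_comm' {X : FinGSet.{u} G} (a b : M.obj X) : M.mul a b = M.mul b a := by
  let s : sum X X ⟶ sum X X := copair (inr X X) (inl X X)
  let e : sum X X ≅ sum X X :=
    ⟨s, s, hom_ext (by rintro (x | x) <;> rfl), hom_ext (by rintro (x | x) <;> rfl)⟩
  have h : M.tr e.hom (M.pair a b) = M.pair b a := by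
    rw [M.tr_iso]
    apply M.sum_ext
    · rw [← M.res_comp, show inl X X ≫ e.inv = inr X X from rfl]; simp
    · rw [← M.res_comp, show inr X X ≫ e.inv = inl X X from rfl]; simp
  have h2 : fold X = e.hom ≫ fold X := hom_ext (by rintro (x | x) <;> rfl)
  rw [mul, h2, M.tr_comp, h]
  rfl

theorem one_mul' {X : FinGSet.{u} G} (a : M.obj X) : M.mul (M.one X) a = a := by
  let e : sum (empty G) X ≅ X :=
    ⟨copair (fromEmpty X) (𝟙 X), inr _ _,
      hom_ext (by
        rintro (x | x)
        · exact (x : PEmpty).elim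
        · rfl), rfl⟩
  have h := M.tr_copair (fromEmpty X) (𝟙 X) M.additive_empty.choose a
  rw [M.tr_id] at h
  refine h.symm.trans ((M.tr_iso e _).trans ?_)
  simp [e]

theorem mul_assoc' {X : FinGSet.{u} G} (a b c : M.obj X) :
    M.mul (M.mul a b) c = M.mul a (M.mul b c) := by
  let e : sum (sum X X) X ≅ sum X (sum X X) :=
    ⟨copair (copair (inl _ _) (inl _ _ ≫ inr _ _)) (inr _ _ ≫ inr _ _),
      copair (inl _ _ ≫ inl _ _) (copair (inr _ _ ≫ inl _ _) (inr _ _)),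
      hom_ext (by rintro ((x | x) | x) <;> rfl), hom_ext (by rintro (x | (x | x)) <;> rfl)⟩
  have h1 := M.tr_copair (fold X) (𝟙 X) (M.pair a b) c
  have h2 := M.tr_copair (𝟙 X) (fold X) a (M.pair b c)
  rw [M.tr_id] at h1 h2
  have h3 : M.tr e.hom (M.pair (M.pair a b) c) = M.pair a (M.pair b c) := by
    rw [M.tr_iso]
    apply M.sum_ext
    · rw [← M.res_comp, show inl _ _ ≫ e.inv = inl _ _ ≫ inl _ _ from rfl, M.res_comp]; simp
    · apply M.sum_ext
      · rw [← M.res_comp, ← M.res_comp,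
          show (inl _ _ ≫ inr _ _) ≫ e.inv = inr _ _ ≫ inl _ _ from rfl, M.res_comp]
        simp
      · rw [← M.res_comp, ← M.res_comp, show (inr _ _ ≫ inr _ _) ≫ e.inv = inr _ _ from rfl]
        simp
  have h4 : copair (fold X) (𝟙 X) = e.hom ≫ copair (𝟙 X) (fold X) :=
    hom_ext (by rintro ((x | x) | x) <;> rfl)
  rw [h4, M.tr_comp, h3] at h1
  exact h1.symm.trans h2

/-- The commutative monoid structure on `M(X)`, written multiplicatively. -/
@[reducible] noncomputable def commMonoid (X : FinGSet.{u} G) : CommMonoid (M.obj X) where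
  mul := M.mul
  one := M.one X
  mul_assoc := M.mul_assoc'
  one_mul := M.one_mul'
  mul_one a := (M.mul_comm' a _).trans (M.one_mul' a)
  mul_comm := M.mul_comm'

/-- A morphism of semi-Mackey functors: a family of maps, natural with respect to restrictions and
transfers. Its components are automatically monoid homomorphisms, see `map_mul` and `map_one`. -/
@[ext]
structure Hom (M N : SemiMackey.{u, v} G) where
  app : ∀ X, M.obj X → N.obj X
  app_res : ∀ {X Y : FinGSet.{u} G} (f : X ⟶ Y) (m : M.obj Y), app X (M.res f m) = N.res f (app Y m)
  app_tr : ∀ {X Y : FinGSet.{u} G} (f : X ⟶ Y) (m : M.obj X), app Y (M.tr f m) = N.tr f (app X m)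

theorem Hom.map_mul {M N : SemiMackey.{u, v} G} (φ : Hom M N) {X : FinGSet.{u} G} (a b : M.obj X) :
    φ.app X (M.mul a b) = N.mul (φ.app X a) (φ.app X b) := by
  rw [mul, φ.app_tr, mul]
  congr 1
  apply N.sum_ext <;> rw [← φ.app_res] <;> simp

theorem Hom.map_one {M N : SemiMackey.{u, v} G} (φ : Hom M N) (X : FinGSet.{u} G) :
    φ.app X (M.one X) = N.one X := by
  rw [one, φ.app_tr, N.additive_empty.choose_spec (φ.app _ _)]
  rfl

/-- The category of semi-Mackey functors on `G`. -/
instance : Category (SemiMackey.{u, v} G) where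
  Hom := Hom
  id M := ⟨fun _ m => m, fun _ _ => rfl, fun _ _ => rfl⟩
  comp φ ψ := ⟨fun X m => ψ.app X (φ.app X m), fun f m => by rw [φ.app_res, ψ.app_res],
    fun f m => by rw [φ.app_tr, ψ.app_tr]⟩

end SemiMackey

/-! ## Tambara functors -/

/-- A semi-Tambara functor on `G`. The underlying semi-Mackey functor `(res, tr)` is the additive
part; `nm` is the multiplicative transfer. -/
structure SemiTambara (G : Type u) [Group G] extends SemiMackey.{u, v} G where
  nm : ∀ {X Y : FinGSet.{u} G}, (X ⟶ Y) → obj X → obj Y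
  nm_id : ∀ {X : FinGSet.{u} G} (m : obj X), nm (𝟙 X) m = m
  nm_comp : ∀ {X Y Z : FinGSet.{u} G} (f : X ⟶ Y) (g : Y ⟶ Z) (m : obj X),
    nm (f ≫ g) m = nm g (nm f m)
  nm_mackey : ∀ {X' Y' X Y : FinGSet.{u} G} (x : X' ⟶ X) (f' : X' ⟶ Y') (f : X ⟶ Y) (y : Y' ⟶ Y),
    IsPullback x f' f y → ∀ m : obj Y', nm x (res f' m) = res f (nm y m)
  /-- the distributive law -/
  distrib : ∀ {X Y A Z B : FinGSet.{u} G} (f : X ⟶ Y) (p : A ⟶ X) (l : Z ⟶ A) (r : Z ⟶ B)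
    (q : B ⟶ Y), IsExponential f p l r q →
      ∀ m : obj A, nm f (tr p m) = tr q (nm r (res l m))

/-- The multiplicative part `(res, nm)` of a semi-Tambara functor. -/
def SemiTambara.mult {G : Type u} [Group G] (T : SemiTambara.{u, v} G) : SemiMackey.{u, v} G where
  obj := T.obj
  res := T.res
  tr := T.nm
  res_id := T.res_id
  res_comp := T.res_comp
  tr_id := T.nm_id
  tr_comp := T.nm_comp
  additive := T.additive
  additive_empty := T.additive_empty
  mackey := T.nm_mackey

/-- A Tambara functor on `G`: a semi-Tambara functor `T` such that every semi-ring `T(X)` is a ring,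
that is, has additive inverses (`mul` and `one` of the additive part are addition and zero). -/
structure Tambara (G : Type u) [Group G] extends SemiTambara.{u, v} G where
  exists_neg : ∀ {X : FinGSet.{u} G} (m : obj X), ∃ n : obj X,
    toSemiMackey.mul n m = toSemiMackey.one X

namespace Tambara

variable {G : Type u} [Group G]

/-- The additive group structure on `T(X)`. -/
noncomputable instance (T : Tambara.{u, v} G) (X : FinGSet.{u} G) : AddCommGroup (T.obj X) :=
  letI : Add (T.obj X) := ⟨T.toSemiMackey.mul⟩
  letI : Zero (T.obj X) := ⟨T.toSemiMackey.one X⟩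
  letI : Neg (T.obj X) := ⟨fun m => (T.exists_neg m).choose⟩
  { AddGroup.ofLeftAxioms (G := T.obj X) T.toSemiMackey.mul_assoc' T.toSemiMackey.one_mul'
      (fun a => (T.exists_neg a).choose_spec) with
    add_comm := T.toSemiMackey.mul_comm' }

theorem add_def (T : Tambara.{u, v} G) {X : FinGSet.{u} G} (a b : T.obj X) :
    a + b = T.tr (fold X) (T.pair a b) := rfl

theorem zero_def (T : Tambara.{u, v} G) (X : FinGSet.{u} G) :
    (0 : T.obj X) = T.toSemiMackey.one X := rfl

/-- The multiplicative unit of `T(X)`. -/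
noncomputable def unit (T : Tambara.{u, v} G) (X : FinGSet.{u} G) : T.obj X := T.mult.one X

/-- A morphism of Tambara functors: a family of maps, natural with respect to restrictions and both
kinds of transfers. Its components are automatically ring homomorphisms, since the additive and the
multiplicative structure on `T(X)` are defined through the transfers. -/
@[ext]
structure Hom (T S : Tambara.{u, v} G) where
  app : ∀ X, T.obj X → S.obj X
  app_res : ∀ {X Y : FinGSet.{u} G} (f : X ⟶ Y) (m : T.obj Y), app X (T.res f m) = S.res f (app Y m)
  app_tr : ∀ {X Y : FinGSet.{u} G} (f : X ⟶ Y) (m : T.obj X), app Y (T.tr f m) = S.tr f (app X m)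
  app_nm : ∀ {X Y : FinGSet.{u} G} (f : X ⟶ Y) (m : T.obj X), app Y (T.nm f m) = S.nm f (app X m)

/-- The category of Tambara functors on `G`. The category of `T`-Tambara functors is `Under T`. -/
instance : Category (Tambara.{u, v} G) where
  Hom := Hom
  id T := ⟨fun _ m => m, fun _ _ => rfl, fun _ _ => rfl, fun _ _ => rfl⟩
  comp φ ψ := ⟨fun X m => ψ.app X (φ.app X m), fun f m => by rw [φ.app_res, ψ.app_res],
    fun f m => by rw [φ.app_tr, ψ.app_tr], fun f m => by rw [φ.app_nm, ψ.app_nm]⟩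

/-- The functor `(-)^μ`, sending a Tambara functor to its multiplicative part. -/
def mu (G : Type u) [Group G] : Tambara.{u, v} G ⥤ SemiMackey.{u, v} G where
  obj T := T.mult
  map φ := ⟨φ.app, φ.app_res, φ.app_nm⟩

end Tambara

/-! ## The tensor product of Tambara functors -/

section Tensor

open scoped TensorProduct DirectSum

variable {G : Type u} [Group G] (T S : Tambara.{u, v} G)

/-- The direct sum of the groups `T(A) ⊗_ℤ S(A)` over all `p : A ⟶ X`. -/
noncomputable abbrev PreTensor (X : FinGSet.{u} G) : Type (max (u + 1) v) :=
  ⨁ A : Over X, T.obj A.left ⊗[ℤ] S.obj A.left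

open Classical in
/-- The element `t ⊗ s` in the component of `p : A ⟶ X`. -/
noncomputable def preSymbol {X : FinGSet.{u} G} (A : Over X) (t : T.obj A.left) (s : S.obj A.left) :
    PreTensor T S X :=
  DirectSum.of (fun A : Over X => T.obj A.left ⊗[ℤ] S.obj A.left) A (t ⊗ₜ[ℤ] s)

/-- The subgroup of relations `a^*(t') ⊗ s = t' ⊗ a_+(s)` and `a_+(t) ⊗ s' = t ⊗ a^*(s')`. -/
noncomputable def tensorRel (X : FinGSet.{u} G) : AddSubgroup (PreTensor T S X) :=
  AddSubgroup.closure
    ({x | ∃ (A A' : Over X) (a : A ⟶ A') (t' : T.obj A'.left) (s : S.obj A.left),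
        x = preSymbol T S A (T.res a.left t') s - preSymbol T S A' t' (S.tr a.left s)} ∪
     {x | ∃ (A A' : Over X) (a : A ⟶ A') (t : T.obj A.left) (s' : S.obj A'.left),
        x = preSymbol T S A' (T.tr a.left t) s' - preSymbol T S A t (S.res a.left s')})

/-- The group `(T ⊗_Ω S)(X)`. -/
abbrev TensorObj (X : FinGSet.{u} G) : Type (max (u + 1) v) := PreTensor T S X ⧸ tensorRel T S X

/-- The element `[t ⊗ s]_{(A, p)}` of `(T ⊗_Ω S)(X)`. -/
noncomputable def symbol {X A : FinGSet.{u} G} (p : A ⟶ X) (t : T.obj A) (s : S.obj A) :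
    TensorObj T S X :=
  QuotientAddGroup.mk (preSymbol T S (Over.mk p) t s)

/-- `P` is the Tambara functor `T ⊗_Ω S`: through the additive identifications `θ`, its values are
the groups `(T ⊗_Ω S)(X)`, and its structure morphisms are given on symbols by
* `f^* [t ⊗ s]_{(B, q)} = [p_B^* t ⊗ p_B^* s]_{(X ×_Y B, p_X)}`,
* `f_+ [t ⊗ s]_{(A, p)} = [t ⊗ s]_{(A, p ≫ f)}`,
* `f_• [t ⊗ s]_{(A, p)} = [f'_• e^* t ⊗ f'_• e^* s]_{(Π_f(A), π)}`.

Every element of `(T ⊗_Ω S)(X)` is a single symbol, so that these formulas determine `P`. -/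
structure IsTensor (P : Tambara.{u, v} G) (θ : ∀ X, TensorObj T S X ≃+ P.obj X) : Prop where
  res_symbol : ∀ {X Y B : FinGSet.{u} G} (f : X ⟶ Y) (q : B ⟶ Y) (t : T.obj B) (s : S.obj B),
    P.res f (θ Y (symbol T S q t s)) =
      θ X (symbol T S (pbFst f q) (T.res (pbSnd f q) t) (S.res (pbSnd f q) s))
  tr_symbol : ∀ {X Y A : FinGSet.{u} G} (f : X ⟶ Y) (p : A ⟶ X) (t : T.obj A) (s : S.obj A),
    P.tr f (θ X (symbol T S p t s)) = θ Y (symbol T S (p ≫ f) t s)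
  nm_symbol : ∀ {X Y A : FinGSet.{u} G} (f : X ⟶ Y) (p : A ⟶ X) (t : T.obj A) (s : S.obj A),
    P.nm f (θ X (symbol T S p t s)) =
      θ Y (symbol T S (piBase f p)
        (T.nm (piSnd f p) (T.res (piEval f p) t)) (S.nm (piSnd f p) (S.res (piEval f p) s)))

end Tensor

/-- The tensor product `- ⊗_Ω -` as a functor `Tam_G × Tam_G ⥤ Tam_G`, together with the natural
morphism `ι_T : T ⟶ T ⊗_Ω S`, `t ↦ [t ⊗ 1]_{(X, id)}`. -/
structure TensorFunctor (G : Type u) [Group G] where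
  functor : Tambara.{u, v} G × Tambara.{u, v} G ⥤ Tambara.{u, v} G
  iso : ∀ (T S : Tambara.{u, v} G) (X : FinGSet.{u} G),
    TensorObj T S X ≃+ (functor.obj (T, S)).obj X
  isTensor : ∀ T S : Tambara.{u, v} G, IsTensor T S (functor.obj (T, S)) (iso T S)
  map_symbol : ∀ {T T' S S' : Tambara.{u, v} G} (τ : T ⟶ T') (σ : S ⟶ S') {X A : FinGSet.{u} G}
    (p : A ⟶ X) (t : T.obj A) (s : S.obj A),
    (functor.map (X := (T, S)) (Y := (T', S')) (τ, σ)).app X (iso T S X (symbol T S p t s)) =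
      iso T' S' X (symbol T' S' p (τ.app A t) (σ.app A s))
  ι : ∀ T S : Tambara.{u, v} G, T ⟶ functor.obj (T, S)
  ι_apply : ∀ (T S : Tambara.{u, v} G) (X : FinGSet.{u} G) (t : T.obj X),
    (ι T S).app X t = iso T S X (symbol T S (𝟙 X) t (S.unit X))

namespace TensorFunctor

variable {G : Type u} [Group G] (Θ : TensorFunctor.{u, v} G)
  (𝒯 : SemiMackey.{u, v} G ⥤ Tambara.{u, v} G)

/-- The functor `ℱ(T, M) = T ⊗_Ω 𝒯(M)`, where `𝒯` is the Tambarization functor. -/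
def genDress : Tambara.{u, v} G × SemiMackey.{u, v} G ⥤ Tambara.{u, v} G :=
  (𝟭 _).prod 𝒯 ⋙ Θ.functor

/-- The functor `ℱ(-, M) : Tam_G ⥤ Tam_G`, `T ↦ T[M]`. -/
def pol (M : SemiMackey.{u, v} G) : Tambara.{u, v} G ⥤ Tambara.{u, v} G :=
  Prod.sectL _ M ⋙ Θ.genDress 𝒯

/-- The structure morphism `T ⟶ T[M]`. -/
def polι (T : Tambara.{u, v} G) (M : SemiMackey.{u, v} G) : T ⟶ (Θ.pol 𝒯 M).obj T :=
  Θ.ι T (𝒯.obj M)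

/-- `T[M]` as a `T`-Tambara functor. -/
def polUnder (T : Tambara.{u, v} G) (M : SemiMackey.{u, v} G) : Under T :=
  Under.mk (Θ.polι 𝒯 T M)

end TensorFunctor

/-! ## Fixed points -/

section Fixed

variable {G : Type u} [Group G] [Finite G]

/-- The group `N_G(H)/H`. -/
abbrev Weyl (H : Subgroup G) : Type u :=
  Subgroup.normalizer (H : Set G) ⧸ H.subgroupOf (Subgroup.normalizer (H : Set G))

/-- The right action of `k = nH ∈ N_G(H)/H` on `U = G/H`, `(xH) · k = xnH`. -/
def weylMap (H : Subgroup G) (k : Weyl H) : orbit H ⟶ orbit H :=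
  homMk (fun x : G ⧸ H => Quotient.liftOn₂' x k (fun a n => ((a * n.1 : G) : G ⧸ H))
    (by
      intro a n b m hab hnm
      rw [QuotientGroup.leftRel_apply] at hab hnm
      rw [Subgroup.mem_subgroupOf] at hnm
      apply QuotientGroup.eq.2
      have h1 := (Subgroup.mem_normalizer_iff.1 (inv_mem n.2) _).1 hab
      have h2 := H.mul_mem h1 hnm
      have h3 : (a * n.1)⁻¹ * (b * m.1) = (n.1⁻¹ * (a⁻¹ * b) * (n.1⁻¹)⁻¹) * (n⁻¹ * m).1 := by
        simp [mul_assoc]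
      rw [h3]
      exact h2))
    (by
      intro g x
      induction x using QuotientGroup.induction_on with
      | H a =>
        induction k using QuotientGroup.induction_on with
        | H n => exact congrArg (fun z : G => (z : G ⧸ H)) (mul_assoc g a n.1))

theorem weylMap_one (H : Subgroup G) : weylMap H 1 = 𝟙 (orbit H) := by
  refine hom_ext fun x => ?_
  induction x using QuotientGroup.induction_on with
  | H a => exact congrArg (fun z : G => (z : G ⧸ H)) (mul_one a)

theorem weylMap_mul (H : Subgroup G) (k l : Weyl H) :
    weylMap H (k * l) = weylMap H k ≫ weylMap H l := by
  refine hom_ext fun x => ?_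
  induction x using QuotientGroup.induction_on with
  | H a =>
    induction k using QuotientGroup.induction_on with
    | H n =>
      induction l using QuotientGroup.induction_on with
      | H m => exact congrArg (fun z : G => (z : G ⧸ H)) (mul_assoc a n.1 m.1).symm

theorem weylMap_free (H : Subgroup G) (k : Weyl H) (x : orbit H) (h : weylMap H k x = x) :
    k = 1 := by
  induction x using QuotientGroup.induction_on with
  | H a =>
    induction k using QuotientGroup.induction_on with
    | H n =>
      have h' : ((a * n.1 : G) : G ⧸ H) = (a : G ⧸ H) := h
      rw [QuotientGroup.eq] at h'
      apply (QuotientGroup.eq_one_iff n).2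
      rw [Subgroup.mem_subgroupOf]
      simpa using h'

/-- The action of `N_G(H)/H` on `M(G/H)`, `k • m = M^*(· k)(m)`. -/
@[reducible] def weylAction (M : SemiMackey.{u, v} G) (H : Subgroup G) :
    MulAction (Weyl H) (M.obj (orbit H)) where
  smul k m := M.res (weylMap H k) m
  one_smul m := (congrArg (fun f => M.res f m) (weylMap_one H)).trans (M.res_id m)
  mul_smul k l m := (congrArg (fun f => M.res f m) (weylMap_mul H k l)).trans (M.res_comp _ _ m)

/-- The fixed part `M(G/H)^{N_G(H)/H}`. -/
def weylFixed (M : SemiMackey.{u, v} G) (H : Subgroup G) : Set (M.obj (orbit H)) :=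
  @MulAction.fixedPoints (Weyl H) (M.obj (orbit H)) _ (weylAction M H)

/-- Right multiplication by `g`, as an automorphism of `G/e`. -/
def rightMul (g : G) : regular G ⟶ regular G :=
  homMk (fun x : G => (x * g : G)) (fun a (x : G) => mul_assoc a x g)

/-- The action of `G` on `M(G/e)`, `g • m = M^*(· g)(m)`. -/
@[reducible] def regularAction (M : SemiMackey.{u, v} G) : MulAction G (M.obj (regular G)) where
  smul g m := M.res (rightMul g) m
  one_smul m := (congrArg (fun f => M.res f m)
    (hom_ext (fun x : G => mul_one x) : rightMul (1 : G) = 𝟙 _)).trans (M.res_id m)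
  mul_smul g h m := (congrArg (fun f => M.res f m)
    (hom_ext (fun x : G => (mul_assoc x g h).symm) :
      rightMul (g * h) = rightMul g ≫ rightMul h)).trans (M.res_comp _ _ m)

/-- The monoid `M(G/e)^G`. -/
noncomputable def regularFixed (M : SemiMackey.{u, v} G) :
    @Submonoid (M.obj (regular G)) (M.commMonoid (regular G)).toMulOneClass :=
  letI := M.commMonoid (regular G)
  { carrier := @MulAction.fixedPoints G (M.obj (regular G)) _ (regularAction M)
    mul_mem' := fun {a b} ha hb g => by
      refine (M.res_mul (rightMul g) a b).trans ?_
      exact congrArg₂ M.mul (ha g) (hb g)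
    one_mem' := fun g => M.res_one (rightMul g) }

/-- The functor `ev : SMack_G ⥤ Mon`, `M ↦ M(G/e)^G`. -/
noncomputable def ev (G : Type u) [Group G] [Finite G] : SemiMackey.{u, v} G ⥤ CommMonCat.{v} where
  obj M :=
    letI := M.commMonoid (regular G)
    CommMonCat.of (regularFixed M)
  map {M N} φ :=
    letI := M.commMonoid (regular G)
    letI := N.commMonoid (regular G)
    CommMonCat.ofHom
      { toFun := fun m => (⟨φ.app _ m.1, fun g =>
          (φ.app_res (rightMul g) m.1).symm.trans (congrArg (φ.app _) (m.2 g))⟩ : regularFixed N)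
        map_one' := Subtype.ext (φ.map_one (regular G))
        map_mul' := fun a b => Subtype.ext (φ.map_mul a.1 b.1) }

end Fixed

/-! ## Composition with the biset `U = G/H` -/

section Biset

variable {G : Type u} [Group G] [Finite G] (H : Subgroup G)

/-- `(u · k, y) ∼ (u, k • y)` on `U × Y`. -/
def balancedSetoid (Y : FinGSet.{u} (Weyl H)) : Setoid (orbit H × Y) where
  r a b := ∃ k : Weyl H, a.1 = weylMap H k b.1 ∧ k • a.2 = b.2
  iseqv :=
    { refl := fun a => ⟨1, by rw [weylMap_one]; rfl, one_smul _ _⟩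
      symm := by
        rintro ⟨u, y⟩ ⟨u', y'⟩ ⟨k, hu, hy⟩
        obtain rfl : u = weylMap H k u' := hu
        obtain rfl : k • y = y' := hy
        exact ⟨k⁻¹, by rw [← FinGSet.comp_apply, ← weylMap_mul, mul_inv_cancel, weylMap_one]; rfl,
          inv_smul_smul k y⟩
      trans := by
        rintro ⟨u, y⟩ ⟨u', y'⟩ ⟨u'', y''⟩ ⟨k, hu, hy⟩ ⟨l, hu', hy'⟩
        obtain rfl : u = weylMap H k u' := hu
        obtain rfl : k • y = y' := hy
        obtain rfl : u' = weylMap H l u'' := hu'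
        obtain rfl : l • k • y = y'' := hy'
        exact ⟨l * k, by rw [weylMap_mul]; rfl, mul_smul l k y⟩ }

/-- The finite `G`-set `U ∘_K Y` for the `G`-`K`-biset `U = G/H`, where `K = N_G(H)/H`. Since `K`
acts freely on `U`, this is the balanced product `(U × Y)/∼`, `(u · k, y) ∼ (u, k • y)`. -/
def bisetObj (Y : FinGSet.{u} (Weyl H)) : FinGSet.{u} G :=
  letI : MulAction G (Quotient (balancedSetoid H Y)) :=
    { smul := fun g => Quotient.map (fun a => (g • a.1, a.2)) (by
        rintro ⟨u, y⟩ ⟨u', y'⟩ ⟨k, hu, hy⟩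
        obtain rfl : u = weylMap H k u' := hu
        obtain rfl : k • y = y' := hy
        exact ⟨k, (FinGSet.map_smul (weylMap H k) g u').symm, rfl⟩)
      one_smul := by
        rintro ⟨u, y⟩
        exact congrArg (fun u' => Quotient.mk (balancedSetoid H Y) (u', y)) (one_smul G u)
      mul_smul := by
        rintro a b ⟨u, y⟩
        exact congrArg (fun u' => Quotient.mk (balancedSetoid H Y) (u', y)) (mul_smul a b u) }
  ⟨Quotient (balancedSetoid H Y)⟩

/-- The class of `(u, y)`. -/
def bisetMk {Y : FinGSet.{u} (Weyl H)} (a : orbit H) (y : Y) : bisetObj H Y :=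
  Quotient.mk (balancedSetoid H Y) (a, y)

theorem bisetMk_surj {Y : FinGSet.{u} (Weyl H)} (z : bisetObj H Y) : ∃ a y, bisetMk H a y = z := by
  obtain ⟨⟨a, y⟩, h⟩ := Quotient.exists_rep z
  exact ⟨a, y, h⟩

theorem bisetMk_eq {Y : FinGSet.{u} (Weyl H)} {a b : orbit H} {y z : Y} :
    bisetMk H a y = bisetMk H b z ↔ ∃ k : Weyl H, a = weylMap H k b ∧ k • y = z :=
  Quotient.eq (r := balancedSetoid H Y)

/-- The map `U ∘_K f`. -/
def bisetMap {Y Z : FinGSet.{u} (Weyl H)} (f : Y ⟶ Z) : bisetObj H Y ⟶ bisetObj H Z :=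
  homMk (Quotient.map (fun a => (a.1, f a.2)) (by
    rintro ⟨u, y⟩ ⟨u', y'⟩ ⟨k, hu, hy⟩
    obtain rfl : u = weylMap H k u' := hu
    obtain rfl : k • y = y' := hy
    exact ⟨k, rfl, (FinGSet.map_smul f k y).symm⟩)) (by
    rintro g ⟨u, y⟩
    rfl)

@[simp] theorem bisetMap_mk {Y Z : FinGSet.{u} (Weyl H)} (f : Y ⟶ Z) (a : orbit H) (y : Y) :
    bisetMap H f (bisetMk H a y) = bisetMk H a (f y) := rfl

theorem bisetMap_id (Y : FinGSet.{u} (Weyl H)) : bisetMap H (𝟙 Y) = 𝟙 _ := by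
  refine hom_ext fun z => ?_
  obtain ⟨a, y, rfl⟩ := bisetMk_surj H z
  rfl

theorem bisetMap_comp {X Y Z : FinGSet.{u} (Weyl H)} (f : X ⟶ Y) (g : Y ⟶ Z) :
    bisetMap H (f ≫ g) = bisetMap H f ≫ bisetMap H g := by
  refine hom_ext fun z => ?_
  obtain ⟨a, y, rfl⟩ := bisetMk_surj H z
  rfl

theorem weylMap_inj {k l : Weyl H} {a : orbit H} (h : weylMap H k a = weylMap H l a) : k = l := by
  have h1 : weylMap H (k * l⁻¹) a = a := by
    rw [weylMap_mul, FinGSet.comp_apply, h, ← FinGSet.comp_apply, ← weylMap_mul, mul_inv_cancel, weylMap_one]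
    rfl
  exact mul_inv_eq_one.1 (weylMap_free H _ _ h1)

theorem bisetMap_isPullback {P X Y Z : FinGSet.{u} (Weyl H)} {a : P ⟶ X} {b : P ⟶ Y} {f : X ⟶ Z}
    {g : Y ⟶ Z} (h : IsPullback a b f g) :
    IsPullback (bisetMap H a) (bisetMap H b) (bisetMap H f) (bisetMap H g) := by
  refine isPullback_of ?_ ?_ ?_
  · intro p
    rw [← FinGSet.comp_apply, ← FinGSet.comp_apply, ← bisetMap_comp, ← bisetMap_comp, h.w]
  · intro x y e
    obtain ⟨c, x, rfl⟩ := bisetMk_surj H x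
    obtain ⟨d, y, rfl⟩ := bisetMk_surj H y
    rw [bisetMap_mk, bisetMap_mk, bisetMk_eq] at e
    obtain ⟨k, rfl, e⟩ := e
    rw [← FinGSet.map_smul] at e
    obtain ⟨p, hp, hp'⟩ := exists_of_isPullback h _ _ e
    refine ⟨bisetMk H d p, ?_, ?_⟩
    · rw [bisetMap_mk, hp]
      exact ((bisetMk_eq H).2 ⟨k, rfl, rfl⟩).symm
    · rw [bisetMap_mk, hp']
  · intro p q h1 h2
    obtain ⟨c, p, rfl⟩ := bisetMk_surj H p
    obtain ⟨d, q, rfl⟩ := bisetMk_surj H q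
    rw [bisetMap_mk, bisetMap_mk, bisetMk_eq] at h1 h2
    obtain ⟨k, rfl, h1⟩ := h1
    obtain ⟨l, hl, h2⟩ := h2
    obtain rfl := weylMap_inj H hl
    rw [← FinGSet.map_smul] at h1 h2
    exact (bisetMk_eq H).2 ⟨k, rfl, inj_of_isPullback h _ _ h1 h2⟩

end Biset

namespace SemiMackey

variable {G : Type u} [Group G] (M : SemiMackey.{u, v} G)

theorem res_bijective_of_iso {X Y : FinGSet.{u} G} (f : X ⟶ Y) (hf : Function.Bijective f) :
    Function.Bijective (M.res f) := by
  let e := isoOfBijective f hf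
  refine Function.bijective_iff_has_inverse.2 ⟨M.res e.inv, fun m => ?_, fun m => ?_⟩
  · rw [← M.res_comp]
    exact (congrArg (fun g => M.res g m) e.inv_hom_id).trans (M.res_id m)
  · rw [← M.res_comp]
    exact (congrArg (fun g => M.res g m) e.hom_inv_id).trans (M.res_id m)

end SemiMackey

/-- The semi-Mackey functor `M ∘ U = M(U ∘_K -)` on `K = N_G(H)/H`. -/
def SemiMackey.compBiset {G : Type u} [Group G] [Finite G] (H : Subgroup G)
    (M : SemiMackey.{u, v} G) : SemiMackey.{u, v} (Weyl H) where
  obj Y := M.obj (bisetObj H Y)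
  res f := M.res (bisetMap H f)
  tr f := M.tr (bisetMap H f)
  res_id m := (congrArg (fun f => M.res f m) (bisetMap_id H _)).trans (M.res_id m)
  res_comp f g m := (congrArg (fun f => M.res f m) (bisetMap_comp H f g)).trans (M.res_comp _ _ m)
  tr_id m := (congrArg (fun f => M.tr f m) (bisetMap_id H _)).trans (M.tr_id m)
  tr_comp f g m := (congrArg (fun f => M.tr f m) (bisetMap_comp H f g)).trans (M.tr_comp _ _ m)
  additive X Y := by
    let c := copair (bisetMap H (inl X Y)) (bisetMap H (inr X Y))
    have hc : Function.Bijective c := by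
      constructor
      · rintro (p | p) (q | q) h
        · obtain ⟨a, x, rfl⟩ := bisetMk_surj H p
          obtain ⟨b, y, rfl⟩ := bisetMk_surj H q
          obtain ⟨k, h1, h2⟩ := (bisetMk_eq H).1 h
          exact congrArg Sum.inl ((bisetMk_eq H).2 ⟨k, h1, Sum.inl_injective h2⟩)
        · obtain ⟨a, x, rfl⟩ := bisetMk_surj H p
          obtain ⟨b, y, rfl⟩ := bisetMk_surj H q
          obtain ⟨k, h1, h2⟩ := (bisetMk_eq H).1 h
          exact (Sum.inl_ne_inr (h2 : (Sum.inl (k • x) : X ⊕ Y) = Sum.inr y)).elim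
        · obtain ⟨a, x, rfl⟩ := bisetMk_surj H p
          obtain ⟨b, y, rfl⟩ := bisetMk_surj H q
          obtain ⟨k, h1, h2⟩ := (bisetMk_eq H).1 h
          exact (Sum.inr_ne_inl (h2 : (Sum.inr (k • x) : X ⊕ Y) = Sum.inl y)).elim
        · obtain ⟨a, x, rfl⟩ := bisetMk_surj H p
          obtain ⟨b, y, rfl⟩ := bisetMk_surj H q
          obtain ⟨k, h1, h2⟩ := (bisetMk_eq H).1 h
          exact congrArg Sum.inr ((bisetMk_eq H).2 ⟨k, h1, Sum.inr_injective h2⟩)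
      · intro z
        obtain ⟨a, x | y, rfl⟩ := bisetMk_surj H z
        · exact ⟨Sum.inl (bisetMk H a x), rfl⟩
        · exact ⟨Sum.inr (bisetMk H a y), rfl⟩
    have h := (M.additive (bisetObj H X) (bisetObj H Y)).comp (M.res_bijective_of_iso c hc)
    convert h using 1
    funext m
    show (M.res _ m, M.res _ m) = (M.res _ (M.res c m), M.res _ (M.res c m))
    rw [← M.res_comp, ← M.res_comp]
    rfl
  additive_empty := by
    let c := fromEmpty (bisetObj H (empty (Weyl H)))
    have hc : Function.Bijective c := by
      constructor
      · exact fun p : PEmpty => p.elim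
      · intro z
        obtain ⟨a, x, rfl⟩ := bisetMk_surj H z
        exact (x : PEmpty).elim
    obtain ⟨m, hm⟩ := M.additive_empty
    obtain ⟨n, hn⟩ := (M.res_bijective_of_iso c hc).2 m
    exact ⟨n, fun m' => (M.res_bijective_of_iso c hc).1 ((hm _).trans hn.symm)⟩
  mackey x f' f y h m := M.mackey _ _ _ _ (bisetMap_isPullback H h) m

/-- The functor `- ∘ U : SMack_G ⥤ SMack_K`, where `K = N_G(H)/H`. -/
def compBiset {G : Type u} [Group G] [Finite G] (H : Subgroup G) :
    SemiMackey.{u, v} G ⥤ SemiMackey.{u, v} (Weyl H) where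
  obj M := M.compBiset H
  map φ := ⟨fun Y => φ.app (bisetObj H Y), fun f => φ.app_res (bisetMap H f),
    fun f => φ.app_tr (bisetMap H f)⟩

/-! ## The Burnside semi-ring functor -/

section Burnside

variable {G : Type u} [Group G]

/-- The set `cl(Gset/X)` of isomorphism classes of finite `G`-sets over `X`. -/
def OverClass (X : FinGSet.{u} G) : Type (u + 1) := Quotient (isIsomorphicSetoid (Over X))

/-- The class of `p : A ⟶ X`. -/
def overClass {X A : FinGSet.{u} G} (p : A ⟶ X) : OverClass X :=
  Quotient.mk (isIsomorphicSetoid (Over X)) (Over.mk p)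

theorem overClass_surj {X : FinGSet.{u} G} (z : OverClass X) :
    ∃ (A : FinGSet.{u} G) (p : A ⟶ X), overClass p = z := by
  obtain ⟨A, h⟩ := Quotient.exists_rep z
  exact ⟨A.left, A.hom, h⟩

theorem overClass_eq {X A B : FinGSet.{u} G} {p : A ⟶ X} {q : B ⟶ X} :
    overClass p = overClass q ↔ ∃ h : A ≅ B, h.hom ≫ q = p := by
  refine (Quotient.eq (r := isIsomorphicSetoid (Over X))).trans ⟨?_, ?_⟩
  · rintro ⟨e⟩
    exact ⟨(Over.forget X).mapIso e, Over.w e.hom⟩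
  · rintro ⟨h, w⟩
    exact ⟨Over.isoMk h w⟩

theorem overClass_eq_of_bijective {X A B : FinGSet.{u} G} {p : A ⟶ X} {q : B ⟶ X} (h : A ⟶ B)
    (hb : Function.Bijective h) (w : ∀ a, q (h a) = p a) : overClass p = overClass q :=
  overClass_eq.2 ⟨isoOfBijective h hb, hom_ext w⟩

/-- Pullback of classes along `f`. -/
def OverClass.res {X Y : FinGSet.{u} G} (f : X ⟶ Y) : OverClass Y → OverClass X :=
  Quotient.lift (fun B : Over Y => overClass (pbFst f B.hom)) (by
    rintro B C ⟨e⟩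
    have hw : ∀ b, C.hom (e.hom.left b) = B.hom b := congr_hom (Over.w e.hom)
    have hw' : ∀ c, B.hom (e.inv.left c) = C.hom c := congr_hom (Over.w e.inv)
    have h1 : ∀ b, e.inv.left (e.hom.left b) = b :=
      congr_hom (congrArg CommaMorphism.left e.hom_inv_id)
    have h2 : ∀ c, e.hom.left (e.inv.left c) = c :=
      congr_hom (congrArg CommaMorphism.left e.inv_hom_id)
    refine overClass_eq_of_bijective
      (homMk (fun z : {z : X × B.left // f z.1 = B.hom z.2} =>
        (⟨(z.1.1, e.hom.left z.1.2), z.2.trans (hw _).symm⟩ :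
          {z : X × C.left // f z.1 = C.hom z.2}))
        (fun g z => Subtype.ext (Prod.ext rfl (FinGSet.map_smul e.hom.left g z.1.2)))) ⟨?_, ?_⟩ ?_
    · rintro ⟨⟨x, b⟩, hz⟩ ⟨⟨x', b'⟩, hz'⟩ h
      have h3 : (x, e.hom.left b) = (x', e.hom.left b') := congrArg Subtype.val h
      obtain ⟨h3, h4⟩ := Prod.mk.inj h3
      refine Subtype.ext (Prod.ext h3 ?_)
      exact (h1 b).symm.trans ((congrArg e.inv.left h4).trans (h1 b'))
    · rintro ⟨⟨x, c⟩, hz⟩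
      exact ⟨⟨(x, e.inv.left c), hz.trans (hw' c).symm⟩, Subtype.ext (Prod.ext rfl (h2 c))⟩
    · exact fun _ => rfl)

/-- Composition of classes with `f`. -/
def OverClass.tr {X Y : FinGSet.{u} G} (f : X ⟶ Y) : OverClass X → OverClass Y :=
  Quotient.lift (fun A : Over X => overClass (A.hom ≫ f)) (by
    rintro A B ⟨e⟩
    exact overClass_eq.2 ⟨(Over.forget X).mapIso e, Over.w_assoc e.hom f⟩)

theorem OverClass.res_mk {X Y B P : FinGSet.{u} G} {f : X ⟶ Y} {q : B ⟶ Y} {a : P ⟶ X} {b : P ⟶ B}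
    (h : IsPullback a b f q) : OverClass.res f (overClass q) = overClass a :=
  overClass_eq.2 ⟨(pb_isPullback f q).isoIsPullback _ _ h,
    (pb_isPullback f q).isoIsPullback_hom_fst _ _ h⟩

theorem OverClass.tr_mk {X Y A : FinGSet.{u} G} (f : X ⟶ Y) (p : A ⟶ X) :
    OverClass.tr f (overClass p) = overClass (p ≫ f) := rfl

theorem overClass_decomp {X Y A : FinGSet.{u} G} (p : A ⟶ sum X Y) :
    overClass p =
      overClass (copair (pbFst (inl X Y) p ≫ inl X Y) (pbFst (inr X Y) p ≫ inr X Y)) := by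
  refine (overClass_eq_of_bijective (copair (pbSnd (inl X Y) p) (pbSnd (inr X Y) p))
    ⟨?_, fun a => ?_⟩ ?_).symm
  · rintro (⟨⟨x, a⟩, h⟩ | ⟨⟨x, a⟩, h⟩) (⟨⟨y, b⟩, h'⟩ | ⟨⟨y, b⟩, h'⟩) e
    · obtain rfl : a = b := e
      exact congrArg Sum.inl (Subtype.ext (Prod.ext (Sum.inl_injective (h.trans h'.symm)) rfl))
    · obtain rfl : a = b := e
      exact (Sum.inl_ne_inr (h.trans h'.symm : (Sum.inl x : X ⊕ Y) = Sum.inr y)).elim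
    · obtain rfl : a = b := e
      exact (Sum.inr_ne_inl (h.trans h'.symm : (Sum.inr x : X ⊕ Y) = Sum.inl y)).elim
    · obtain rfl : a = b := e
      exact congrArg Sum.inr (Subtype.ext (Prod.ext (Sum.inr_injective (h.trans h'.symm)) rfl))
  · rcases h : (p a : X ⊕ Y) with x | y
    · exact ⟨Sum.inl ⟨(x, a), h.symm⟩, rfl⟩
    · exact ⟨Sum.inr ⟨(y, a), h.symm⟩, rfl⟩
  · rintro (⟨⟨x, a⟩, h⟩ | ⟨⟨x, a⟩, h⟩)
    · exact h.symm
    · exact h.symm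

theorem overClass_glue {X Y A A' B B' : FinGSet.{u} G} {p : A ⟶ X} {p' : A' ⟶ X} {q : B ⟶ Y}
    {q' : B' ⟶ Y} (hp : overClass p = overClass p') (hq : overClass q = overClass q') :
    overClass (copair (p ≫ inl X Y) (q ≫ inr X Y)) =
      overClass (copair (p' ≫ inl X Y) (q' ≫ inr X Y)) := by
  obtain ⟨e, rfl⟩ := overClass_eq.1 hp
  obtain ⟨e', rfl⟩ := overClass_eq.1 hq
  have h1 : ∀ a, e.inv (e.hom a) = a := congr_hom e.hom_inv_id
  have h2 : ∀ a, e.hom (e.inv a) = a := congr_hom e.inv_hom_id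
  have h3 : ∀ a, e'.inv (e'.hom a) = a := congr_hom e'.hom_inv_id
  have h4 : ∀ a, e'.hom (e'.inv a) = a := congr_hom e'.inv_hom_id
  refine overClass_eq.2 ⟨⟨copair (e.hom ≫ inl _ _) (e'.hom ≫ inr _ _),
    copair (e.inv ≫ inl _ _) (e'.inv ≫ inr _ _), hom_ext ?_, hom_ext ?_⟩, hom_ext ?_⟩
  · rintro (a | a)
    · exact congrArg Sum.inl (h1 a)
    · exact congrArg Sum.inr (h3 a)
  · rintro (a | a)
    · exact congrArg Sum.inl (h2 a)
    · exact congrArg Sum.inr (h4 a)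
  · rintro (a | a) <;> rfl

/-- The additive part `𝔄^α` of the Burnside semi-ring functor: `𝔄(X) = cl(Gset/X)`, restriction is
pullback, and (additive) transfer is composition. -/
def burnside (G : Type u) [Group G] : SemiMackey.{u, max (u + 1) w} G where
  obj X := ULift.{w} (OverClass X)
  res f z := ⟨OverClass.res f z.down⟩
  tr f z := ⟨OverClass.tr f z.down⟩
  res_id := by
    rintro X ⟨z⟩
    obtain ⟨A, p, rfl⟩ := overClass_surj z
    exact congrArg ULift.up (OverClass.res_mk (IsPullback.of_vert_isIso ⟨by simp⟩ :
      IsPullback p (𝟙 A) (𝟙 X) p))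
  res_comp := by
    rintro X Y Z f g ⟨z⟩
    obtain ⟨A, p, rfl⟩ := overClass_surj z
    refine congrArg ULift.up ?_
    have h1 := pb_isPullback g p
    have h2 := pb_isPullback f (pbFst g p)
    rw [OverClass.res_mk h1, OverClass.res_mk h2]
    exact OverClass.res_mk (h2.flip.paste_horiz h1.flip).flip
  tr_id := by
    rintro X ⟨z⟩
    obtain ⟨A, p, rfl⟩ := overClass_surj z
    rfl
  tr_comp := by
    rintro X Y Z f g ⟨z⟩
    obtain ⟨A, p, rfl⟩ := overClass_surj z
    rfl
  additive X Y := by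
    constructor
    · rintro ⟨z⟩ ⟨z'⟩ h
      obtain ⟨A, p, rfl⟩ := overClass_surj z
      obtain ⟨B, q, rfl⟩ := overClass_surj z'
      obtain ⟨h1, h2⟩ := Prod.mk.inj h
      have h1' := congrArg ULift.down h1
      have h2' := congrArg ULift.down h2
      rw [OverClass.res_mk (pb_isPullback _ p), OverClass.res_mk (pb_isPullback _ q)] at h1' h2'
      rw [overClass_decomp p, overClass_decomp q, overClass_glue h1' h2']
    · rintro ⟨⟨z⟩, ⟨z'⟩⟩
      obtain ⟨A, p, rfl⟩ := overClass_surj z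
      obtain ⟨B, q, rfl⟩ := overClass_surj z'
      refine ⟨⟨overClass (copair (p ≫ inl X Y) (q ≫ inr X Y))⟩, ?_⟩
      have h1 : IsPullback p (inl A B) (inl X Y) (copair (p ≫ inl X Y) (q ≫ inr X Y)) := by
        refine isPullback_of (fun _ => rfl) ?_ (fun a b _ h => Sum.inl_injective h)
        rintro x (a | b) h
        · exact ⟨a, (Sum.inl_injective (h : (Sum.inl x : X ⊕ Y) = Sum.inl (p a))).symm, rfl⟩
        · exact (Sum.inl_ne_inr (h : (Sum.inl x : X ⊕ Y) = Sum.inr (q b))).elim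
      have h2 : IsPullback q (inr A B) (inr X Y) (copair (p ≫ inl X Y) (q ≫ inr X Y)) := by
        refine isPullback_of (fun _ => rfl) ?_ (fun a b _ h => Sum.inr_injective h)
        rintro y (a | b) h
        · exact (Sum.inr_ne_inl (h : (Sum.inr y : X ⊕ Y) = Sum.inl (p a))).elim
        · exact ⟨b, (Sum.inr_injective (h : (Sum.inr y : X ⊕ Y) = Sum.inr (q b))).symm, rfl⟩
      exact Prod.ext (congrArg ULift.up (OverClass.res_mk h1))
        (congrArg ULift.up (OverClass.res_mk h2))
  additive_empty := by
    refine ⟨⟨overClass (𝟙 _)⟩, ?_⟩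
    rintro ⟨z⟩
    obtain ⟨A, p, rfl⟩ := overClass_surj z
    refine congrArg ULift.up (overClass_eq_of_bijective p ⟨fun a => ?_, ?_⟩ fun _ => rfl)
    · exact (p a : PEmpty).elim
    · exact fun x : PEmpty => x.elim
  mackey := by
    rintro X' Y' X Y x f' f y h ⟨z⟩
    obtain ⟨A, p, rfl⟩ := overClass_surj z
    refine congrArg ULift.up ?_
    have h1 := pb_isPullback f' p
    rw [OverClass.res_mk h1, OverClass.tr_mk, OverClass.tr_mk]
    exact (OverClass.res_mk (h1.flip.paste_vert h.flip).flip).symm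

end Burnside

end Functors

/-- The additive monoid `ℕ`, as an object of `Mon`. -/
def natMon : CommMonCat.{v} := CommMonCat.of (ULift.{v} (Multiplicative ℕ))

/-- The semi-Mackey functor `𝔛_H = L_U(ℒ^K_ℕ)`, `K = N_G(H)/H`, formed with the left adjoints `ℒ` of
`ev (Weyl H)` and `L` of `compBiset H`. -/
def frakX {G : Type u} [Group G] [Finite G] {H : Subgroup G}
    (ℒ : CommMonCat.{v} ⥤ SemiMackey.{u, v} (Weyl H))
    (L : SemiMackey.{u, v} (Weyl H) ⥤ SemiMackey.{u, v} G) : SemiMackey.{u, v} G :=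
  L.obj (ℒ.obj natMon)

/-!
The proof has three ingredients.

*Left adjoints.* Semi-Mackey and Tambara functors are the models of many-sorted equational theories,
with one sort for each finite `G`-set: apart from the operations `res`, `tr`, `nm`, the bijectivity
of `M(X ⊔ Y) ⟶ M(X) × M(Y)` amounts to a pairing operation, and additive inverses to a negation. So
the left adjoints of `(-)^μ`, of `M ↦ M(K/e)^K` and of `M ↦ M(U ∘_K -)` are given by formal
expressions modulo an identification. The identification used here is semantic: two expressions are
equal if they have the same value in every model, for every admissible interpretation of the
generators (`freeMackey`, `freeTambara`). All laws then hold because they hold in each model, and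
the universal property is immediate; the only point that needs an argument is uniqueness, an
induction on expressions.

*Tensor products.* Let `TensorSet T S X` be the set of symbols `[t ⊗ s]_{(A, p)}` modulo the two
relations `a^*(t') ⊗ s ∼ t' ⊗ a_+(s)` and `a_+(t) ⊗ s' ∼ t ⊗ a^*(s')`, without any additivity. Since
addition in `T(A)` is the transfer along the codiagonal of `A`, the relations already make symbols
biadditive, and this set is the group `(T ⊗_Ω S)(X)` (`tensorEquiv`). On it the multiplicative
transfer, which is not additive, can be defined symbol by symbol; that it respects the relations,
and the axioms of a Tambara functor, follow from the calculus of exponential diagrams: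
`IsExponential.comp` (functoriality in `f`), `IsExponential.comp_left` (functoriality in `p`) and
`IsExponential.base_change`.
Frobenius reciprocity (`Tambara.tr_prod`), itself an instance of the distributive law, shows that
`[t ⊗ s]_{(A, p)} ↦ p_+(φ(t) · ψ(s))` is well defined, so the tensor product is the coproduct of
Tambara functors (`IsTensor.desc`, `IsTensor.hom_ext`).

*Corepresentability.* Consequently `T`-Tambara morphisms `T[M] ⟶ S` are morphisms `M ⟶ S^μ`
(`TensorFunctor.polUnderEquiv`). For `M = 𝔛_H` the two adjunctions turn these into monoid morphisms
`ℕ ⟶ S(U ∘_K K/e)^K`, and `U ∘_K K/e` is `G/H` with `K` acting through `weylMap`; so `𝔛_H`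
corepresents `N ↦ N(G/H)^{N_G(H)/H}` (`frakXEquiv`). The Burnside functor corepresents `N ↦ N(G/G)`
(`burnsideEquiv`), and `ℒ^G_ℕ` corepresents `N ↦ N(G/e)^G` (`natFreeEquiv`), which identifies `𝔛_G`
and `𝔛_e`.
-/

/-! ### Exponential diagrams -/

namespace FinGSet

variable {G : Type u} [Group G]

theorem isoHom_bijective {X Y : FinGSet.{u} G} (e : X ≅ Y) : Function.Bijective e.hom :=
  Function.bijective_iff_has_inverse.2
    ⟨e.inv, congr_hom e.hom_inv_id, congr_hom e.inv_hom_id⟩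

/-- The elementwise content of an exponential diagram: `Z` is the pullback of `f` and `q`, and the
points of `B` over `y` correspond, through `l`, to the sections of `p` over `f⁻¹(y)`. -/
structure ExpCriterion {X Y A Z B : FinGSet.{u} G} (f : X ⟶ Y) (p : A ⟶ X) (l : Z ⟶ A) (r : Z ⟶ B)
    (q : B ⟶ Y) : Prop where
  comm : ∀ z, f (p (l z)) = q (r z)
  ex : ∀ x b, f x = q b → ∃ z, p (l z) = x ∧ r z = b
  inj : ∀ z z', p (l z) = p (l z') → r z = r z' → z = z'
  sec : ∀ (y : Y) (σ : ∀ x, f x = y → A), (∀ x h, p (σ x h) = x) →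
    ∃ b, q b = y ∧ ∀ z, r z = b → ∀ h, l z = σ (p (l z)) h
  uniq : ∀ b b', q b = q b' →
    (∀ z z', r z = b → r z' = b' → p (l z) = p (l z') → l z = l z') → b = b'

theorem expCriterion_pi {X Y A : FinGSet.{u} G} (f : X ⟶ Y) (p : A ⟶ X) :
    ExpCriterion f p (piEval f p) (piSnd f p) (piBase f p) := by
  have hp : ∀ z : {z : X × PiSet f p // f z.1 = z.2.base}, p (piEval f p z) = z.1.1 :=
    fun z => z.1.2.p_sec ⟨z.1.1, z.2⟩
  refine ⟨fun z => ?_, fun x b h => ?_, fun z z' h1 h2 => ?_, fun y σ hσ => ?_,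
    fun b b' h1 h2 => ?_⟩
  · exact (congrArg f (hp z)).trans z.2
  · exact ⟨⟨(x, b), h⟩, hp _, rfl⟩
  · exact Subtype.ext (Prod.ext ((hp z).symm.trans (h1.trans (hp z'))) h2)
  · refine ⟨(⟨y, fun x => σ x.1 x.2, fun x => hσ _ _⟩ : PiSet f p), rfl, ?_⟩
    rintro ⟨⟨x, b⟩, hz⟩ h h'
    obtain rfl : b = _ := h
    have := hp ⟨(x, _), hz⟩
    show σ x _ = σ _ _
    congr 1
    exact this.symm
  · refine PiSet.ext' h1 fun x hs ht => ?_
    exact h2 (⟨(x, b), hs⟩ : {z : X × PiSet f p // f z.1 = z.2.base})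
      (⟨(x, b'), ht⟩ : {z : X × PiSet f p // f z.1 = z.2.base}) rfl rfl
      ((hp ⟨(x, b), hs⟩).trans (hp ⟨(x, b'), ht⟩).symm)

theorem ExpCriterion.isExponential {X Y A Z B : FinGSet.{u} G} {f : X ⟶ Y} {p : A ⟶ X} {l : Z ⟶ A}
    {r : Z ⟶ B} {q : B ⟶ Y} (H : ExpCriterion f p l r q) : IsExponential f p l r q := by
  -- `c x b` is the point of `Z` over `(x, b)`; a point `b` of `B` gives the section `x ↦ l (c x b)`
  choose c hc1 hc2 using H.ex
  have key : ∀ z, ∀ x b h, x = p (l z) → b = r z → c x b h = z := by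
    rintro z x b h rfl rfl
    exact H.inj _ _ (hc1 _ _ _) (hc2 _ _ _)
  let β : B ⟶ pi f p := homMk
    (fun b => (⟨q b, fun x => l (c x.1 b x.2), fun x => hc1 _ _ _⟩ : PiSet f p)) (by
      intro g b
      refine PiSet.ext' (map_smul q g b) fun x hs ht => ?_
      show l (c x (g • b) _) = g • l (c (g⁻¹ • x) b _)
      rw [← map_smul]
      congr 1
      apply key
      · rw [map_smul, map_smul, hc1, smul_inv_smul]
      · rw [map_smul, hc2])
  have hβs : ∀ b x h, PiSet.sec (β b) ⟨x, h⟩ = l (c x b h) := fun _ _ _ => rfl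
  have hβ : Function.Bijective β := by
    constructor
    · intro b b' h
      have hq : q b = q b' := congrArg PiSet.base h
      refine H.uniq b b' hq ?_
      rintro z z' rfl rfl hz
      have hsec : ∀ (s t : PiSet f p) (x : X) (hs : f x = s.base) (ht : f x = t.base), s = t →
          s.sec ⟨x, hs⟩ = t.sec ⟨x, ht⟩ := by
        rintro s _ x hs ht rfl; rfl
      have h1 : l (c (p (l z)) (r z) (H.comm z)) = l (c (p (l z)) (r z') ((H.comm z).trans hq)) :=
        hsec (β (r z)) (β (r z')) (p (l z)) (H.comm z) ((H.comm z).trans hq) h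
      rwa [key z _ _ _ rfl rfl, key z' _ _ _ hz rfl] at h1
    · rintro ⟨y, σ, hσ⟩
      obtain ⟨b, hb, hb'⟩ := H.sec y (fun x h => σ ⟨x, h⟩) (fun x h => hσ ⟨x, h⟩)
      refine ⟨b, PiSet.ext' hb fun x hs ht => ?_⟩
      rw [hβs, hb' (c x b hs) (hc2 _ _ _) ((congrArg f (hc1 _ _ _)).trans ht)]
      congr 2
      exact hc1 _ _ _
  let ζ : Z ⟶ pb f (piBase f p) := homMk
    (fun z => (⟨(p (l z), β (r z)), H.comm z⟩ : {z : X × PiSet f p // f z.1 = z.2.base}))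
    (fun g z => Subtype.ext (Prod.ext (by
      show p (l (g • z)) = g • p (l z)
      simp only [map_smul]) (by
      show β (r (g • z)) = g • β (r z)
      simp only [map_smul])))
  have hζ : Function.Bijective ζ := by
    constructor
    · intro z z' h
      obtain ⟨h1, h2⟩ := Prod.mk.inj (congrArg Subtype.val h)
      exact H.inj _ _ h1 (hβ.1 h2)
    · rintro ⟨⟨x, s⟩, hz⟩
      obtain ⟨b, rfl⟩ := hβ.2 s
      exact ⟨c x b hz, Subtype.ext (Prod.ext (hc1 _ _ _) (congrArg β (hc2 _ _ _)))⟩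
  refine ⟨isoOfBijective ζ hζ, isoOfBijective β hβ, hom_ext fun z => ?_, rfl, rfl⟩
  exact congrArg l (key z _ _ _ rfl rfl)

theorem IsExponential.expCriterion {X Y A Z B : FinGSet.{u} G} {f : X ⟶ Y} {p : A ⟶ X} {l : Z ⟶ A}
    {r : Z ⟶ B} {q : B ⟶ Y} (H : IsExponential f p l r q) : ExpCriterion f p l r q := by
  obtain ⟨ζ, β, hl, hr, hq⟩ := H
  have hζ := isoHom_bijective ζ
  have hβ := isoHom_bijective β
  have K := expCriterion_pi f p
  have hl' : ∀ z, l z = piEval f p (ζ.hom z) := fun z => (congr_hom hl z).symm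
  have hr' : ∀ z, β.hom (r z) = piSnd f p (ζ.hom z) := fun z => (congr_hom hr z).symm
  have hq' : ∀ b, q b = piBase f p (β.hom b) := fun b => (congr_hom hq b).symm
  refine ⟨fun z => ?_, fun x b h => ?_, fun z z' h1 h2 => ?_, fun y σ hσ => ?_,
    fun b b' h1 h2 => ?_⟩
  · rw [hl', K.comm, hq', hr']
  · obtain ⟨z, hz1, hz2⟩ := K.ex x (β.hom b) (h.trans (hq' b))
    obtain ⟨z, rfl⟩ := hζ.2 z
    exact ⟨z, by rw [hl', hz1], hβ.1 (by rw [hr', hz2])⟩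
  · exact hζ.1 (K.inj _ _ (by rw [← hl', h1, hl']) (by rw [← hr', h2, hr']))
  · obtain ⟨b, hb, hb'⟩ := K.sec y σ hσ
    obtain ⟨b, rfl⟩ := hβ.2 b
    refine ⟨b, (hq' b).trans hb, fun z hz h => ?_⟩
    subst hz
    have := hb' (ζ.hom z) (hr' z).symm (by rw [← hl']; exact h)
    simp only [← hl'] at this
    exact this
  · refine hβ.1 (K.uniq _ _ (by rw [← hq', h1, hq']) fun z z' hz hz' h => ?_)
    obtain ⟨z, rfl⟩ := hζ.2 z
    obtain ⟨z', rfl⟩ := hζ.2 z'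
    rw [← hl', ← hl']
    rw [← hl', ← hl'] at h
    exact h2 z z' (hβ.1 (by rw [hr', hz])) (hβ.1 (by rw [hr', hz'])) h

theorem isExponential_pi {X Y A : FinGSet.{u} G} (f : X ⟶ Y) (p : A ⟶ X) :
    IsExponential f p (piEval f p) (piSnd f p) (piBase f p) :=
  (expCriterion_pi f p).isExponential

theorem isExponential_id {X A : FinGSet.{u} G} (p : A ⟶ X) :
    IsExponential (𝟙 X) p (𝟙 A) (𝟙 A) p := by
  refine ExpCriterion.isExponential ⟨fun _ => rfl, fun x b h => ⟨b, h.symm, rfl⟩,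
    fun _ _ _ h => h, fun y σ hσ => ⟨σ y rfl, hσ y rfl, ?_⟩, fun b b' h1 h2 => h2 b b' rfl rfl h1⟩
  have hc : ∀ x x' h h', x = x' → σ x h = σ x' h' := by rintro x _ _ _ rfl; rfl
  rintro z rfl h
  exact hc _ _ _ _ h.symm

theorem isExponential_of_id {X Y : FinGSet.{u} G} (f : X ⟶ Y) :
    IsExponential f (𝟙 X) (𝟙 X) f (𝟙 Y) :=
  ExpCriterion.isExponential ⟨fun _ => rfl, fun x _ h => ⟨x, rfl, h⟩,
    fun _ _ h _ => h, fun y _ hσ => ⟨y, rfl, fun z _ h => (hσ z h).symm⟩, fun _ _ h1 _ => h1⟩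

/-- Exponential diagrams compose along `X ⟶ Y ⟶ W`: `Π_g Π_f = Π_{gf}`. -/
theorem IsExponential.comp {X Y W A Z B Z' B' P : FinGSet.{u} G} {f : X ⟶ Y} {g : Y ⟶ W}
    {p : A ⟶ X} {l : Z ⟶ A} {r : Z ⟶ B} {q : B ⟶ Y} {l' : Z' ⟶ B} {r' : Z' ⟶ B'} {q' : B' ⟶ W}
    {a : P ⟶ Z} {b : P ⟶ Z'} (H : IsExponential f p l r q) (H' : IsExponential g q l' r' q')
    (hP : IsPullback a b r l') : IsExponential (f ≫ g) p (a ≫ l) (b ≫ r') q' := by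
  have K := H.expCriterion
  have K' := H'.expCriterion
  have hc : ∀ z, r (a z) = l' (b z) := comm_apply hP.w
  refine ExpCriterion.isExponential ⟨fun z => ?_, fun x y h => ?_, fun z z' h1 h2 => ?_,
    fun y σ hσ => ?_, fun y y' h1 h2 => ?_⟩
  · simp only [comp_apply]
    rw [K.comm, hc, K'.comm]
  · obtain ⟨z', h1, h2⟩ := K'.ex _ _ h
    obtain ⟨z, h3, h4⟩ := K.ex x (l' z') h1.symm
    obtain ⟨t, rfl, rfl⟩ := exists_of_isPullback hP z z' h4
    exact ⟨t, h3, h2⟩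
  · simp only [comp_apply] at h1 h2
    have h3 : b z = b z' := by
      refine K'.inj _ _ ?_ h2
      rw [← hc, ← hc, ← K.comm, ← K.comm, h1]
    refine inj_of_isPullback hP _ _ (K.inj _ _ h1 ?_) h3
    rw [hc, hc, h3]
  · choose τ hτ hτ' using fun (y' : Y) (h : g y' = y) =>
      K.sec y' (fun x hx => σ x ((congrArg g hx).trans h)) (fun x hx => hσ _ _)
    obtain ⟨b', hb, hb'⟩ := K'.sec y τ hτ
    refine ⟨b', hb, fun z hz h => ?_⟩
    have h1 : g (q (l' (b z))) = y := (K'.comm _).trans ((congrArg q' hz).trans hb)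
    exact hτ' _ h1 (a z) ((hc z).trans (hb' (b z) hz h1)) ((K.comm _).trans (congrArg q (hc z)))
  · refine K'.uniq _ _ h1 fun z z' hz hz' h => K.uniq _ _ h fun t t' ht ht' h' => ?_
    obtain ⟨s, rfl, rfl⟩ := exists_of_isPullback hP _ _ ht
    obtain ⟨s', rfl, rfl⟩ := exists_of_isPullback hP _ _ ht'
    exact h2 s s' hz hz' h'

/-- Exponential diagrams compose along `C ⟶ A ⟶ X`: sections of `C ⟶ X` are sections of `A ⟶ X`
together with sections of the pullback of `C ⟶ A` along evaluation. -/
theorem IsExponential.comp_left {X Y A C Z B E Z' D : FinGSet.{u} G} {f : X ⟶ Y} {p : A ⟶ X}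
    {l : Z ⟶ A} {r : Z ⟶ B} {q : B ⟶ Y} {c : C ⟶ A} {e : E ⟶ C} {c' : E ⟶ Z} {l' : Z' ⟶ E}
    {r' : Z' ⟶ D} {q' : D ⟶ B} (H : IsExponential f p l r q) (hE : IsPullback e c' c l)
    (H' : IsExponential r c' l' r' q') : IsExponential f (c ≫ p) (l' ≫ e) r' (q' ≫ q) := by
  have K := H.expCriterion
  have K' := H'.expCriterion
  have hc : ∀ z, c (e z) = l (c' z) := comm_apply hE.w
  refine ExpCriterion.isExponential ⟨fun z => ?_, fun x y h => ?_, fun z z' h1 h2 => ?_,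
    fun y σ hσ => ?_, fun y y' h1 h2 => ?_⟩
  · simp only [comp_apply]
    rw [hc, K.comm, K'.comm]
  · obtain ⟨z, h1, h2⟩ := K.ex _ _ h
    obtain ⟨z', h3, h4⟩ := K'.ex z y h2
    refine ⟨z', ?_, h4⟩
    simp only [comp_apply]
    rw [hc, h3, h1]
  · simp only [comp_apply] at h1 h2
    refine K'.inj _ _ (K.inj _ _ ?_ ?_) h2
    · rw [← hc, ← hc, h1]
    · rw [K'.comm, K'.comm, h2]
  · obtain ⟨b, hb, hb'⟩ := K.sec y (fun x h => c (σ x h)) hσ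
    have h0 : ∀ z, r z = b → f (p (l z)) = y := fun z hz =>
      (K.comm z).trans ((congrArg q hz).trans hb)
    choose τ hτ hτ' using fun (z : Z) (hz : r z = b) =>
      exists_of_isPullback hE (σ _ (h0 z hz)) z (hb' z hz _).symm
    obtain ⟨d, hd, hd'⟩ := K'.sec b τ hτ'
    refine ⟨d, (congrArg q hd).trans hb, fun z hz h => ?_⟩
    have h1 : r (c' (l' z)) = b := (K'.comm z).trans ((congrArg q' hz).trans hd)
    have hs : ∀ x x' h h', x = x' → σ x h = σ x' h' := by rintro x _ _ _ rfl; rfl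
    exact (congrArg e (hd' z hz h1)).trans
      ((hτ _ _).trans (hs _ _ _ _ (congrArg p (hc (l' z)).symm)))
  · have hq : q' y = q' y' := by
      refine K.uniq _ _ h1 fun z z' hz hz' h => ?_
      obtain ⟨t, rfl, rfl⟩ := K'.ex z y hz
      obtain ⟨t', rfl, rfl⟩ := K'.ex z' y' hz'
      rw [← hc, ← hc]
      refine congrArg c (h2 t t' rfl rfl ?_)
      simp only [comp_apply]
      rw [hc, hc, h]
    refine K'.uniq _ _ hq fun z z' hz hz' h => ?_
    refine inj_of_isPullback hE _ _ (h2 z z' hz hz' ?_) h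
    simp only [comp_apply]
    rw [hc, hc, h]

/-- Base change of exponential diagrams. -/
theorem IsExponential.base_change {X Y A Z B X' Y' A' Z' B' : FinGSet.{u} G} {f : X ⟶ Y}
    {p : A ⟶ X} {l : Z ⟶ A} {r : Z ⟶ B} {q : B ⟶ Y} {f' : X' ⟶ Y'} {x : X' ⟶ X} {y : Y' ⟶ Y}
    {p' : A' ⟶ X'} {a : A' ⟶ A} {q' : B' ⟶ Y'} {b : B' ⟶ B} {r' : Z' ⟶ B'} {z : Z' ⟶ Z}
    {l' : Z' ⟶ A'} (H : IsExponential f p l r q) (hX : IsPullback x f' f y)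
    (hA : IsPullback a p' p x) (hB : IsPullback b q' q y) (hZ : IsPullback z r' r b)
    (hl : l' ≫ a = z ≫ l) (hl' : l' ≫ p' ≫ f' = r' ≫ q') : IsExponential f' p' l' r' q' := by
  have K := H.expCriterion
  have cX : ∀ t, f (x t) = y (f' t) := comm_apply hX.w
  have cA : ∀ t, p (a t) = x (p' t) := comm_apply hA.w
  have cB : ∀ t, q (b t) = y (q' t) := comm_apply hB.w
  have cZ : ∀ t, r (z t) = b (r' t) := comm_apply hZ.w
  have cl : ∀ t, a (l' t) = l (z t) := comm_apply hl
  have cl' : ∀ t, f' (p' (l' t)) = q' (r' t) := congr_hom hl'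
  refine ExpCriterion.isExponential ⟨cl', fun t s h => ?_, fun t t' h1 h2 => ?_,
    fun t σ hσ => ?_, fun s s' h1 h2 => ?_⟩
  · obtain ⟨w, h1, h2⟩ := K.ex (x t) (b s) (by rw [cX, h, cB])
    obtain ⟨w, rfl, rfl⟩ := exists_of_isPullback hZ w s h2
    refine ⟨w, inj_of_isPullback hX _ _ ?_ ?_, rfl⟩
    · rw [← cA, cl, h1]
    · rw [cl', h]
  · refine inj_of_isPullback hZ _ _ (K.inj _ _ ?_ ?_) h2
    · rw [← cl, ← cl, cA, cA, h1]
    · rw [cZ, cZ, h2]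
  · choose ξ hξ hξ' using fun (s : X) (hs : f s = y t) => exists_of_isPullback hX s t hs
    obtain ⟨b₀, hb, hb'⟩ := K.sec (y t) (fun s hs => a (σ (ξ s hs) (hξ' s hs)))
      (fun s hs => by rw [cA, hσ, hξ])
    obtain ⟨b', rfl, hb''⟩ := exists_of_isPullback hB b₀ t hb
    refine ⟨b', hb'', fun w hw h => inj_of_isPullback hA _ _ ?_ (hσ _ _).symm⟩
    have h0 : f (p (l (z w))) = y t := by rw [K.comm, cZ, hw, hb]
    rw [cl, hb' (z w) (by rw [cZ, hw]) h0]
    congr 2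
    refine inj_of_isPullback hX _ _ ?_ ?_
    · rw [hξ, ← cA, cl]
    · rw [hξ', h]
  · refine inj_of_isPullback hB _ _ (K.uniq _ _ (by rw [cB, cB, h1]) fun w w' hw hw' h => ?_) h1
    obtain ⟨w, rfl, rfl⟩ := exists_of_isPullback hZ w s hw
    obtain ⟨w', rfl, rfl⟩ := exists_of_isPullback hZ w' s' hw'
    rw [← cl, ← cl]
    refine congrArg a (h2 w w' rfl rfl (inj_of_isPullback hX _ _ ?_ ?_))
    · rw [← cA, ← cA, cl, cl, h]
    · rw [cl', cl', h1]

/-- The exponential diagram behind Frobenius reciprocity: a section of `a ⊔ 𝟙` over the two copies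
of a point `y` is a point of `A` over `y`. -/
theorem isExponential_fold {A X : FinGSet.{u} G} (a : A ⟶ X) :
    IsExponential (fold X) (copair (a ≫ inl X X) (inr X X)) (copair (inl A X) (a ≫ inr A X))
      (fold A) a := by
  refine ExpCriterion.isExponential ⟨?_, ?_, ?_, fun y σ hσ => ?_, fun b b' h1 h2 => ?_⟩
  · rintro (z | z) <;> rfl
  · rintro (x | x) b h
    · exact ⟨Sum.inl b, congrArg Sum.inl (h : x = a b).symm, rfl⟩
    · exact ⟨Sum.inr b, congrArg Sum.inr (h : x = a b).symm, rfl⟩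
  · rintro (z | z) (z' | z') h1 h2
    · exact congrArg Sum.inl h2
    · exact (Sum.inl_ne_inr h1).elim
    · exact (Sum.inr_ne_inl h1).elim
    · exact congrArg Sum.inr h2
  · have h1 := hσ (Sum.inl y) rfl
    rcases h : σ (Sum.inl y) rfl with b | x
    · rw [h] at h1
      obtain rfl : a b = y := Sum.inl_injective h1
      refine ⟨b, rfl, ?_⟩
      rintro (z | z) hz h'
      · obtain rfl : z = b := hz
        exact h.symm
      · obtain rfl : z = b := hz
        have h2 := hσ (Sum.inr (a z)) rfl
        rcases h3 : σ (Sum.inr (a z)) rfl with c | x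
        · rw [h3] at h2
          exact (Sum.inl_ne_inr h2).elim
        · rw [h3] at h2
          refine Eq.trans ?_ h3.symm
          exact congrArg Sum.inr (Sum.inr_injective h2).symm
    · rw [h] at h1
      exact (Sum.inr_ne_inl h1).elim
  · exact Sum.inl_injective (h2 (Sum.inl b) (Sum.inl b') rfl rfl (congrArg Sum.inl h1))

end FinGSet

/-! ### Semi-Mackey functors and finite coproducts -/

namespace FinGSet

variable {G : Type u} [Group G]

/-- The coproduct of two maps. -/
def sumMap {A X B Y : FinGSet.{u} G} (a : A ⟶ X) (b : B ⟶ Y) : sum A B ⟶ sum X Y :=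
  copair (a ≫ inl X Y) (b ≫ inr X Y)

theorem sumMap_isPullback_inl {A X B Y : FinGSet.{u} G} (a : A ⟶ X) (b : B ⟶ Y) :
    IsPullback a (inl A B) (inl X Y) (sumMap a b) := by
  refine isPullback_of (fun _ => rfl) ?_ (fun p q _ h => Sum.inl_injective h)
  rintro x (c | c) h
  · exact ⟨c, (Sum.inl_injective h).symm, rfl⟩
  · exact (Sum.inl_ne_inr h).elim

theorem sumMap_isPullback_inr {A X B Y : FinGSet.{u} G} (a : A ⟶ X) (b : B ⟶ Y) :
    IsPullback b (inr A B) (inr X Y) (sumMap a b) := by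
  refine isPullback_of (fun _ => rfl) ?_ (fun p q _ h => Sum.inr_injective h)
  rintro x (c | c) h
  · exact (Sum.inr_ne_inl h).elim
  · exact ⟨c, (Sum.inr_injective h).symm, rfl⟩

theorem sumMap_comp {A B C A' B' C' : FinGSet.{u} G} (a : A ⟶ B) (b : B ⟶ C) (a' : A' ⟶ B')
    (b' : B' ⟶ C') : sumMap (a ≫ b) (a' ≫ b') = sumMap a a' ≫ sumMap b b' :=
  hom_ext (by rintro (x | x) <;> rfl)

theorem pb_copair_bijective {X Y A : FinGSet.{u} G} (p : A ⟶ sum X Y) :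
    Function.Bijective (copair (pbSnd (inl X Y) p) (pbSnd (inr X Y) p)) := by
  refine ⟨?_, fun a => ?_⟩
  · rintro (⟨⟨x, a⟩, h⟩ | ⟨⟨x, a⟩, h⟩) (⟨⟨y, b⟩, h'⟩ | ⟨⟨y, b⟩, h'⟩) e
    · obtain rfl : a = b := e
      exact congrArg Sum.inl (Subtype.ext (Prod.ext (Sum.inl_injective (h.trans h'.symm)) rfl))
    · obtain rfl : a = b := e
      exact (Sum.inl_ne_inr (h.trans h'.symm : (Sum.inl x : X ⊕ Y) = Sum.inr y)).elim
    · obtain rfl : a = b := e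
      exact (Sum.inr_ne_inl (h.trans h'.symm : (Sum.inr x : X ⊕ Y) = Sum.inl y)).elim
    · obtain rfl : a = b := e
      exact congrArg Sum.inr (Subtype.ext (Prod.ext (Sum.inr_injective (h.trans h'.symm)) rfl))
  · rcases h : (p a : X ⊕ Y) with x | y
    · exact ⟨Sum.inl ⟨(x, a), h.symm⟩, rfl⟩
    · exact ⟨Sum.inr ⟨(y, a), h.symm⟩, rfl⟩

theorem isPullback_id {X A : FinGSet.{u} G} (p : A ⟶ X) : IsPullback p (𝟙 A) (𝟙 X) p :=
  IsPullback.of_vert_isIso ⟨by simp⟩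

end FinGSet

open FinGSet

namespace SemiMackey

variable {G : Type u} [Group G] (M : SemiMackey.{u, v} G)

theorem res_sumMap {A X B Y : FinGSet.{u} G} (a : A ⟶ X) (b : B ⟶ Y) (m : M.obj X) (n : M.obj Y) :
    M.res (sumMap a b) (M.pair m n) = M.pair (M.res a m) (M.res b n) := by
  apply M.sum_ext
  · rw [← M.res_comp, show inl A B ≫ sumMap a b = a ≫ inl X Y from rfl, M.res_comp]; simp
  · rw [← M.res_comp, show inr A B ≫ sumMap a b = b ≫ inr X Y from rfl, M.res_comp]; simp

theorem tr_sumMap {A X B Y : FinGSet.{u} G} (a : A ⟶ X) (b : B ⟶ Y) (m : M.obj A) (n : M.obj B) :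
    M.tr (sumMap a b) (M.pair m n) = M.pair (M.tr a m) (M.tr b n) := by
  apply M.sum_ext
  · rw [← M.mackey _ _ _ _ (sumMap_isPullback_inl a b)]; simp
  · rw [← M.mackey _ _ _ _ (sumMap_isPullback_inr a b)]; simp

theorem res_copair {X Y Z : FinGSet.{u} G} (f : X ⟶ Z) (g : Y ⟶ Z) (m : M.obj Z) :
    M.res (copair f g) m = M.pair (M.res f m) (M.res g m) := by
  apply M.sum_ext
  · rw [← M.res_comp, show inl X Y ≫ copair f g = f from rfl]; simp
  · rw [← M.res_comp, show inr X Y ≫ copair f g = g from rfl]; simp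

theorem pair_eq_mul {X Y : FinGSet.{u} G} (m : M.obj X) (n : M.obj Y) :
    M.pair m n = M.mul (M.tr (inl X Y) m) (M.tr (inr X Y) n) := by
  rw [← M.tr_copair, show copair (inl X Y) (inr X Y) = 𝟙 _ from
    hom_ext (by rintro (x | x) <;> rfl), M.tr_id]

theorem tr_mul {X Y : FinGSet.{u} G} (f : X ⟶ Y) (m n : M.obj X) :
    M.tr f (M.mul m n) = M.mul (M.tr f m) (M.tr f n) := by
  rw [mul, ← M.tr_comp, ← M.tr_copair]
  congr 1
  exact hom_ext (by rintro (x | x) <;> rfl)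

theorem tr_one {X Y : FinGSet.{u} G} (f : X ⟶ Y) : M.tr f (M.one X) = M.one Y := by
  rw [one, ← M.tr_comp]
  congr 1
  exact hom_ext fun x : PEmpty => x.elim

theorem empty_ext (m n : M.obj (empty G)) : m = n :=
  (M.additive_empty.choose_spec m).trans (M.additive_empty.choose_spec n).symm

theorem tr_fromEmpty {X : FinGSet.{u} G} (m : M.obj (empty G)) : M.tr (fromEmpty X) m = M.one X :=
  congrArg _ (M.empty_ext _ _)

theorem Hom.map_pair {M N : SemiMackey.{u, v} G} (φ : Hom M N) {X Y : FinGSet.{u} G} (a : M.obj X)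
    (b : M.obj Y) : φ.app _ (M.pair a b) = N.pair (φ.app _ a) (φ.app _ b) := by
  apply N.sum_ext <;> rw [← φ.app_res] <;> simp

end SemiMackey

/-! ### The tensor product on the level of symbols -/

section

variable {G : Type u} [Group G] (T S : Tambara.{u, v} G)

/-- A formal symbol `[t ⊗ s]_{(A, p)}`. -/
structure TensorSym (X : FinGSet.{u} G) : Type (max (u + 1) v) where
  dom : FinGSet.{u} G
  map : dom ⟶ X
  fst : T.obj dom
  snd : S.obj dom

/-- The relations `a^*(t') ⊗ s ∼ t' ⊗ a_+(s)` and `a_+(t) ⊗ s' ∼ t ⊗ a^*(s')` between symbols. -/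
inductive TensorSymRel (X : FinGSet.{u} G) : TensorSym T S X → TensorSym T S X → Prop
  | left {A A' : FinGSet.{u} G} (a : A ⟶ A') (p : A' ⟶ X) (t : T.obj A') (s : S.obj A) :
      TensorSymRel X ⟨A, a ≫ p, T.res a t, s⟩ ⟨A', p, t, S.tr a s⟩
  | right {A A' : FinGSet.{u} G} (a : A ⟶ A') (p : A' ⟶ X) (t : T.obj A) (s : S.obj A') :
      TensorSymRel X ⟨A, a ≫ p, t, S.res a s⟩ ⟨A', p, T.tr a t, s⟩

/-- The set of symbols modulo the two relations. No additivity is imposed: it holds automatically,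
and this set turns out to be the group `(T ⊗_Ω S)(X)`. -/
def TensorSet (X : FinGSet.{u} G) : Type (max (u + 1) v) := Quot (TensorSymRel T S X)

namespace TensorSet

variable {T S}

/-- The class of the symbol `[t ⊗ s]_{(A, p)}`. -/
def mk {X A : FinGSet.{u} G} (p : A ⟶ X) (t : T.obj A) (s : S.obj A) : TensorSet T S X :=
  Quot.mk _ ⟨A, p, t, s⟩

theorem exists_mk {X : FinGSet.{u} G} (z : TensorSet T S X) :
    ∃ (A : FinGSet.{u} G) (p : A ⟶ X) (t : T.obj A) (s : S.obj A), mk p t s = z := by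
  obtain ⟨⟨A, p, t, s⟩, h⟩ := Quot.exists_rep z
  exact ⟨A, p, t, s, h⟩

theorem mk_res_left {X A A' : FinGSet.{u} G} (a : A ⟶ A') (p : A' ⟶ X) (t : T.obj A')
    (s : S.obj A) : mk (a ≫ p) (T.res a t) s = mk p t (S.tr a s) :=
  Quot.sound (.left a p t s)

theorem mk_res_right {X A A' : FinGSet.{u} G} (a : A ⟶ A') (p : A' ⟶ X) (t : T.obj A)
    (s : S.obj A') : mk (a ≫ p) t (S.res a s) = mk p (T.tr a t) s :=
  Quot.sound (.right a p t s)

/-- The symmetry `[t ⊗ s] ↦ [s ⊗ t]`. -/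
def swap {X : FinGSet.{u} G} : TensorSet T S X → TensorSet S T X :=
  Quot.map (fun x => ⟨x.dom, x.map, x.snd, x.fst⟩) (by
    rintro _ _ (⟨a, p, t, s⟩ | ⟨a, p, t, s⟩)
    · exact .right a p s t
    · exact .left a p s t)

/-- Isomorphic symbols are equal, as transfer along an isomorphism inverts restriction. -/
theorem mk_iso {X A B : FinGSet.{u} G} (e : A ≅ B) {p : A ⟶ X} {q : B ⟶ X} (w : e.hom ≫ q = p)
    (t : T.obj B) (s : S.obj B) : mk p (T.res e.hom t) (S.res e.hom s) = mk q t s := by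
  subst w
  rw [mk_res_left, show S.tr e.hom (S.res e.hom s) = s from ?_]
  rw [S.tr_iso, ← S.res_comp, e.inv_hom_id, S.res_id]

/-! ### Restriction of symbols -/

/-- The restriction of a symbol along `f`, computed by the canonical pullback. -/
def resSym {X Y : FinGSet.{u} G} (f : X ⟶ Y) (x : TensorSym T S Y) : TensorSet T S X :=
  mk (pbFst f x.map) (T.res (pbSnd f x.map) x.fst) (S.res (pbSnd f x.map) x.snd)

/-- Any pullback square may be used to compute the restriction. -/
theorem resSym_of_isPullback {X Y B P : FinGSet.{u} G} {f : X ⟶ Y} {q : B ⟶ Y} {a : P ⟶ X}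
    {b : P ⟶ B} (h : IsPullback a b f q) (t : T.obj B) (s : S.obj B) :
    resSym f ⟨B, q, t, s⟩ = mk a (T.res b t) (S.res b s) := by
  have h' := pb_isPullback f q
  rw [← mk_iso (h'.isoIsPullback _ _ h) (h'.isoIsPullback_hom_fst _ _ h), ← T.res_comp,
    ← S.res_comp, h'.isoIsPullback_hom_snd _ _ h]
  rfl

/-- Restriction respects the first relation, by base change of the transfer along `a`. The second
relation follows by the symmetry `swap`. -/
theorem resSym_left {X Y A A' : FinGSet.{u} G} (f : X ⟶ Y) (a : A ⟶ A') (p : A' ⟶ Y) (t : T.obj A')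
    (s : S.obj A) :
    resSym f ⟨A, a ≫ p, T.res a t, s⟩ = resSym f ⟨A', p, t, S.tr a s⟩ := by
  have h1 := pb_isPullback f p
  have h2 := pb_isPullback (pbSnd f p) a
  have h3 := (h2.flip.paste_vert h1.flip).flip
  rw [resSym_of_isPullback h3, resSym_of_isPullback h1, ← S.mackey _ _ _ _ h2, ← mk_res_left,
    ← T.res_comp, ← T.res_comp, h2.w]

/-- Restriction along `f`. -/
def res {X Y : FinGSet.{u} G} (f : X ⟶ Y) : TensorSet T S Y → TensorSet T S X :=
  Quot.lift (resSym f) (by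
    rintro _ _ (⟨a, p, t, s⟩ | ⟨a, p, t, s⟩)
    · exact resSym_left f a p t s
    · exact congrArg swap (resSym_left f a p s t))

theorem res_mk {X Y B P : FinGSet.{u} G} {f : X ⟶ Y} {q : B ⟶ Y} {a : P ⟶ X} {b : P ⟶ B}
    (h : IsPullback a b f q) (t : T.obj B) (s : S.obj B) :
    res f (mk q t s) = mk a (T.res b t) (S.res b s) :=
  resSym_of_isPullback h t s

/-! ### Additive transfer of symbols -/

/-- Additive transfer along `f`. -/
def tr {X Y : FinGSet.{u} G} (f : X ⟶ Y) : TensorSet T S X → TensorSet T S Y :=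
  Quot.map (fun x => ⟨x.dom, x.map ≫ f, x.fst, x.snd⟩) (by
    rintro _ _ (⟨a, p, t, s⟩ | ⟨a, p, t, s⟩)
    · exact .left a (p ≫ f) t s
    · exact .right a (p ≫ f) t s)

theorem tr_mk {X Y A : FinGSet.{u} G} (f : X ⟶ Y) (p : A ⟶ X) (t : T.obj A) (s : S.obj A) :
    tr f (mk p t s) = mk (p ≫ f) t s := rfl

/-! ### Multiplicative transfer of symbols -/

/-- The multiplicative transfer of a symbol along `f`, computed by the canonical exponential
diagram. -/
def nmSym {X Y : FinGSet.{u} G} (f : X ⟶ Y) (x : TensorSym T S X) : TensorSet T S Y :=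
  mk (piBase f x.map) (T.nm (piSnd f x.map) (T.res (piEval f x.map) x.fst))
    (S.nm (piSnd f x.map) (S.res (piEval f x.map) x.snd))

/-- Any exponential diagram may be used to compute the multiplicative transfer. -/
theorem nmSym_of_isExponential {X Y A Z B : FinGSet.{u} G} {f : X ⟶ Y} {p : A ⟶ X} {l : Z ⟶ A}
    {r : Z ⟶ B} {q : B ⟶ Y} (h : IsExponential f p l r q) (t : T.obj A) (s : S.obj A) :
    nmSym f ⟨A, p, t, s⟩ = mk q (T.nm r (T.res l t)) (S.nm r (S.res l s)) := by
  obtain ⟨ζ, β, rfl, hr, hq⟩ := h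
  have h : IsPullback r ζ.hom β.hom (piSnd f p) := (IsPullback.of_horiz_isIso ⟨hr⟩).flip
  have hT : ∀ R : Tambara.{u, v} G, ∀ m : R.obj A, R.nm r (R.res (ζ.hom ≫ piEval f p) m) =
      R.res β.hom (R.nm (piSnd f p) (R.res (piEval f p) m)) := fun R m => by
    rw [R.res_comp, R.nm_mackey _ _ _ _ h]
  rw [hT, hT, mk_iso β hq]
  rfl

/-- Multiplicative transfer respects the first relation. The distributive law rewrites
`f'_• e^*(a_+ s)` as a transfer along a projection `q`, which the relation moves to the other
factor; the resulting exponential diagrams compose to one for `f` and `a ≫ p`. -/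
theorem nmSym_left {X Y A A' : FinGSet.{u} G} (f : X ⟶ Y) (a : A ⟶ A') (p : A' ⟶ X) (t : T.obj A')
    (s : S.obj A) :
    nmSym f ⟨A, a ≫ p, T.res a t, s⟩ = nmSym f ⟨A', p, t, S.tr a s⟩ := by
  have H := isExponential_pi f p
  have hE := pb_isPullback a (piEval f p)
  have H' := isExponential_pi (piSnd f p) (pbSnd a (piEval f p))
  have hev : pbFst (piSnd f p) (piBase _ (pbSnd a (piEval f p))) =
      piEval (piSnd f p) (pbSnd a (piEval f p)) ≫ pbSnd a (piEval f p) :=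
    hom_ext fun z => (z.1.2.p_sec ⟨z.1.1, z.2⟩).symm
  rw [nmSym_of_isExponential (H.comp_left hE H'), nmSym_of_isExponential H,
    ← S.mackey _ _ _ _ hE.flip, S.distrib _ _ _ _ _ H', ← mk_res_left,
    ← T.nm_mackey _ _ _ _ (pb_isPullback _ _).flip, ← T.res_comp, ← T.res_comp, ← S.res_comp,
    hev, Category.assoc, Category.assoc, hE.w]
  rfl

/-- Multiplicative transfer along `f`. -/
def nm {X Y : FinGSet.{u} G} (f : X ⟶ Y) : TensorSet T S X → TensorSet T S Y :=
  Quot.lift (nmSym f) (by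
    rintro _ _ (⟨a, p, t, s⟩ | ⟨a, p, t, s⟩)
    · exact nmSym_left f a p t s
    · exact congrArg swap (nmSym_left f a p s t))

theorem nm_mk {X Y A Z B : FinGSet.{u} G} {f : X ⟶ Y} {p : A ⟶ X} {l : Z ⟶ A}
    {r : Z ⟶ B} {q : B ⟶ Y} (h : IsExponential f p l r q) (t : T.obj A) (s : S.obj A) :
    nm f (mk p t s) = mk q (T.nm r (T.res l t)) (S.nm r (S.res l s)) :=
  nmSym_of_isExponential h t s

/-! ### Symbols over a coproduct -/

/-- The symbol over `X ⊔ Y` assembled from a symbol over `X` and a symbol over `Y`. -/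
noncomputable def glueSym {X Y : FinGSet.{u} G} (x : TensorSym T S X) (y : TensorSym T S Y) :
    TensorSet T S (sum X Y) :=
  mk (sumMap x.map y.map) (T.pair x.fst y.fst) (S.pair x.snd y.snd)

/-- The first relation, applied in both arguments at once; taking `a` or `b` to be an identity gives
the relation in one argument. -/
theorem glueSym_left {X Y A A' B B' : FinGSet.{u} G} (a : A ⟶ A') (p : A' ⟶ X) (b : B ⟶ B')
    (q : B' ⟶ Y) (t : T.obj A') (s : S.obj A) (t' : T.obj B') (s' : S.obj B) :
    glueSym ⟨A, a ≫ p, T.res a t, s⟩ ⟨B, b ≫ q, T.res b t', s'⟩ =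
      glueSym ⟨A', p, t, S.tr a s⟩ ⟨B', q, t', S.tr b s'⟩ := by
  show mk (sumMap (a ≫ p) (b ≫ q)) (T.pair _ _) (S.pair _ _) =
    mk (sumMap p q) (T.pair _ _) (S.pair _ _)
  rw [sumMap_comp, ← T.res_sumMap, mk_res_left, S.tr_sumMap]

theorem glueSym_left_fst {X Y A A' : FinGSet.{u} G} (a : A ⟶ A') (p : A' ⟶ X) (t : T.obj A')
    (s : S.obj A) (y : TensorSym T S Y) :
    glueSym ⟨A, a ≫ p, T.res a t, s⟩ y = glueSym ⟨A', p, t, S.tr a s⟩ y := by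
  obtain ⟨B, q, t', s'⟩ := y
  have := glueSym_left a p (𝟙 B) q t s t' s'
  rwa [T.res_id, S.tr_id, Category.id_comp] at this

theorem glueSym_left_snd {X Y A A' : FinGSet.{u} G} (a : A ⟶ A') (p : A' ⟶ Y) (t : T.obj A')
    (s : S.obj A) (y : TensorSym T S X) :
    glueSym y ⟨A, a ≫ p, T.res a t, s⟩ = glueSym y ⟨A', p, t, S.tr a s⟩ := by
  obtain ⟨B, q, t', s'⟩ := y
  have := glueSym_left (𝟙 B) q a p t' s' t s
  rwa [T.res_id, S.tr_id, Category.id_comp] at this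

/-- The element of the tensor product over `X ⊔ Y` with given components. -/
noncomputable def glue {X Y : FinGSet.{u} G} :
    TensorSet T S X → TensorSet T S Y → TensorSet T S (sum X Y) :=
  Quot.lift₂ glueSym
    (by
      rintro y _ _ (⟨a, p, t, s⟩ | ⟨a, p, t, s⟩)
      · exact glueSym_left_snd a p t s y
      · exact congrArg swap (glueSym_left_snd a p s t ⟨y.dom, y.map, y.snd, y.fst⟩))
    (by
      rintro _ _ y (⟨a, p, t, s⟩ | ⟨a, p, t, s⟩)
      · exact glueSym_left_fst a p t s y
      · exact congrArg swap (glueSym_left_fst a p s t ⟨y.dom, y.map, y.snd, y.fst⟩))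

theorem glue_mk {X Y A B : FinGSet.{u} G} (p : A ⟶ X) (q : B ⟶ Y) (t : T.obj A) (s : S.obj A)
    (t' : T.obj B) (s' : S.obj B) :
    glue (mk p t s) (mk q t' s') = mk (sumMap p q) (T.pair t t') (S.pair s s') := rfl

theorem res_inl_glue {X Y : FinGSet.{u} G} (x : TensorSet T S X) (y : TensorSet T S Y) :
    res (inl X Y) (glue x y) = x := by
  obtain ⟨A, p, t, s, rfl⟩ := exists_mk x
  obtain ⟨B, q, t', s', rfl⟩ := exists_mk y
  rw [glue_mk, res_mk (sumMap_isPullback_inl p q), T.res_inl_pair, S.res_inl_pair]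

theorem res_inr_glue {X Y : FinGSet.{u} G} (x : TensorSet T S X) (y : TensorSet T S Y) :
    res (inr X Y) (glue x y) = y := by
  obtain ⟨A, p, t, s, rfl⟩ := exists_mk x
  obtain ⟨B, q, t', s', rfl⟩ := exists_mk y
  rw [glue_mk, res_mk (sumMap_isPullback_inr p q), T.res_inr_pair, S.res_inr_pair]

theorem glue_res {X Y : FinGSet.{u} G} (z : TensorSet T S (sum X Y)) :
    glue (res (inl X Y) z) (res (inr X Y) z) = z := by
  obtain ⟨A, p, t, s, rfl⟩ := exists_mk z
  rw [res_mk (pb_isPullback _ p), res_mk (pb_isPullback _ p), glue_mk, ← T.res_copair,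
    ← S.res_copair]
  refine mk_iso (isoOfBijective _ (pb_copair_bijective p)) (hom_ext ?_) t s
  rintro (⟨⟨x, a⟩, h⟩ | ⟨⟨x, a⟩, h⟩) <;> exact h.symm

theorem empty_ext (x y : TensorSet T S (empty G)) : x = y := by
  have key : ∀ z : TensorSet T S (empty G),
      z = mk (𝟙 _) T.additive_empty.choose S.additive_empty.choose := fun z => by
    obtain ⟨A, p, t, s, rfl⟩ := exists_mk z
    have hp : Function.Bijective p := ⟨fun a => (p a : PEmpty).elim, fun x : PEmpty => x.elim⟩
    obtain ⟨t, rfl⟩ := (T.res_bijective_of_iso p hp).2 t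
    obtain ⟨s, rfl⟩ := (S.res_bijective_of_iso p hp).2 s
    rw [T.toSemiMackey.empty_ext t T.additive_empty.choose,
      S.toSemiMackey.empty_ext s S.additive_empty.choose]
    exact mk_iso (isoOfBijective p hp) (Category.comp_id _) _ _
  rw [key x, key y]

end TensorSet

open TensorSet

/-- The additive part of `T ⊗_Ω S`. -/
def tensorMackey : SemiMackey.{u, max (u + 1) v} G where
  obj := TensorSet T S
  res := res
  tr := tr
  res_id z := by
    obtain ⟨A, p, t, s, rfl⟩ := exists_mk z
    rw [res_mk (isPullback_id p), T.res_id, S.res_id]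
  res_comp f g z := by
    obtain ⟨A, p, t, s, rfl⟩ := exists_mk z
    have h1 := pb_isPullback g p
    have h2 := pb_isPullback f (pbFst g p)
    rw [res_mk h1, res_mk h2, res_mk (h2.flip.paste_horiz h1.flip).flip, T.res_comp, S.res_comp]
  tr_id z := by
    obtain ⟨A, p, t, s, rfl⟩ := exists_mk z
    rfl
  tr_comp f g z := by
    obtain ⟨A, p, t, s, rfl⟩ := exists_mk z
    rfl
  additive X Y := by
    constructor
    · intro z z' h
      rw [← glue_res z, ← glue_res z']
      obtain ⟨h1, h2⟩ := Prod.mk.inj h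
      rw [h1, h2]
    · rintro ⟨x, y⟩
      exact ⟨glue x y, Prod.ext (res_inl_glue x y) (res_inr_glue x y)⟩
  additive_empty :=
    ⟨mk (𝟙 _) T.additive_empty.choose S.additive_empty.choose, fun _ => empty_ext _ _⟩
  mackey x f' f y h z := by
    obtain ⟨A, p, t, s, rfl⟩ := exists_mk z
    have h1 := pb_isPullback f' p
    rw [res_mk h1, tr_mk, tr_mk, res_mk (h1.flip.paste_vert h.flip).flip]

/-- The semi-Tambara functor underlying `T ⊗_Ω S`. -/
def tensorSemiTambara : SemiTambara.{u, max (u + 1) v} G where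
  toSemiMackey := tensorMackey T S
  nm := nm
  nm_id z := by
    obtain ⟨A, p, t, s, rfl⟩ := exists_mk z
    rw [nm_mk (isExponential_id p), T.nm_id, S.nm_id, T.res_id, S.res_id]
  nm_comp f g z := by
    obtain ⟨A, p, t, s, rfl⟩ := exists_mk z
    have H := isExponential_pi f p
    have H' := isExponential_pi g (piBase f p)
    have h := pb_isPullback (piSnd f p) (piEval g (piBase f p))
    rw [nm_mk H, nm_mk H', nm_mk (H.comp H' h), ← T.nm_mackey _ _ _ _ h.flip,
      ← S.nm_mackey _ _ _ _ h.flip, T.nm_comp, S.nm_comp, T.res_comp, S.res_comp]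
  nm_mackey x f' f y h z := by
    obtain ⟨A, p, t, s, rfl⟩ := exists_mk z
    have H := isExponential_pi y p
    have hA := pb_isPullback f' p
    have hB := pb_isPullback f (piBase y p)
    have hZ := pb_isPullback (piSnd y p) (pbSnd f (piBase y p))
    have hw : ∀ z, y (p (piEval y p (pbFst (piSnd y p) (pbSnd f (piBase y p)) z))) =
        f (pbFst f (piBase y p) (pbSnd (piSnd y p) (pbSnd f (piBase y p)) z)) := fun z => by
      rw [H.expCriterion.comm, comm_apply hZ.w, comm_apply hB.w]
    -- the evaluation `l'` of the diagram obtained by base change along `f`: its components in `X'`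
    -- and `A` are induced by the evaluation of the canonical diagram for `y` and `p`
    let k := h.flip.lift (pbFst (piSnd y p) (pbSnd f (piBase y p)) ≫ piEval y p ≫ p)
      (pbSnd (piSnd y p) (pbSnd f (piBase y p)) ≫ pbFst f (piBase y p)) (hom_ext hw)
    let l' := hA.lift k (pbFst (piSnd y p) (pbSnd f (piBase y p)) ≫ piEval y p)
      ((h.flip.lift_fst _ _ _).trans (Category.assoc _ _ _).symm)
    have H' : IsExponential x (pbFst f' p) l' (pbSnd (piSnd y p) (pbSnd f (piBase y p)))
        (pbFst f (piBase y p)) := by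
      refine H.base_change h.flip hA.flip hB.flip hZ (hA.lift_snd _ _ _) ?_
      rw [← Category.assoc, hA.lift_fst]
      exact h.flip.lift_snd _ _ _
    have hl : l' ≫ pbSnd f' p = _ := hA.lift_snd _ _ _
    show nm x (res f' (mk p t s)) = res f (nm y (mk p t s))
    rw [res_mk hA, nm_mk H', nm_mk H, res_mk hB, ← T.nm_mackey _ _ _ _ hZ.flip,
      ← S.nm_mackey _ _ _ _ hZ.flip, ← T.res_comp, ← S.res_comp, ← T.res_comp, ← S.res_comp, hl]
  distrib f p l r q H z := by
    obtain ⟨C, c, t, s, rfl⟩ := exists_mk z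
    have hE := pb_isPullback l c
    have H' := isExponential_pi r (pbFst l c)
    show nm f (tr p (mk c t s)) = tr q (nm r (res l (mk c t s)))
    rw [tr_mk, res_mk hE, nm_mk H', tr_mk, nm_mk (H.comp_left hE.flip H'), T.res_comp, S.res_comp]

theorem tensorMackey_pair {X Y : FinGSet.{u} G} (x : TensorSet T S X) (y : TensorSet T S Y) :
    (tensorMackey T S).pair x y = glue x y := by
  apply (tensorMackey T S).sum_ext
  · exact ((tensorMackey T S).res_inl_pair x y).trans (res_inl_glue x y).symm
  · exact ((tensorMackey T S).res_inr_pair x y).trans (res_inr_glue x y).symm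

theorem tensorMackey_mul {X A B : FinGSet.{u} G} (p : A ⟶ X) (t : T.obj A) (s : S.obj A)
    (q : B ⟶ X) (t' : T.obj B) (s' : S.obj B) :
    (tensorMackey T S).mul (mk p t s) (mk q t' s') =
      mk (copair p q) (T.pair t t') (S.pair s s') := by
  have h : copair p q = sumMap p q ≫ fold X := hom_ext (by rintro (x | x) <;> rfl)
  rw [h]
  exact congrArg (tr (fold X)) (tensorMackey_pair T S (mk p t s) (mk q t' s'))

/-- Symbols are additive in the first factor: the codiagonal transfer defining the sum is moved to
the second factor, where it becomes the restriction to two copies of the same element. -/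
theorem tensorMackey_mul_left {X A : FinGSet.{u} G} (p : A ⟶ X) (t t' : T.obj A) (s : S.obj A) :
    (tensorMackey T S).mul (mk p t s) (mk p t' s) = mk p (T.toSemiMackey.mul t t') s := by
  have h : copair p p = fold A ≫ p := hom_ext (by rintro (x | x) <;> rfl)
  have h' : S.pair s s = S.res (fold A) s := by
    rw [fold, S.res_copair, S.res_id]
  rw [tensorMackey_mul, h, h', mk_res_right]
  rfl

theorem tensorMackey_mul_right {X A : FinGSet.{u} G} (p : A ⟶ X) (t : T.obj A) (s s' : S.obj A) :
    (tensorMackey T S).mul (mk p t s) (mk p t s') = mk p t (S.toSemiMackey.mul s s') := by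
  have h : copair p p = fold A ≫ p := hom_ext (by rintro (x | x) <;> rfl)
  have h' : T.pair t t = T.res (fold A) t := by
    rw [fold, T.res_copair, T.res_id]
  rw [tensorMackey_mul, h, h', mk_res_left]
  rfl

theorem tensorMackey_mk_one_left {X A : FinGSet.{u} G} (p : A ⟶ X) (s : S.obj A) :
    mk p (T.toSemiMackey.one A) s = (tensorMackey T S).one X := by
  rw [SemiMackey.one, ← mk_res_right, ← (tensorMackey T S).tr_fromEmpty
    (mk (𝟙 _) T.additive_empty.choose (S.res (fromEmpty A) s))]
  show _ = mk _ _ _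
  congr 1
  exact hom_ext fun x : PEmpty => x.elim

/-- The tensor product `T ⊗_Ω S`, with the set of symbols as its value. -/
noncomputable def tensorTambara : Tambara.{u, max (u + 1) v} G where
  toSemiTambara := tensorSemiTambara T S
  exists_neg z := by
    obtain ⟨A, p, t, s, rfl⟩ := exists_mk z
    obtain ⟨n, hn⟩ := T.exists_neg t
    refine ⟨mk p n s, ?_⟩
    show (tensorMackey T S).mul (mk p n s) (mk p t s) = _
    rw [tensorMackey_mul_left, hn, tensorMackey_mk_one_left]
    rfl

end

/-! ### Comparison of symbols with the tensor product groups -/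

section

open scoped TensorProduct DirectSum

variable {G : Type u} [Group G] (T S : Tambara.{u, v} G)

section Symbols

variable {T S} {X : FinGSet.{u} G}

theorem symbol_res_left {A A' : FinGSet.{u} G} (a : A ⟶ A') (p : A' ⟶ X) (t : T.obj A')
    (s : S.obj A) : symbol T S (a ≫ p) (T.res a t) s = symbol T S p t (S.tr a s) := by
  rw [symbol, symbol, ← sub_eq_zero, ← QuotientAddGroup.mk_sub, QuotientAddGroup.eq_zero_iff]
  exact AddSubgroup.subset_closure (Or.inl ⟨Over.mk (a ≫ p), Over.mk p, Over.homMk a, t, s, rfl⟩)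

theorem symbol_res_right {A A' : FinGSet.{u} G} (a : A ⟶ A') (p : A' ⟶ X) (t : T.obj A)
    (s : S.obj A') : symbol T S (a ≫ p) t (S.res a s) = symbol T S p (T.tr a t) s := by
  symm
  rw [symbol, symbol, ← sub_eq_zero, ← QuotientAddGroup.mk_sub, QuotientAddGroup.eq_zero_iff]
  exact AddSubgroup.subset_closure (Or.inr ⟨Over.mk (a ≫ p), Over.mk p, Over.homMk a, t, s, rfl⟩)

theorem symbol_add_left {A : FinGSet.{u} G} (p : A ⟶ X) (t t' : T.obj A) (s : S.obj A) :
    symbol T S p (t + t') s = symbol T S p t s + symbol T S p t' s := by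
  rw [symbol, preSymbol, TensorProduct.add_tmul, map_add, QuotientAddGroup.mk_add]
  rfl

theorem symbol_zero_left {A : FinGSet.{u} G} (p : A ⟶ X) (s : S.obj A) :
    symbol T S p 0 s = 0 := by
  rw [symbol, preSymbol, TensorProduct.zero_tmul, map_zero, QuotientAddGroup.mk_zero]

/-- A sum of two symbols is a symbol on the disjoint union. -/
theorem symbol_add_symbol {A B : FinGSet.{u} G} (p : A ⟶ X) (q : B ⟶ X) (t : T.obj A) (s : S.obj A)
    (t' : T.obj B) (s' : S.obj B) :
    symbol T S p t s + symbol T S q t' s' =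
      symbol T S (copair p q) (T.pair t t') (S.pair s s') := by
  have h : T.pair t t' = T.tr (inl A B) t + T.tr (inr A B) t' := T.pair_eq_mul t t'
  rw [h, symbol_add_left, ← symbol_res_right, ← symbol_res_right, S.res_inl_pair, S.res_inr_pair]
  rfl

/-- Every element of `(T ⊗_Ω S)(X)` is a single symbol. -/
theorem exists_symbol (z : TensorObj T S X) :
    ∃ (A : FinGSet.{u} G) (p : A ⟶ X) (t : T.obj A) (s : S.obj A), symbol T S p t s = z := by
  classical
  have h0 : ∃ (A : FinGSet.{u} G) (p : A ⟶ X) (t : T.obj A) (s : S.obj A), symbol T S p t s = 0 :=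
    ⟨X, 𝟙 X, 0, 0, symbol_zero_left _ _⟩
  have hadd : ∀ z z' : TensorObj T S X,
      (∃ (A : FinGSet.{u} G) (p : A ⟶ X) (t : T.obj A) (s : S.obj A), symbol T S p t s = z) →
      (∃ (A : FinGSet.{u} G) (p : A ⟶ X) (t : T.obj A) (s : S.obj A), symbol T S p t s = z') →
      ∃ (A : FinGSet.{u} G) (p : A ⟶ X) (t : T.obj A) (s : S.obj A),
        symbol T S p t s = z + z' := by
    rintro _ _ ⟨A, p, t, s, rfl⟩ ⟨B, q, t', s', rfl⟩
    exact ⟨_, _, _, _, (symbol_add_symbol p q t s t' s').symm⟩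
  obtain ⟨z, rfl⟩ := QuotientAddGroup.mk_surjective z
  induction z using DirectSum.induction_on with
  | zero => exact h0
  | of A x =>
    induction x using TensorProduct.induction_on with
    | zero => rw [map_zero]; exact h0
    | tmul t s =>
      refine ⟨A.left, A.hom, t, s, ?_⟩
      rw [symbol, preSymbol]
      congr!
    | add x y hx hy => rw [map_add]; exact hadd _ _ hx hy
  | add x y hx hy => exact hadd _ _ hx hy

end Symbols

open TensorSet

/-- The class of a symbol, as an element of the group `(T ⊗_Ω S)(X)`. -/
noncomputable def tensorMk {X A : FinGSet.{u} G} (p : A ⟶ X) (t : T.obj A) (s : S.obj A) :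
    (tensorTambara T S).obj X :=
  mk p t s

theorem tensorMk_add_left {X A : FinGSet.{u} G} (p : A ⟶ X) (t t' : T.obj A) (s : S.obj A) :
    tensorMk T S p (t + t') s = tensorMk T S p t s + tensorMk T S p t' s :=
  (tensorMackey_mul_left T S p t t' s).symm

theorem tensorMk_add_right {X A : FinGSet.{u} G} (p : A ⟶ X) (t : T.obj A) (s s' : S.obj A) :
    tensorMk T S p t (s + s') = tensorMk T S p t s + tensorMk T S p t s' :=
  (tensorMackey_mul_right T S p t s s').symm

open Classical in
/-- The additive map from the direct sum of the groups `T(A) ⊗ S(A)`, `t ⊗ s ↦ [t ⊗ s]`. -/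
noncomputable def preTensorToSet (X : FinGSet.{u} G) :
    PreTensor T S X →+ (tensorTambara T S).obj X :=
  DirectSum.toAddMonoid fun A => TensorProduct.liftAddHom
    (AddMonoidHom.mk' (fun t => AddMonoidHom.mk' (fun s => tensorMk T S A.hom t s)
      (tensorMk_add_right T S A.hom t))
      (fun t t' => AddMonoidHom.ext (tensorMk_add_left T S A.hom t t')))
    (fun n t s => by simp only [map_zsmul]; rfl)

theorem preTensorToSet_preSymbol {X : FinGSet.{u} G} (A : Over X) (t : T.obj A.left)
    (s : S.obj A.left) : preTensorToSet T S X (preSymbol T S A t s) = mk A.hom t s := by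
  classical
  rw [preTensorToSet, preSymbol, DirectSum.toAddMonoid_of]
  rfl

/-- The additive map `(T ⊗_Ω S)(X) ⟶ TensorSet T S X`. -/
noncomputable def tensorToSet (X : FinGSet.{u} G) :
    TensorObj T S X →+ (tensorTambara T S).obj X :=
  QuotientAddGroup.lift _ (preTensorToSet T S X) (by
    rw [tensorRel, AddSubgroup.closure_le]
    rintro _ (⟨A, A', a, t, s, rfl⟩ | ⟨A, A', a, t, s, rfl⟩)
    · refine (map_sub _ _ _).trans (sub_eq_zero.2 ?_)
      rw [preTensorToSet_preSymbol, preTensorToSet_preSymbol, ← mk_res_left, Over.w]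
    · refine (map_sub _ _ _).trans (sub_eq_zero.2 ?_)
      rw [preTensorToSet_preSymbol, preTensorToSet_preSymbol, ← mk_res_right, Over.w])

theorem tensorToSet_symbol {X A : FinGSet.{u} G} (p : A ⟶ X) (t : T.obj A) (s : S.obj A) :
    tensorToSet T S X (symbol T S p t s) = mk p t s :=
  preTensorToSet_preSymbol T S (Over.mk p) t s

/-- The inverse map, sending the class of a symbol to the symbol. -/
noncomputable def setToTensor (X : FinGSet.{u} G) : TensorSet T S X → TensorObj T S X :=
  Quot.lift (fun x => symbol T S x.map x.fst x.snd) (by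
    rintro _ _ (⟨a, p, t, s⟩ | ⟨a, p, t, s⟩)
    · exact symbol_res_left a p t s
    · exact symbol_res_right a p t s)

/-- The additive identification of `(T ⊗_Ω S)(X)` with the set of symbols. -/
noncomputable def tensorEquiv (X : FinGSet.{u} G) :
    TensorObj T S X ≃+ (tensorTambara T S).obj X :=
  AddEquiv.ofBijective (tensorToSet T S X) (by
    refine ⟨Function.LeftInverse.injective (g := setToTensor T S X) fun z => ?_, fun z => ?_⟩
    · obtain ⟨A, p, t, s, rfl⟩ := exists_symbol z
      rw [tensorToSet_symbol]
      rfl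
    · obtain ⟨A, p, t, s, rfl⟩ := exists_mk z
      exact ⟨_, tensorToSet_symbol T S p t s⟩)

theorem tensorEquiv_symbol {X A : FinGSet.{u} G} (p : A ⟶ X) (t : T.obj A) (s : S.obj A) :
    tensorEquiv T S X (symbol T S p t s) = mk p t s :=
  tensorToSet_symbol T S p t s

variable {T S}

/-- Functoriality of the tensor product: `[t ⊗ s] ↦ [τ(t) ⊗ σ(s)]`. -/
def tensorMap {T' S' : Tambara.{u, v} G} (τ : T ⟶ T') (σ : S ⟶ S') :
    tensorTambara T S ⟶ tensorTambara T' S' where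
  app X := Quot.map (fun x => ⟨x.dom, x.map, τ.app _ x.fst, σ.app _ x.snd⟩) (by
    rintro _ _ (⟨a, p, t, s⟩ | ⟨a, p, t, s⟩)
    · simp only [τ.app_res, σ.app_tr]
      exact .left a p _ _
    · simp only [σ.app_res, τ.app_tr]
      exact .right a p _ _)
  app_res f z := by
    obtain ⟨A, p, t, s, rfl⟩ := exists_mk z
    show mk _ (τ.app _ (T.res _ t)) (σ.app _ (S.res _ s)) = mk _ (T'.res _ _) (S'.res _ _)
    rw [τ.app_res, σ.app_res]
  app_tr f z := by
    obtain ⟨A, p, t, s, rfl⟩ := exists_mk z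
    rfl
  app_nm f z := by
    obtain ⟨A, p, t, s, rfl⟩ := exists_mk z
    show mk _ (τ.app _ (T.nm _ (T.res _ t))) (σ.app _ (S.nm _ (S.res _ s))) =
      mk _ (T'.nm _ (T'.res _ _)) (S'.nm _ (S'.res _ _))
    rw [τ.app_nm, σ.app_nm, τ.app_res, σ.app_res]

end

/-! ### The tensor product is a coproduct -/

namespace FinGSet

theorem isPullback_id_id {G : Type u} [Group G] {X Y : FinGSet.{u} G} (f : X ⟶ Y) :
    IsPullback (𝟙 X) f f (𝟙 Y) :=
  isPullback_of (fun _ => rfl) (fun x _ h => ⟨x, rfl, h⟩) (fun _ _ h _ => h)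

end FinGSet

section

variable {G : Type u} [Group G]

theorem SemiMackey.hom_ext {M N : SemiMackey.{u, v} G} {φ ψ : M ⟶ N}
    (h : ∀ X t, φ.app X t = ψ.app X t) : φ = ψ :=
  SemiMackey.Hom.ext (funext fun X => funext (h X))

namespace Tambara

theorem hom_ext {T S : Tambara.{u, v} G} {φ ψ : T ⟶ S}
    (h : ∀ X t, φ.app X t = ψ.app X t) : φ = ψ :=
  Tambara.Hom.ext (funext fun X => funext (h X))

variable (T : Tambara.{u, v} G)

/-- The product of two elements of the ring `T(X)`. -/
noncomputable def prod {X : FinGSet.{u} G} (a b : T.obj X) : T.obj X := T.mult.mul a b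

variable {X Y : FinGSet.{u} G}

theorem res_unit (f : X ⟶ Y) : T.res f (T.unit Y) = T.unit X := T.mult.res_one f

theorem nm_unit (f : X ⟶ Y) : T.nm f (T.unit X) = T.unit Y := T.mult.tr_one f

theorem prod_comm (a b : T.obj X) : T.prod a b = T.prod b a := T.mult.mul_comm' a b

theorem unit_prod (a : T.obj X) : T.prod (T.unit X) a = a := T.mult.one_mul' a

theorem prod_unit (a : T.obj X) : T.prod a (T.unit X) = a := by rw [prod_comm, unit_prod]

theorem res_prod (f : X ⟶ Y) (a b : T.obj Y) :
    T.res f (T.prod a b) = T.prod (T.res f a) (T.res f b) := T.mult.res_mul f a b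

theorem nm_prod (f : X ⟶ Y) (a b : T.obj X) :
    T.nm f (T.prod a b) = T.prod (T.nm f a) (T.nm f b) := T.mult.tr_mul f a b

/-- Frobenius reciprocity, a consequence of the distributive law for the codiagonal. -/
theorem tr_prod (a : X ⟶ Y) (m : T.obj X) (n : T.obj Y) :
    T.prod (T.tr a m) n = T.tr a (T.prod m (T.res a n)) := by
  have h1 : T.pair (T.tr a m) n = T.tr (copair (a ≫ inl Y Y) (inr Y Y)) (T.pair m n) := by
    have := T.tr_sumMap a (𝟙 Y) m n
    rw [T.tr_id] at this
    exact this.symm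
  have h2 : T.res (copair (inl X Y) (a ≫ inr X Y)) (T.pair m n) = T.pair m (T.res a n) := by
    have := T.res_sumMap (𝟙 X) a m n
    rw [T.res_id] at this
    exact this
  have h3 := T.distrib _ _ _ _ _ (isExponential_fold a) (T.pair m n)
  rw [← h1, h2] at h3
  exact h3

variable {T}

theorem map_unit {S : Tambara.{u, v} G} (φ : T ⟶ S) (X : FinGSet.{u} G) :
    φ.app X (T.unit X) = S.unit X :=
  ((mu G).map φ).map_one X

theorem map_prod {S : Tambara.{u, v} G} (φ : T ⟶ S) (a b : T.obj X) :
    φ.app X (T.prod a b) = S.prod (φ.app X a) (φ.app X b) :=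
  ((mu G).map φ).map_mul a b

end Tambara

theorem symbol_congr {T S : Tambara.{u, v} G} {X A B : FinGSet.{u} G} {p : A ⟶ X} {q : B ⟶ X}
    {t : T.obj A} {s : S.obj A} {t' : T.obj B} {s' : S.obj B}
    (h : TensorSet.mk p t s = TensorSet.mk q t' s') : symbol T S p t s = symbol T S q t' s' :=
  congrArg (setToTensor T S X) h

namespace IsTensor

variable {T S P R : Tambara.{u, v} G} {θ : ∀ X, TensorObj T S X ≃+ P.obj X}

theorem exists_symbol {X : FinGSet.{u} G} (_ : IsTensor T S P θ) (z : P.obj X) :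
    ∃ (A : FinGSet.{u} G) (p : A ⟶ X) (t : T.obj A) (s : S.obj A),
      θ X (symbol T S p t s) = z := by
  obtain ⟨A, p, t, s, h⟩ := _root_.exists_symbol ((θ X).symm z)
  exact ⟨A, p, t, s, by rw [h, AddEquiv.apply_symm_apply]⟩

theorem res_of_isPullback (H : IsTensor T S P θ) {X Y B Q : FinGSet.{u} G} {f : X ⟶ Y} {q : B ⟶ Y}
    {a : Q ⟶ X} {b : Q ⟶ B} (h : IsPullback a b f q) (t : T.obj B) (s : S.obj B) :
    P.res f (θ Y (symbol T S q t s)) = θ X (symbol T S a (T.res b t) (S.res b s)) :=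
  (H.res_symbol f q t s).trans (congrArg (θ X) (symbol_congr (TensorSet.res_mk h t s)))

theorem nm_of_isExponential (H : IsTensor T S P θ) {X Y A Z B : FinGSet.{u} G} {f : X ⟶ Y}
    {p : A ⟶ X} {l : Z ⟶ A} {r : Z ⟶ B} {q : B ⟶ Y} (h : IsExponential f p l r q) (t : T.obj A)
    (s : S.obj A) :
    P.nm f (θ X (symbol T S p t s)) =
      θ Y (symbol T S q (T.nm r (T.res l t)) (S.nm r (S.res l s))) :=
  (H.nm_symbol f p t s).trans (congrArg (θ Y) (symbol_congr (TensorSet.nm_mk h t s)))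

/-- Products of symbols over the identity are formed in each factor. -/
theorem prod_symbol (H : IsTensor T S P θ) {X : FinGSet.{u} G} (t t' : T.obj X) (s s' : S.obj X) :
    P.prod (θ X (symbol T S (𝟙 X) t s)) (θ X (symbol T S (𝟙 X) t' s')) =
      θ X (symbol T S (𝟙 X) (T.prod t t') (S.prod s s')) := by
  have h : P.pair (θ X (symbol T S (𝟙 X) t s)) (θ X (symbol T S (𝟙 X) t' s')) =
      θ _ (symbol T S (𝟙 (sum X X)) (T.pair t t') (S.pair s s')) := by
    apply P.sum_ext
    · rw [H.res_of_isPullback (isPullback_id_id _)]; simp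
    · rw [H.res_of_isPullback (isPullback_id_id _)]; simp
  refine (congrArg (P.nm (fold X)) h).trans ?_
  rw [H.nm_of_isExponential (isExponential_of_id _), T.res_id, S.res_id]
  rfl

/-- The coprojection `t ↦ [t ⊗ 1]_{(X, 𝟙)}`. -/
noncomputable def inl (H : IsTensor T S P θ) : T ⟶ P where
  app X t := θ X (symbol T S (𝟙 X) t (S.unit X))
  app_res f t := by rw [H.res_of_isPullback (isPullback_id_id f), S.res_unit]
  app_tr f t := by
    rw [H.tr_symbol, ← symbol_res_right, S.res_unit, Category.comp_id, Category.id_comp]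
  app_nm f t := by
    rw [H.nm_of_isExponential (isExponential_of_id f), T.res_id, S.res_id, S.nm_unit]

/-- The coprojection `s ↦ [1 ⊗ s]_{(X, 𝟙)}`. -/
noncomputable def inr (H : IsTensor T S P θ) : S ⟶ P where
  app X s := θ X (symbol T S (𝟙 X) (T.unit X) s)
  app_res f s := by rw [H.res_of_isPullback (isPullback_id_id f), T.res_unit]
  app_tr f s := by
    rw [H.tr_symbol, ← symbol_res_left, T.res_unit, Category.comp_id, Category.id_comp]
  app_nm f s := by
    rw [H.nm_of_isExponential (isExponential_of_id f), T.res_id, S.res_id, T.nm_unit]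

theorem inl_app (H : IsTensor T S P θ) {X : FinGSet.{u} G} (t : T.obj X) :
    H.inl.app X t = θ X (symbol T S (𝟙 X) t (S.unit X)) := rfl

theorem inr_app (H : IsTensor T S P θ) {X : FinGSet.{u} G} (s : S.obj X) :
    H.inr.app X s = θ X (symbol T S (𝟙 X) (T.unit X) s) := rfl

/-- Every symbol is expressed through the two coprojections, the product and a transfer. -/
theorem symbol_eq (H : IsTensor T S P θ) {X A : FinGSet.{u} G} (p : A ⟶ X) (t : T.obj A)
    (s : S.obj A) :
    θ X (symbol T S p t s) = P.tr p (P.prod (H.inl.app A t) (H.inr.app A s)) := by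
  rw [inl_app, inr_app, H.prod_symbol, T.prod_unit, S.unit_prod, H.tr_symbol, Category.id_comp]

/-- Morphisms out of the tensor product are determined by their restrictions to the factors. -/
theorem hom_ext (H : IsTensor T S P θ) {g g' : P ⟶ R} (hl : H.inl ≫ g = H.inl ≫ g')
    (hr : H.inr ≫ g = H.inr ≫ g') : g = g' := by
  refine Tambara.hom_ext fun X z => ?_
  obtain ⟨A, p, t, s, rfl⟩ := H.exists_symbol z
  have hl' : g.app A (H.inl.app A t) = g'.app A (H.inl.app A t) :=
    congrArg (fun k : T ⟶ R => k.app A t) hl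
  have hr' : g.app A (H.inr.app A s) = g'.app A (H.inr.app A s) :=
    congrArg (fun k : S ⟶ R => k.app A s) hr
  rw [H.symbol_eq, g.app_tr, g'.app_tr, Tambara.map_prod, Tambara.map_prod, hl', hr']

/-- The map `[t ⊗ s]_{(A, p)} ↦ p_+(φ(t) · ψ(s))`; Frobenius reciprocity makes it well defined. -/
noncomputable def descSet (φ : T ⟶ R) (ψ : S ⟶ R) (X : FinGSet.{u} G) :
    TensorSet T S X → R.obj X :=
  Quot.lift (fun x => R.tr x.map (R.prod (φ.app _ x.fst) (ψ.app _ x.snd))) (by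
    rintro _ _ (⟨a, p, t, s⟩ | ⟨a, p, t, s⟩)
    · show R.tr (a ≫ p) (R.prod (φ.app _ (T.res a t)) (ψ.app _ s)) =
        R.tr p (R.prod (φ.app _ t) (ψ.app _ (S.tr a s)))
      rw [R.tr_comp, φ.app_res, ψ.app_tr, R.prod_comm (φ.app _ t), R.tr_prod, R.prod_comm]
    · show R.tr (a ≫ p) (R.prod (φ.app _ t) (ψ.app _ (S.res a s))) =
        R.tr p (R.prod (φ.app _ (T.tr a t)) (ψ.app _ s))
      rw [R.tr_comp, ψ.app_res, φ.app_tr, R.tr_prod])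

/-- The components of the morphism out of the tensor product given by `φ` and `ψ`. -/
noncomputable def descApp (_ : IsTensor T S P θ) (φ : T ⟶ R) (ψ : S ⟶ R) (X : FinGSet.{u} G)
    (z : P.obj X) : R.obj X :=
  descSet φ ψ X (tensorToSet T S X ((θ X).symm z))

theorem descApp_symbol (H : IsTensor T S P θ) (φ : T ⟶ R) (ψ : S ⟶ R) {X A : FinGSet.{u} G}
    (p : A ⟶ X) (t : T.obj A) (s : S.obj A) :
    H.descApp φ ψ X (θ X (symbol T S p t s)) = R.tr p (R.prod (φ.app A t) (ψ.app A s)) := by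
  rw [descApp, AddEquiv.symm_apply_apply, tensorToSet_symbol]
  rfl

/-- The morphism out of the tensor product given by morphisms out of the factors. -/
noncomputable def desc (H : IsTensor T S P θ) (φ : T ⟶ R) (ψ : S ⟶ R) : P ⟶ R where
  app := H.descApp φ ψ
  app_res f z := by
    obtain ⟨A, p, t, s, rfl⟩ := H.exists_symbol z
    rw [H.res_symbol, descApp_symbol, descApp_symbol, ← R.mackey _ _ _ _ (pb_isPullback f p),
      R.res_prod, φ.app_res, ψ.app_res]
  app_tr f z := by
    obtain ⟨A, p, t, s, rfl⟩ := H.exists_symbol z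
    rw [H.tr_symbol, descApp_symbol, descApp_symbol, R.tr_comp]
  app_nm f z := by
    obtain ⟨A, p, t, s, rfl⟩ := H.exists_symbol z
    rw [H.nm_symbol, descApp_symbol, descApp_symbol, R.distrib _ _ _ _ _ (isExponential_pi f p),
      R.res_prod, R.nm_prod, φ.app_nm, ψ.app_nm, φ.app_res, ψ.app_res]

theorem inl_desc (H : IsTensor T S P θ) (φ : T ⟶ R) (ψ : S ⟶ R) : H.inl ≫ H.desc φ ψ = φ :=
  Tambara.hom_ext fun X t => (H.descApp_symbol φ ψ _ _ _).trans (by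
    rw [R.tr_id, Tambara.map_unit, R.prod_unit])

theorem inr_desc (H : IsTensor T S P θ) (φ : T ⟶ R) (ψ : S ⟶ R) : H.inr ≫ H.desc φ ψ = ψ :=
  Tambara.hom_ext fun X s => (H.descApp_symbol φ ψ _ _ _).trans (by
    rw [R.tr_id, Tambara.map_unit, R.unit_prod])

/-- The coproduct property, relative to the first factor: morphisms `T ⊗ S ⟶ R` under `T` are
morphisms `S ⟶ R`. -/
noncomputable def underEquiv (H : IsTensor T S P θ) {ι : T ⟶ P} (hι : ι = H.inl) (R : Under T) :
    (Under.mk ι ⟶ R) ≃ (S ⟶ R.right) where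
  toFun φ := H.inr ≫ φ.right
  invFun ψ := Under.homMk (H.desc R.hom ψ) ((congrArg (· ≫ _) hι).trans (H.inl_desc _ _))
  left_inv φ := by
    refine Under.UnderMorphism.ext (H.hom_ext ?_ ?_)
    · exact (H.inl_desc _ _).trans (((congrArg (· ≫ _) hι).symm.trans (Under.w φ)).symm)
    · exact H.inr_desc _ _
  right_inv ψ := H.inr_desc _ _

end IsTensor

end

/-! ### Existence of the tensor product functor -/

section

variable {G : Type u} [Group G]

theorem tensorTambara_isTensor (T S : Tambara.{u, max (u + 1) w} G) :
    IsTensor T S (tensorTambara T S) (tensorEquiv T S) where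
  res_symbol f q t s := by
    rw [tensorEquiv_symbol, tensorEquiv_symbol]
    rfl
  tr_symbol f q t s := by
    rw [tensorEquiv_symbol, tensorEquiv_symbol]
    rfl
  nm_symbol f q t s := by
    rw [tensorEquiv_symbol, tensorEquiv_symbol]
    rfl

/-- The tensor product as a functor in both variables. -/
noncomputable def tensorFunctor (G : Type u) [Group G] : TensorFunctor.{u, max (u + 1) w} G where
  functor :=
    { obj := fun x => tensorTambara x.1 x.2
      map := fun f => tensorMap f.1 f.2
      map_id := fun x => Tambara.hom_ext fun X z => by
        obtain ⟨A, p, t, s, rfl⟩ := TensorSet.exists_mk z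
        rfl
      map_comp := fun f g => Tambara.hom_ext fun X z => by
        obtain ⟨A, p, t, s, rfl⟩ := TensorSet.exists_mk z
        rfl }
  iso T S := tensorEquiv T S
  isTensor T S := tensorTambara_isTensor T S
  map_symbol τ σ _ _ p t s := by
    rw [tensorEquiv_symbol, tensorEquiv_symbol]
    rfl
  ι T S := (tensorTambara_isTensor T S).inl
  ι_apply T S X t := rfl

end

/-! ### Free semi-Mackey and Tambara functors -/

/-- A functor `F` has a left adjoint if every object `d` has a universal arrow `η : d ⟶ F c`. -/
theorem isRightAdjoint_of_universal {C D : Type*} [Category* C] [Category* D] (F : C ⥤ D)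
    (h : ∀ d : D, ∃ (c : C) (η : d ⟶ F.obj c),
      ∀ (c' : C) (g : d ⟶ F.obj c'), ∃! φ : c ⟶ c', η ≫ F.map φ = g) :
    F.IsRightAdjoint := by
  choose c η hη using h
  let e : ∀ d c', (c d ⟶ c') ≃ (d ⟶ F.obj c') := fun d c' =>
    Equiv.ofBijective (fun φ => η d ≫ F.map φ)
      ⟨fun φ ψ hφ => (hη d c' _).unique hφ rfl, fun g => (hη d c' g).exists⟩
  have he : ∀ d c' c'' g φ, e d c'' (φ ≫ g) = e d c' φ ≫ F.map g := fun d c' c'' g φ => by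
    show η d ≫ F.map (φ ≫ g) = (η d ≫ F.map φ) ≫ F.map g
    rw [F.map_comp, Category.assoc]
  exact ⟨_, ⟨Adjunction.adjunctionOfEquivLeft e he⟩⟩

section

variable {G : Type u} [Group G] {I : Type (max (u + 1) w)} (s : I → FinGSet.{u} G)

/-- Formal expressions in the operations of a semi-Mackey functor, in generators indexed by `I`,
the generator with index `i` living over the `G`-set `s i`. -/
inductive MackeyTerm : FinGSet.{u} G → Type (max (u + 1) w)
  | gen (i : I) : MackeyTerm (s i)
  | res {X Y : FinGSet.{u} G} (f : X ⟶ Y) (t : MackeyTerm Y) : MackeyTerm X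
  | tr {X Y : FinGSet.{u} G} (f : X ⟶ Y) (t : MackeyTerm X) : MackeyTerm Y
  | pair {X Y : FinGSet.{u} G} (t : MackeyTerm X) (t' : MackeyTerm Y) : MackeyTerm (sum X Y)
  | nil : MackeyTerm (empty G)

/-- Formal expressions in the operations of a Tambara functor, see `MackeyTerm`. -/
inductive TambaraTerm : FinGSet.{u} G → Type (max (u + 1) w)
  | gen (i : I) : TambaraTerm (s i)
  | res {X Y : FinGSet.{u} G} (f : X ⟶ Y) (t : TambaraTerm Y) : TambaraTerm X
  | tr {X Y : FinGSet.{u} G} (f : X ⟶ Y) (t : TambaraTerm X) : TambaraTerm Y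
  | nm {X Y : FinGSet.{u} G} (f : X ⟶ Y) (t : TambaraTerm X) : TambaraTerm Y
  | pair {X Y : FinGSet.{u} G} (t : TambaraTerm X) (t' : TambaraTerm Y) : TambaraTerm (sum X Y)
  | nil : TambaraTerm (empty G)
  | neg {X : FinGSet.{u} G} (t : TambaraTerm X) : TambaraTerm X

variable {s}

/-- The value of an expression in `N` when the generators are interpreted by `γ`. -/
noncomputable def MackeyTerm.eval (N : SemiMackey.{u, v} G) (γ : ∀ i, N.obj (s i)) :
    ∀ {X : FinGSet.{u} G}, MackeyTerm.{u, w} s X → N.obj X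
  | _, .gen i => γ i
  | _, .res f t => N.res f (t.eval N γ)
  | _, .tr f t => N.tr f (t.eval N γ)
  | _, .pair t t' => N.pair (t.eval N γ) (t'.eval N γ)
  | _, .nil => N.additive_empty.choose

/-- The value of an expression in `N` when the generators are interpreted by `γ`. -/
noncomputable def TambaraTerm.eval (N : Tambara.{u, v} G) (γ : ∀ i, N.obj (s i)) :
    ∀ {X : FinGSet.{u} G}, TambaraTerm.{u, w} s X → N.obj X
  | _, .gen i => γ i
  | _, .res f t => N.res f (t.eval N γ)
  | _, .tr f t => N.tr f (t.eval N γ)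
  | _, .nm f t => N.nm f (t.eval N γ)
  | _, .pair t t' => N.pair (t.eval N γ) (t'.eval N γ)
  | _, .nil => N.additive_empty.choose
  | _, .neg t => -(t.eval N γ)

section Mackey

variable {Γ : SemiMackey.{u, max (u + 1) w} G → Type v} (γ : ∀ N, Γ N → ∀ i, N.obj (s i))

/-- Two expressions are identified if they have the same value in all semi-Mackey functors `N`,
for all admissible interpretations of the generators; these are parametrized by `Γ N`. -/
def mackeySetoid (X : FinGSet.{u} G) : Setoid (MackeyTerm.{u, w} s X) where
  r t t' := ∀ N (c : Γ N), t.eval N (γ N c) = t'.eval N (γ N c)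
  iseqv := ⟨fun _ _ _ => rfl, fun h N c => (h N c).symm, fun h h' N c => (h N c).trans (h' N c)⟩

/-- The semi-Mackey functor of expressions. Since the identification is semantic, every law that
holds in all semi-Mackey functors holds here. -/
noncomputable def freeMackey : SemiMackey.{u, max (u + 1) w} G where
  obj X := Quotient (mackeySetoid γ X)
  res f := Quotient.map (.res f) fun _ _ h N c => congrArg (N.res f) (h N c)
  tr f := Quotient.map (.tr f) fun _ _ h N c => congrArg (N.tr f) (h N c)
  res_id := by
    rintro X ⟨t⟩
    exact Quotient.sound fun N c => N.res_id _
  res_comp := by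
    rintro X Y Z f g ⟨t⟩
    exact Quotient.sound fun N c => N.res_comp f g _
  tr_id := by
    rintro X ⟨t⟩
    exact Quotient.sound fun N c => N.tr_id _
  tr_comp := by
    rintro X Y Z f g ⟨t⟩
    exact Quotient.sound fun N c => N.tr_comp f g _
  additive X Y := by
    constructor
    · rintro ⟨t⟩ ⟨t'⟩ h
      obtain ⟨h1, h2⟩ := Prod.mk.inj h
      exact Quotient.sound fun N c =>
        N.sum_ext (Quotient.exact h1 N c) (Quotient.exact h2 N c)
    · rintro ⟨⟨t⟩, ⟨t'⟩⟩
      exact ⟨Quotient.mk _ (.pair t t'), Prod.ext (Quotient.sound fun N c => N.res_inl_pair _ _)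
        (Quotient.sound fun N c => N.res_inr_pair _ _)⟩
  additive_empty := by
    refine ⟨Quotient.mk _ .nil, ?_⟩
    rintro ⟨t⟩
    exact Quotient.sound fun N c => N.empty_ext _ _
  mackey := by
    rintro X' Y' X Y x f' f y h ⟨t⟩
    exact Quotient.sound fun N c => N.mackey _ _ _ _ h _

/-- The class of an expression. -/
def freeMackeyMk {X : FinGSet.{u} G} (t : MackeyTerm.{u, w} s X) : (freeMackey γ).obj X :=
  Quotient.mk (mackeySetoid γ X) t

theorem freeMackey_pair {X Y : FinGSet.{u} G} (t : MackeyTerm.{u, w} s X)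
    (t' : MackeyTerm.{u, w} s Y) :
    (freeMackey γ).pair (freeMackeyMk γ t) (freeMackeyMk γ t') = freeMackeyMk γ (.pair t t') := by
  apply (freeMackey γ).sum_ext
  · rw [SemiMackey.res_inl_pair]
    exact (Quotient.sound fun N c => N.res_inl_pair _ _).symm
  · rw [SemiMackey.res_inr_pair]
    exact (Quotient.sound fun N c => N.res_inr_pair _ _).symm

/-- An admissible interpretation of the generators extends to a morphism. -/
noncomputable def freeMackeyLift {N : SemiMackey.{u, max (u + 1) w} G} (c : Γ N) :
    freeMackey γ ⟶ N where
  app X := Quotient.lift (MackeyTerm.eval N (γ N c)) fun _ _ h => h N c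
  app_res := by
    rintro X Y f ⟨t⟩
    rfl
  app_tr := by
    rintro X Y f ⟨t⟩
    rfl

/-- A morphism is determined by its values on the generators: it is compatible with pairing, and the
value over the empty `G`-set is forced. -/
theorem freeMackey_hom_ext {N : SemiMackey.{u, max (u + 1) w} G} {φ ψ : freeMackey γ ⟶ N}
    (h : ∀ i, φ.app _ (freeMackeyMk γ (.gen i)) = ψ.app _ (freeMackeyMk γ (.gen i))) : φ = ψ := by
  have key : ∀ {X} (t : MackeyTerm.{u, w} s X),
      φ.app X (freeMackeyMk γ t) = ψ.app X (freeMackeyMk γ t) := by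
    intro X t
    induction t with
    | gen i => exact h i
    | res f t ih => exact (φ.app_res f _).trans ((congrArg _ ih).trans (ψ.app_res f _).symm)
    | tr f t ih => exact (φ.app_tr f _).trans ((congrArg _ ih).trans (ψ.app_tr f _).symm)
    | pair t t' ih ih' => rw [← freeMackey_pair, φ.map_pair, ψ.map_pair, ih, ih']
    | nil => exact N.empty_ext _ _
  refine SemiMackey.hom_ext ?_
  rintro X ⟨t⟩
  exact key t

end Mackey

section Tambara

variable {Γ : Tambara.{u, max (u + 1) w} G → Type v} (γ : ∀ N, Γ N → ∀ i, N.obj (s i))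

/-- Two expressions are identified if they have the same value in all Tambara functors `N`, for all
admissible interpretations of the generators; these are parametrized by `Γ N`. -/
def tambaraSetoid (X : FinGSet.{u} G) : Setoid (TambaraTerm.{u, w} s X) where
  r t t' := ∀ N (c : Γ N), t.eval N (γ N c) = t'.eval N (γ N c)
  iseqv := ⟨fun _ _ _ => rfl, fun h N c => (h N c).symm, fun h h' N c => (h N c).trans (h' N c)⟩

/-- The semi-Tambara functor of expressions, see `freeMackey`. -/
noncomputable def freeSemiTambara : SemiTambara.{u, max (u + 1) w} G where
  obj X := Quotient (tambaraSetoid γ X)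
  res f := Quotient.map (.res f) fun _ _ h N c => congrArg (N.res f) (h N c)
  tr f := Quotient.map (.tr f) fun _ _ h N c => congrArg (N.tr f) (h N c)
  nm f := Quotient.map (.nm f) fun _ _ h N c => congrArg (N.nm f) (h N c)
  res_id := by
    rintro X ⟨t⟩
    exact Quotient.sound fun N c => N.res_id _
  res_comp := by
    rintro X Y Z f g ⟨t⟩
    exact Quotient.sound fun N c => N.res_comp f g _
  tr_id := by
    rintro X ⟨t⟩
    exact Quotient.sound fun N c => N.tr_id _
  tr_comp := by
    rintro X Y Z f g ⟨t⟩
    exact Quotient.sound fun N c => N.tr_comp f g _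
  nm_id := by
    rintro X ⟨t⟩
    exact Quotient.sound fun N c => N.nm_id _
  nm_comp := by
    rintro X Y Z f g ⟨t⟩
    exact Quotient.sound fun N c => N.nm_comp f g _
  additive X Y := by
    constructor
    · rintro ⟨t⟩ ⟨t'⟩ h
      obtain ⟨h1, h2⟩ := Prod.mk.inj h
      exact Quotient.sound fun N c =>
        N.sum_ext (Quotient.exact h1 N c) (Quotient.exact h2 N c)
    · rintro ⟨⟨t⟩, ⟨t'⟩⟩
      exact ⟨Quotient.mk _ (.pair t t'), Prod.ext (Quotient.sound fun N c => N.res_inl_pair _ _)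
        (Quotient.sound fun N c => N.res_inr_pair _ _)⟩
  additive_empty := by
    refine ⟨Quotient.mk _ .nil, ?_⟩
    rintro ⟨t⟩
    exact Quotient.sound fun N c => N.empty_ext _ _
  mackey := by
    rintro X' Y' X Y x f' f y h ⟨t⟩
    exact Quotient.sound fun N c => N.mackey _ _ _ _ h _
  nm_mackey := by
    rintro X' Y' X Y x f' f y h ⟨t⟩
    exact Quotient.sound fun N c => N.nm_mackey _ _ _ _ h _
  distrib := by
    rintro X Y A Z B f p l r q h ⟨t⟩
    exact Quotient.sound fun N c => N.distrib _ _ _ _ _ h _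

/-- The class of an expression. -/
def freeTambaraMk {X : FinGSet.{u} G} (t : TambaraTerm.{u, w} s X) : (freeSemiTambara γ).obj X :=
  Quotient.mk (tambaraSetoid γ X) t

theorem freeSemiTambara_pair {X Y : FinGSet.{u} G} (t : TambaraTerm.{u, w} s X)
    (t' : TambaraTerm.{u, w} s Y) :
    (freeSemiTambara γ).pair (freeTambaraMk γ t) (freeTambaraMk γ t') =
      freeTambaraMk γ (.pair t t') := by
  apply (freeSemiTambara γ).sum_ext
  · rw [SemiMackey.res_inl_pair]
    exact (Quotient.sound fun N c => N.res_inl_pair _ _).symm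
  · rw [SemiMackey.res_inr_pair]
    exact (Quotient.sound fun N c => N.res_inr_pair _ _).symm

theorem freeSemiTambara_neg_mul {X : FinGSet.{u} G} (t : TambaraTerm.{u, w} s X) :
    (freeSemiTambara γ).mul (freeTambaraMk γ (.neg t)) (freeTambaraMk γ t) =
      (freeSemiTambara γ).one X := by
  rw [SemiMackey.mul, freeSemiTambara_pair,
    ← (freeSemiTambara γ).tr_fromEmpty (freeTambaraMk γ .nil)]
  exact Quotient.sound fun N c => neg_add_cancel (t.eval N (γ N c))

/-- The Tambara functor of expressions. -/
noncomputable def freeTambara : Tambara.{u, max (u + 1) w} G where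
  toSemiTambara := freeSemiTambara γ
  exists_neg := by
    rintro X ⟨t⟩
    exact ⟨_, freeSemiTambara_neg_mul γ t⟩

/-- An admissible interpretation of the generators extends to a morphism. -/
noncomputable def freeTambaraLift {N : Tambara.{u, max (u + 1) w} G} (c : Γ N) :
    freeTambara γ ⟶ N where
  app X := Quotient.lift (TambaraTerm.eval N (γ N c)) fun _ _ h => h N c
  app_res := by
    rintro X Y f ⟨t⟩
    rfl
  app_tr := by
    rintro X Y f ⟨t⟩
    rfl
  app_nm := by
    rintro X Y f ⟨t⟩
    rfl

/-- The underlying morphism of additive parts. -/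
def Tambara.Hom.add {T S : Tambara.{u, v} G} (φ : T ⟶ S) : T.toSemiMackey ⟶ S.toSemiMackey :=
  ⟨φ.app, φ.app_res, φ.app_tr⟩

/-- A morphism is determined by its values on the generators; negation is preserved since additive
inverses are unique. -/
theorem freeTambara_hom_ext {N : Tambara.{u, max (u + 1) w} G} {φ ψ : freeTambara γ ⟶ N}
    (h : ∀ i, φ.app _ (freeTambaraMk γ (.gen i)) = ψ.app _ (freeTambaraMk γ (.gen i))) :
    φ = ψ := by
  have key : ∀ {X} (t : TambaraTerm.{u, w} s X),
      φ.app X (freeTambaraMk γ t) = ψ.app X (freeTambaraMk γ t) := by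
    intro X t
    induction t with
    | gen i => exact h i
    | res f t ih => exact (φ.app_res f _).trans ((congrArg _ ih).trans (ψ.app_res f _).symm)
    | tr f t ih => exact (φ.app_tr f _).trans ((congrArg _ ih).trans (ψ.app_tr f _).symm)
    | nm f t ih => exact (φ.app_nm f _).trans ((congrArg _ ih).trans (ψ.app_nm f _).symm)
    | pair t t' ih ih' =>
      rw [← freeSemiTambara_pair]
      exact (φ.add.map_pair _ _).trans ((congrArg₂ N.pair ih ih').trans (ψ.add.map_pair _ _).symm)
    | nil => exact N.empty_ext _ _
    | neg t ih =>
      have hneg : ∀ χ : freeTambara γ ⟶ N, χ.app _ (freeTambaraMk γ (.neg t)) =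
          -χ.app _ (freeTambaraMk γ t) := fun χ => eq_neg_of_add_eq_zero_left <|
        (χ.add.map_mul _ _).symm.trans
          ((congrArg _ (freeSemiTambara_neg_mul γ t)).trans (χ.add.map_one _))
      rw [hneg, hneg, ih]
  refine Tambara.hom_ext ?_
  rintro X ⟨t⟩
  exact key t

end Tambara

end

/-! ### Existence of the adjoints -/

section

variable (G : Type u) [Group G]

/-- The left adjoint is presented by a generator for each `m ∈ M(X)`; admissible interpretations in
`N` are the morphisms `M ⟶ N^μ`. -/
theorem mu_isRightAdjoint : (Tambara.mu.{u, max (u + 1) w} G).IsRightAdjoint := by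
  refine isRightAdjoint_of_universal _ fun M => ?_
  let s : (Σ X, M.obj X) → FinGSet.{u} G := Sigma.fst
  let γ : ∀ N, (M ⟶ (Tambara.mu.{u, max (u + 1) w} G).obj N) → ∀ i, N.obj (s i) :=
    fun N c i => c.app i.1 i.2
  let η : M ⟶ (freeTambara γ).mult :=
    ⟨fun X m => freeTambaraMk γ (.gen (⟨X, m⟩ : Σ X, M.obj X)),
      fun f m => Quotient.sound fun N c => c.app_res f m,
      fun f m => Quotient.sound fun N c => c.app_tr f m⟩
  refine ⟨freeTambara γ, η, fun N c =>
    ⟨freeTambaraLift γ c, rfl, fun φ hφ => freeTambara_hom_ext γ ?_⟩⟩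
  rintro ⟨X, m⟩
  exact congrArg (fun k : M ⟶ N.mult => k.app X m) hφ

variable [Finite G]

/-- The left adjoint is presented by a generator over `U ∘_K Y` for each `m ∈ M(Y)`; admissible
interpretations in `N` are the morphisms `M ⟶ N(U ∘_K -)`. -/
theorem compBiset_isRightAdjoint (H : Subgroup G) :
    (compBiset.{u, max (u + 1) w} H).IsRightAdjoint := by
  refine isRightAdjoint_of_universal _ fun M => ?_
  let s : (Σ Y, M.obj Y) → FinGSet.{u} G := fun i => bisetObj H i.1
  let γ : ∀ N, (M ⟶ (compBiset.{u, max (u + 1) w} H).obj N) → ∀ i, N.obj (s i) :=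
    fun N c i => c.app i.1 i.2
  let η : M ⟶ (compBiset H).obj (freeMackey γ) :=
    ⟨fun Y m => freeMackeyMk γ (.gen (⟨Y, m⟩ : Σ Y, M.obj Y)),
      fun f m => Quotient.sound fun N c => c.app_res f m,
      fun f m => Quotient.sound fun N c => c.app_tr f m⟩
  refine ⟨freeMackey γ, η, fun N c =>
    ⟨freeMackeyLift γ c, rfl, fun φ hφ => freeMackey_hom_ext γ ?_⟩⟩
  rintro ⟨Y, m⟩
  exact congrArg (fun k : M ⟶ (compBiset H).obj N => k.app Y m) hφ

/-- A morphism of monoids into `M(G/e)^G`, given by its values in `M(G/e)`. -/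
noncomputable def homEvMk {G : Type u} [Group G] [Finite G] {Q : CommMonCat.{v}}
    {N : SemiMackey.{u, v} G} (f : Q → N.obj (regular G))
    (hf : ∀ g q, N.res (rightMul g) (f q) = f q)
    (h1 : f 1 = N.one _) (h2 : ∀ a b, f (a * b) = N.mul (f a) (f b)) : Q ⟶ (ev G).obj N :=
  letI := N.commMonoid (regular G)
  CommMonCat.ofHom
    { toFun := fun q => (⟨f q, fun g => hf g q⟩ : regularFixed N)
      map_one' := Subtype.ext h1
      map_mul' := fun a b => Subtype.ext (h2 a b) }

/-- The value of a morphism of monoids into `M(G/e)^G`, as an element of `M(G/e)`. -/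
noncomputable def homEvApp {G : Type u} [Group G] [Finite G] {Q : CommMonCat.{v}}
    {N : SemiMackey.{u, v} G} (c : Q ⟶ (ev G).obj N) (q : Q) : N.obj (regular G) :=
  letI := N.commMonoid (regular G)
  (show regularFixed N from c.hom q).1

section HomEv

variable {G} {Q : CommMonCat.{v}} {N : SemiMackey.{u, v} G}

theorem homEv_ext {c c' : Q ⟶ (ev G).obj N} (h : ∀ q, homEvApp c q = homEvApp c' q) : c = c' := by
  let _ := N.commMonoid (regular G)
  exact CommMonCat.hom_ext (MonoidHom.ext fun q => Subtype.ext (h q))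

theorem homEvApp_res (c : Q ⟶ (ev G).obj N) (g : G) (q : Q) :
    N.res (rightMul g) (homEvApp c q) = homEvApp c q := by
  let _ := N.commMonoid (regular G)
  exact (show regularFixed N from c.hom q).2 g

theorem homEvApp_one (c : Q ⟶ (ev G).obj N) : homEvApp c 1 = N.one _ := by
  let _ := N.commMonoid (regular G)
  exact congrArg Subtype.val (c.hom.map_one)

theorem homEvApp_mul (c : Q ⟶ (ev G).obj N) (a b : Q) :
    homEvApp c (a * b) = N.mul (homEvApp c a) (homEvApp c b) := by
  let _ := N.commMonoid (regular G)
  exact congrArg Subtype.val (c.hom.map_mul a b)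

end HomEv

/-- The left adjoint is presented by a generator over `G/e` for each `q ∈ Q`; admissible
interpretations in `N` are the monoid morphisms `Q ⟶ N(G/e)^G`. -/
theorem ev_isRightAdjoint : (ev.{u, max (u + 1) w} G).IsRightAdjoint := by
  refine isRightAdjoint_of_universal _ fun Q => ?_
  let s : Q → FinGSet.{u} G := fun _ => regular G
  let γ : ∀ N, (Q ⟶ (ev.{u, max (u + 1) w} G).obj N) → ∀ i, N.obj (s i) :=
    fun N c i => homEvApp c i
  refine ⟨freeMackey γ, homEvMk (fun q => freeMackeyMk γ (.gen q)) ?_ ?_ ?_, fun N c =>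
    ⟨freeMackeyLift γ c, homEv_ext fun q => rfl, fun φ hφ => freeMackey_hom_ext γ ?_⟩⟩
  · exact fun g q => Quotient.sound fun N c => homEvApp_res c g q
  · rw [← (freeMackey γ).tr_fromEmpty (freeMackeyMk γ .nil)]
    exact Quotient.sound fun N c => homEvApp_one c
  · intro a b
    rw [SemiMackey.mul, freeMackey_pair γ (.gen a) (.gen b)]
    exact Quotient.sound fun N c => homEvApp_mul c a b
  · exact fun q => congrArg (fun k => homEvApp k q) hφ

end

/-! ### Morphisms out of `𝔛_H` -/

/-- Morphisms from the additive monoid `ℕ` are elements. -/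
def natMonEquiv (Q : CommMonCat.{v}) : (natMon.{v} ⟶ Q) ≃ Q where
  toFun c := c.hom (ULift.up (Multiplicative.ofAdd 1) : ULift.{v} (Multiplicative ℕ))
  invFun q := CommMonCat.ofHom ((powersHom Q q).comp
    (MulEquiv.ulift : ULift.{v} (Multiplicative ℕ) ≃* _).toMonoidHom)
  left_inv c := by
    refine CommMonCat.hom_ext (MonoidHom.ext ?_)
    rintro ⟨n⟩
    exact DFunLike.congr_fun ((powersHom Q).apply_symm_apply (c.hom.comp
      (MulEquiv.ulift : ULift.{v} (Multiplicative ℕ) ≃* _).symm.toMonoidHom)) n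
  right_inv q := (powersHom Q).symm_apply_apply q

theorem natMonEquiv_comp {Q Q' : CommMonCat.{v}} (c : natMon ⟶ Q) (f : Q ⟶ Q') :
    natMonEquiv Q' (c ≫ f) = f.hom (natMonEquiv Q c) := rfl

section

variable {G : Type u} [Group G]

/-- Restriction along an isomorphism `j` identifies the fixed points of two families of
endomorphisms that correspond to each other under `j`. -/
noncomputable def fixedEquiv (N : SemiMackey.{u, v} G) {X Y : FinGSet.{u} G} (j : X ⟶ Y)
    (hj : Function.Bijective j) {K K' : Type*} (α : K → (X ⟶ X)) (β : K' → (Y ⟶ Y))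
    (hα : ∀ k, ∃ l, α k ≫ j = j ≫ β l) (hβ : ∀ l, ∃ k, α k ≫ j = j ≫ β l) :
    {y : N.obj Y // ∀ l, N.res (β l) y = y} ≃ {x : N.obj X // ∀ k, N.res (α k) x = x} :=
  (Equiv.ofBijective _ (N.res_bijective_of_iso j hj)).subtypeEquiv fun y => by
    constructor
    · intro h k
      obtain ⟨l, hl⟩ := hα k
      show N.res _ (N.res j y) = N.res j y
      rw [← N.res_comp, hl, N.res_comp, h]
    · intro h l
      obtain ⟨k, hk⟩ := hβ l
      refine (N.res_bijective_of_iso j hj).1 ?_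
      rw [← N.res_comp, ← hk, N.res_comp]
      exact h k

/-- Two semi-Mackey functors that corepresent the same elements are isomorphic. -/
theorem nonempty_iso_of_equiv {A B : SemiMackey.{u, v} G} {X : FinGSet.{u} G}
    (P : ∀ N : SemiMackey.{u, v} G, Set (N.obj X)) (a : ∀ N, (A ⟶ N) ≃ P N)
    (b : ∀ N, (B ⟶ N) ≃ P N)
    (ha : ∀ {N N'} (φ : A ⟶ N) (g : N ⟶ N'), (a N' (φ ≫ g)).1 = g.app X (a N φ).1)
    (hb : ∀ {N N'} (φ : B ⟶ N) (g : N ⟶ N'), (b N' (φ ≫ g)).1 = g.app X (b N φ).1) :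
    Nonempty (A ≅ B) := by
  have h1 : ∀ {N} (x : P N), ((a B).symm (b B (𝟙 B)) ≫ (b N).symm x) = (a N).symm x := fun x => by
    rw [Equiv.eq_symm_apply]
    refine Subtype.ext ?_
    rw [ha, Equiv.apply_symm_apply, ← hb, Category.id_comp, Equiv.apply_symm_apply]
  have h2 : ∀ {N} (x : P N), ((b A).symm (a A (𝟙 A)) ≫ (a N).symm x) = (b N).symm x := fun x => by
    rw [Equiv.eq_symm_apply]
    refine Subtype.ext ?_
    rw [hb, Equiv.apply_symm_apply, ← ha, Category.id_comp, Equiv.apply_symm_apply]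
  refine ⟨⟨(a B).symm (b B (𝟙 B)), (b A).symm (a A (𝟙 A)), ?_, ?_⟩⟩
  · rw [h1, Equiv.symm_apply_apply]
  · rw [h2, Equiv.symm_apply_apply]

variable [Finite G]

/-- The map `G/H ⟶ U ∘_K (K/e)`, `u ↦ [u, 1]`. -/
def toBisetRegular (H : Subgroup G) : orbit H ⟶ bisetObj H (regular (Weyl H)) :=
  homMk (fun a => bisetMk H a (1 : Weyl H)) fun _ _ => rfl

/-- Right translation of `K/e` corresponds to the right action of `K` on `U = G/H`. -/
theorem toBisetRegular_rightMul (H : Subgroup G) (k : Weyl H) :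
    weylMap H k ≫ toBisetRegular H = toBisetRegular H ≫ bisetMap H (rightMul k) := by
  refine hom_ext fun a => (bisetMk_eq H).2 ⟨k, rfl, ?_⟩
  exact (mul_one (M := Weyl H) k).trans (one_mul (M := Weyl H) k).symm

theorem toBisetRegular_bijective (H : Subgroup G) : Function.Bijective (toBisetRegular H) := by
  constructor
  · intro a b h
    obtain ⟨k, rfl, hk⟩ := (bisetMk_eq H).1 h
    obtain rfl : k = 1 := (mul_one (M := Weyl H) k).symm.trans hk
    rw [weylMap_one]
    rfl
  · intro z
    obtain ⟨a, y, rfl⟩ := bisetMk_surj H z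
    exact ⟨weylMap H y a, (bisetMk_eq H).2 ⟨y, rfl, mul_one (M := Weyl H) y⟩⟩

/-- `M(U ∘_K (K/e))^K` is the fixed part of `M(G/H)`. -/
noncomputable def evCompBisetEquiv (H : Subgroup G) (N : SemiMackey.{u, v} G) :
    (ev (Weyl H)).obj ((compBiset H).obj N) ≃ weylFixed N H :=
  fixedEquiv N (toBisetRegular H) (toBisetRegular_bijective H) (weylMap H)
    (fun k => bisetMap H (rightMul k)) (fun k => ⟨k, toBisetRegular_rightMul H k⟩)
    (fun k => ⟨k, toBisetRegular_rightMul H k⟩)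

section FrakX

variable {H : Subgroup G} {ℒ : CommMonCat.{v} ⥤ SemiMackey.{u, v} (Weyl H)}
  {L : SemiMackey.{u, v} (Weyl H) ⥤ SemiMackey.{u, v} G}

/-- `𝔛_H` corepresents `N ↦ N(G/H)^{N_G(H)/H}`. -/
noncomputable def frakXEquiv (adj : ℒ ⊣ ev (Weyl H)) (adj' : L ⊣ compBiset H)
    (N : SemiMackey.{u, v} G) : (frakX ℒ L ⟶ N) ≃ weylFixed N H :=
  (adj'.homEquiv _ _).trans <| (adj.homEquiv _ _).trans <|
    (natMonEquiv _).trans (evCompBisetEquiv H N)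

/-- Naturality of `frakXEquiv`. -/
theorem frakXEquiv_comp (adj : ℒ ⊣ ev (Weyl H)) (adj' : L ⊣ compBiset H)
    {N N' : SemiMackey.{u, v} G} (φ : frakX ℒ L ⟶ N) (g : N ⟶ N') :
    (frakXEquiv adj adj' N' (φ ≫ g)).1 = g.app (orbit H) (frakXEquiv adj adj' N φ).1 := by
  have h1 : frakXEquiv adj adj' N' (φ ≫ g) = evCompBisetEquiv H N' (natMonEquiv _
      (adj.homEquiv _ _ (adj'.homEquiv _ _ φ) ≫ (ev (Weyl H)).map ((compBiset H).map g))) :=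
    congrArg (fun k => evCompBisetEquiv H N' (natMonEquiv _ k))
      ((congrArg (adj.homEquiv _ _) (adj'.homEquiv_naturality_right φ g)).trans
        (adj.homEquiv_naturality_right _ _))
  rw [h1]
  exact (g.app_res (toBisetRegular H) _).symm

end FrakX

/-! ### The case `H = G` -/

instance : Subsingleton (orbit (⊤ : Subgroup G)) :=
  QuotientGroup.subsingleton_quotient_top

theorem mem_weylFixed_top (N : SemiMackey.{u, v} G) (n : N.obj (orbit (⊤ : Subgroup G))) :
    n ∈ weylFixed N ⊤ := fun k => by
  show N.res (weylMap ⊤ k) n = n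
  rw [show weylMap ⊤ k = 𝟙 (orbit (⊤ : Subgroup G)) from hom_ext fun _ => Subsingleton.elim _ _,
    N.res_id]

/-- The map to the one-point `G`-set `G/G`. -/
def toPoint (X : FinGSet.{u} G) : X ⟶ orbit (⊤ : Subgroup G) :=
  homMk (fun _ => ((1 : G) : G ⧸ (⊤ : Subgroup G))) fun _ _ =>
    Subsingleton.elim (α := orbit (⊤ : Subgroup G)) _ _

theorem toPoint_uniq {X : FinGSet.{u} G} (f g : X ⟶ orbit (⊤ : Subgroup G)) : f = g :=
  hom_ext fun _ => Subsingleton.elim _ _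

/-- The morphism `𝔄^α ⟶ N` determined by `n ∈ N(G/G)`: the class of `p : A ⟶ X` is sent to the
transfer along `p` of the restriction of `n` to `A`. -/
def burnsideLift (N : SemiMackey.{u, max (u + 1) w} G) (n : N.obj (orbit (⊤ : Subgroup G))) :
    burnside.{u, w} G ⟶ N where
  app X z := Quotient.lift (fun A : Over X => N.tr A.hom (N.res (toPoint A.left) n)) (by
    rintro A B ⟨e⟩
    have h : N.tr e.hom.left (N.res (toPoint A.left) n) = N.res (toPoint B.left) n :=
      (N.tr_iso ((Over.forget X).mapIso e) _).trans
        ((N.res_comp _ _ _).symm.trans (congrArg (fun f => N.res f n) (toPoint_uniq _ _)))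
    show N.tr A.hom _ = N.tr B.hom _
    rw [← Over.w e.hom, N.tr_comp, h]) z.down
  app_res := by
    rintro X Y f ⟨z⟩
    obtain ⟨A, p, rfl⟩ := overClass_surj z
    show N.tr (pbFst f p) (N.res (toPoint _) n) = N.res f (N.tr p (N.res (toPoint A) n))
    rw [← N.mackey _ _ _ _ (pb_isPullback f p), ← N.res_comp]
    exact congrArg (fun g => N.tr (pbFst f p) (N.res g n)) (toPoint_uniq _ _)
  app_tr := by
    rintro X Y f ⟨z⟩
    obtain ⟨A, p, rfl⟩ := overClass_surj z
    exact N.tr_comp p f _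

/-- The Burnside functor corepresents `N ↦ N(G/G)`. -/
def burnsideEquiv (N : SemiMackey.{u, max (u + 1) w} G) :
    (burnside.{u, w} G ⟶ N) ≃ weylFixed N (⊤ : Subgroup G) where
  toFun φ := ⟨φ.app _ ⟨overClass (𝟙 _)⟩, mem_weylFixed_top N _⟩
  invFun n := burnsideLift N n.1
  left_inv φ := by
    refine SemiMackey.hom_ext ?_
    rintro X ⟨z⟩
    obtain ⟨A, p, rfl⟩ := overClass_surj z
    refine (congrArg (N.tr p) (φ.app_res (toPoint A) _).symm).trans
      ((φ.app_tr p _).symm.trans (congrArg (φ.app X) (congrArg ULift.up ?_)))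
    show OverClass.tr p (OverClass.res (toPoint A) (overClass (𝟙 _))) = _
    rw [OverClass.res_mk (isPullback_id_id _), OverClass.tr_mk, Category.id_comp]
  right_inv n := Subtype.ext <| by
    show N.tr (𝟙 _) (N.res (toPoint _) n.1) = n.1
    rw [N.tr_id, toPoint_uniq (toPoint _) (𝟙 _), N.res_id]

/-! ### The case `H = e` -/

/-- The isomorphism `G/e ⟶ G/{1}` between the two realizations of the free orbit. -/
def regularToOrbit (G : Type u) [Group G] [Finite G] : regular G ⟶ orbit (⊥ : Subgroup G) :=
  homMk (fun g : G => (g : G ⧸ (⊥ : Subgroup G))) fun _ _ => rfl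

theorem regularToOrbit_bijective : Function.Bijective (regularToOrbit G) := by
  constructor
  · intro a b h
    have := (QuotientGroup.eq (α := G) (s := ⊥) (a := a) (b := b)).1 h
    exact (inv_mul_eq_one (G := G)).1 (Subgroup.mem_bot.1 this)
  · intro z
    induction z using QuotientGroup.induction_on with
    | H a => exact ⟨a, rfl⟩

/-- `M(G/e)^G` is the fixed part of `M(G/{1})`. -/
noncomputable def evEquiv (N : SemiMackey.{u, v} G) :
    (ev G).obj N ≃ weylFixed N (⊥ : Subgroup G) :=
  (fixedEquiv N (regularToOrbit G) regularToOrbit_bijective rightMul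
    (weylMap (⊥ : Subgroup G))
    (fun g => ⟨QuotientGroup.mk (⟨g, by rw [Subgroup.normalizer_eq_top]; trivial⟩ :
      Subgroup.normalizer ((⊥ : Subgroup G) : Set G)), rfl⟩)
    (fun k => by
      induction k using QuotientGroup.induction_on with
      | H n => exact ⟨n.1, rfl⟩)).symm

/-- `ℒ^G_ℕ` corepresents `N ↦ N(G/{1})^G`. -/
noncomputable def natFreeEquiv {ℒG : CommMonCat.{v} ⥤ SemiMackey.{u, v} G} (adj : ℒG ⊣ ev G)
    (N : SemiMackey.{u, v} G) : (ℒG.obj natMon ⟶ N) ≃ weylFixed N (⊥ : Subgroup G) :=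
  (adj.homEquiv _ _).trans <| (natMonEquiv _).trans (evEquiv N)

theorem evEquiv_map {N N' : SemiMackey.{u, v} G} (g : N ⟶ N') (x : (ev G).obj N) :
    (evEquiv N' (((ev G).map g).hom x)).1 = g.app _ (evEquiv N x).1 := by
  obtain ⟨y, rfl⟩ := (evEquiv N).symm.surjective x
  rw [Equiv.apply_symm_apply]
  have h : ((ev G).map g).hom ((evEquiv N).symm y) =
      (evEquiv N').symm ⟨g.app _ y.1, fun k => (g.app_res _ _).symm.trans
        (congrArg _ (y.2 k))⟩ :=
    Subtype.ext (g.app_res _ _)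
  rw [h, Equiv.apply_symm_apply]

theorem natFreeEquiv_comp {ℒG : CommMonCat.{v} ⥤ SemiMackey.{u, v} G} (adj : ℒG ⊣ ev G)
    {N N' : SemiMackey.{u, v} G} (φ : ℒG.obj natMon ⟶ N) (g : N ⟶ N') :
    (natFreeEquiv adj N' (φ ≫ g)).1 = g.app _ (natFreeEquiv adj N φ).1 := by
  have h1 : natFreeEquiv adj N' (φ ≫ g) = evEquiv N' (natMonEquiv _
      (adj.homEquiv _ _ φ ≫ (ev G).map g)) := by
    rw [← adj.homEquiv_naturality_right]
    rfl
  rw [h1, natMonEquiv_comp]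
  exact evEquiv_map g _

end

/-! ### Polynomial Tambara functors -/

namespace TensorFunctor

variable {G : Type u} [Group G] (Θ : TensorFunctor.{u, v} G)

theorem ι_eq (T S : Tambara.{u, v} G) : Θ.ι T S = (Θ.isTensor T S).inl :=
  Tambara.hom_ext fun X t => Θ.ι_apply T S X t

theorem ι_map {T S S' : Tambara.{u, v} G} (σ : S ⟶ S') :
    Θ.ι T S ≫ Θ.functor.map (X := (T, S)) (Y := (T, S')) (𝟙 T, σ) = Θ.ι T S' :=
  Tambara.hom_ext fun X t => by
    show (Θ.functor.map _).app X ((Θ.ι T S).app X t) = _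
    rw [Θ.ι_apply, Θ.ι_apply, Θ.map_symbol, Tambara.map_unit]
    rfl

/-- The second coprojection is compatible with change of the first factor; this makes the bijections
for `T[M]` compatible with change of `T`. -/
theorem inr_map {T T' S : Tambara.{u, v} G} (τ : T ⟶ T') :
    (Θ.isTensor T S).inr ≫ Θ.functor.map (X := (T, S)) (Y := (T', S)) (τ, 𝟙 S) =
      (Θ.isTensor T' S).inr :=
  Tambara.hom_ext fun X s => by
    show (Θ.functor.map _).app X ((Θ.isTensor T S).inr.app X s) = _
    rw [IsTensor.inr_app, IsTensor.inr_app, Θ.map_symbol, Tambara.map_unit]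
    rfl

variable (𝒯 : SemiMackey.{u, v} G ⥤ Tambara.{u, v} G)

/-- Isomorphic semi-Mackey functors `M` give isomorphic `T`-Tambara functors `T[M]`, naturally in
`T`. -/
theorem exists_polIso {M M' : SemiMackey.{u, v} G} (e : M ≅ M') :
    ∃ Φ : Θ.pol 𝒯 M ≅ Θ.pol 𝒯 M', ∀ T, Θ.polι 𝒯 T M ≫ Φ.hom.app T = Θ.polι 𝒯 T M' := by
  refine ⟨NatIso.ofComponents
    (fun T => Θ.functor.mapIso ((Iso.refl T).prod (𝒯.mapIso e))) fun {T T'} τ => ?_,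
    fun T => Θ.ι_map (𝒯.map e.hom)⟩
  refine (Θ.functor.map_comp _ _).symm.trans (Eq.trans ?_ (Θ.functor.map_comp _ _))
  refine congrArg (fun f => Θ.functor.map f) (Prod.ext ?_ ?_)
  · exact (Category.comp_id τ).trans (Category.id_comp τ).symm
  · show 𝒯.map (𝟙 M) ≫ 𝒯.map e.hom = 𝒯.map e.hom ≫ 𝒯.map (𝟙 M')
    rw [𝒯.map_id, 𝒯.map_id, Category.comp_id, Category.id_comp]

variable {𝒯}

/-- Morphisms `T[M] ⟶ S` of `T`-Tambara functors are morphisms `M ⟶ S^μ`. -/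
noncomputable def polUnderEquiv (adj : 𝒯 ⊣ Tambara.mu G) (T : Tambara.{u, v} G)
    (M : SemiMackey.{u, v} G) (S : Under T) :
    (Θ.polUnder 𝒯 T M ⟶ S) ≃ (M ⟶ S.right.mult) :=
  ((Θ.isTensor T (𝒯.obj M)).underEquiv (Θ.ι_eq T (𝒯.obj M)) S).trans (adj.homEquiv M S.right)

theorem polUnderEquiv_comp (adj : 𝒯 ⊣ Tambara.mu G) {T : Tambara.{u, v} G}
    {M : SemiMackey.{u, v} G} {S S' : Under T} (φ : Θ.polUnder 𝒯 T M ⟶ S) (g : S ⟶ S') :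
    Θ.polUnderEquiv adj T M S' (φ ≫ g) =
      Θ.polUnderEquiv adj T M S φ ≫ (Tambara.mu G).map g.right :=
  adj.homEquiv_naturality_right _ _

theorem polUnderEquiv_map (adj : 𝒯 ⊣ Tambara.mu G) {T T' : Tambara.{u, v} G} (τ : T ⟶ T')
    {M : SemiMackey.{u, v} G} {S : Under T'} (φ : Θ.polUnder 𝒯 T' M ⟶ S)
    (ψ : Θ.polUnder 𝒯 T M ⟶ (Under.map τ).obj S)
    (h : ψ.right = (Θ.pol 𝒯 M).map τ ≫ φ.right) :
    Θ.polUnderEquiv adj T M ((Under.map τ).obj S) ψ = Θ.polUnderEquiv adj T' M S φ := by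
  refine congrArg (adj.homEquiv M S.right) ?_
  show (Θ.isTensor T (𝒯.obj M)).inr ≫ ψ.right = (Θ.isTensor T' (𝒯.obj M)).inr ≫ φ.right
  have h' : (Θ.pol 𝒯 M).map τ =
      Θ.functor.map (X := (T, 𝒯.obj M)) (Y := (T', 𝒯.obj M)) (τ, 𝟙 _) := by
    rw [← 𝒯.map_id]
    rfl
  refine (congrArg ((Θ.isTensor T (𝒯.obj M)).inr ≫ ·)
    (h.trans (congrArg (· ≫ φ.right) h'))).trans ?_
  exact (Category.assoc _ _ _).symm.trans (congrArg (· ≫ φ.right) (Θ.inr_map τ))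

end TensorFunctor

theorem mainTheorem2 (G : Type u) [Group G] [Finite G] :
    -- the functors entering the construction exist
    (Tambara.mu.{u, max (u + 1) w} G).IsRightAdjoint ∧
    Nonempty (TensorFunctor.{u, max (u + 1) w} G) ∧
    (ev.{u, max (u + 1) w} G).IsRightAdjoint ∧
    (∀ H : Subgroup G, (ev.{u, max (u + 1) w} (Weyl H)).IsRightAdjoint) ∧
    (∀ H : Subgroup G, (compBiset.{u, max (u + 1) w} H).IsRightAdjoint) ∧
    -- and, for all choices of them, the construction has the stated properties
    ∀ (Θ : TensorFunctor.{u, max (u + 1) w} G)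
      (𝒯 : SemiMackey.{u, max (u + 1) w} G ⥤ Tambara.{u, max (u + 1) w} G)
      (_ : 𝒯 ⊣ Tambara.mu G)
      (ℒG : CommMonCat.{max (u + 1) w} ⥤ SemiMackey.{u, max (u + 1) w} G)
      (_ : ℒG ⊣ ev G)
      (ℒ : ∀ H : Subgroup G,
        CommMonCat.{max (u + 1) w} ⥤ SemiMackey.{u, max (u + 1) w} (Weyl H))
      (_ : ∀ H : Subgroup G, ℒ H ⊣ ev (Weyl H))
      (L : ∀ H : Subgroup G,
        SemiMackey.{u, max (u + 1) w} (Weyl H) ⥤ SemiMackey.{u, max (u + 1) w} G)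
      (_ : ∀ H : Subgroup G, L H ⊣ compBiset H),
      -- the bijections `T-Tam(T[𝔛_H], S) ≃ S(G/H)^{N_G(H)/H}`
      (∀ H : Subgroup G,
        ∃ θ : ∀ (T : Tambara.{u, max (u + 1) w} G) (S : Under T),
            (Θ.polUnder 𝒯 T (frakX (ℒ H) (L H)) ⟶ S) ≃ weylFixed S.right.mult H,
          -- natural in `S`
          (∀ (T : Tambara.{u, max (u + 1) w} G) (S S' : Under T) (g : S ⟶ S')
              (φ : Θ.polUnder 𝒯 T (frakX (ℒ H) (L H)) ⟶ S),
            (θ T S' (φ ≫ g)).1 = g.right.app (FinGSet.orbit H) (θ T S φ).1) ∧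
          -- natural in `T`
          (∀ (T T' : Tambara.{u, max (u + 1) w} G) (τ : T ⟶ T') (S : Under T')
              (φ : Θ.polUnder 𝒯 T' (frakX (ℒ H) (L H)) ⟶ S)
              (ψ : Θ.polUnder 𝒯 T (frakX (ℒ H) (L H)) ⟶ (Under.map τ).obj S),
            ψ.right = (Θ.pol 𝒯 (frakX (ℒ H) (L H))).map τ ≫ φ.right →
              (θ T ((Under.map τ).obj S) ψ).1 = (θ T' S φ).1)) ∧
      -- `H = G`: the polynomial Tambara functors `T[X] = T[𝔄^α]`
      Nonempty (frakX (ℒ ⊤) (L ⊤) ≅ burnside.{u, w} G) ∧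
      (∃ Φ : Θ.pol 𝒯 (frakX (ℒ ⊤) (L ⊤)) ≅ Θ.pol 𝒯 (burnside.{u, w} G),
        ∀ T, Θ.polι 𝒯 T (frakX (ℒ ⊤) (L ⊤)) ≫ Φ.hom.app T = Θ.polι 𝒯 T (burnside.{u, w} G)) ∧
      -- `H = e`: the polynomial Tambara functors `T[x] = T[ℒ^G_ℕ]`
      Nonempty (frakX (ℒ ⊥) (L ⊥) ≅ ℒG.obj natMon) ∧
      (∃ Ψ : Θ.pol 𝒯 (frakX (ℒ ⊥) (L ⊥)) ≅ Θ.pol 𝒯 (ℒG.obj natMon),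
        ∀ T, Θ.polι 𝒯 T (frakX (ℒ ⊥) (L ⊥)) ≫ Ψ.hom.app T = Θ.polι 𝒯 T (ℒG.obj natMon)) := by
  refine ⟨mu_isRightAdjoint G, ⟨tensorFunctor G⟩, ev_isRightAdjoint G,
    fun H => ev_isRightAdjoint (Weyl H), compBiset_isRightAdjoint G, ?_⟩
  intro Θ 𝒯 adj ℒG adjG ℒ adjℒ L adjL
  -- `e` and `e'` identify objects corepresenting the same functor
  obtain ⟨e⟩ := nonempty_iso_of_equiv (fun N => weylFixed N (⊤ : Subgroup G))
    (frakXEquiv (adjℒ ⊤) (adjL ⊤)) burnsideEquiv (frakXEquiv_comp (adjℒ ⊤) (adjL ⊤))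
    (fun _ _ => rfl)
  obtain ⟨e'⟩ := nonempty_iso_of_equiv (fun N => weylFixed N (⊥ : Subgroup G))
    (frakXEquiv (adjℒ ⊥) (adjL ⊥)) (natFreeEquiv adjG) (frakXEquiv_comp (adjℒ ⊥) (adjL ⊥))
    (natFreeEquiv_comp adjG)
  refine ⟨fun H => ⟨fun T S => (Θ.polUnderEquiv adj T _ S).trans
    (frakXEquiv (adjℒ H) (adjL H) S.right.mult), ?_, ?_⟩, ⟨e⟩, Θ.exists_polIso 𝒯 e, ⟨e'⟩,
    Θ.exists_polIso 𝒯 e'⟩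
  · intro T S S' g φ
    exact (congrArg (fun k => (frakXEquiv (adjℒ H) (adjL H) S'.right.mult k).1)
      (Θ.polUnderEquiv_comp adj φ g)).trans (frakXEquiv_comp _ _ _ _)
  · intro T T' τ S φ ψ h
    exact congrArg (fun k => (frakXEquiv (adjℒ H) (adjL H) S.right.mult k).1)
      (Θ.polUnderEquiv_map adj τ φ ψ h)
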